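/- **Setting.** Let $A\in\mathbb R^{n\times n}$ be symmetric with zero diagonal and let $\mathcal D(A,0)$ be the zero-field Ising model on $\{-1,1\}^n$, $\Pr[Z=z]\propto\exp\big(\sum_{i<j}A_{ij}z_iz_j\big)$, with dependency graph $G$ ($i\sim j$ iff $A_{ij}\neq0$). Let $\lambda>0$ satisfy $\sum_j|A_{ij}|\le\lambda$ for all $i$, and let the known numbers $p_i$ satisfy $0\le p_i\le p_{\max}<1$. A corrupted sample $X$ is obtained from $Z\sim\mathcal D(A,0)$ by erasing every entry $Z_i$ independently with probability $p_i$; an erased entry is recorded as $X_i=0$, otherwise $X_i=Z_i$. **Algorithm for a vertex $u$.** Weights $w\in\mathbb R^{2n-1}$ have coordinates $w_{+j},w_{-j}$ ($j\ne u$) and one slack coordinate; put $\Pi(w)_j=w_{+j}-w_{-j}$. For $i\neq u$ let $$g^i(w;X)=-\frac{X_u}{1-p_u}\cdot\frac{e^{-\Pi(w)_iX_uX_i}X_i}{1-p_i}\prod_{j\ne i,u}\frac{e^{-\Pi(w)_jX_uX_j}-p_j}{1-p_j},$$ and let $G_{\mathsf{miss}}(w;X)$ have coordinates $g^i$ at $+i$,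 $-g^i$ at $-i$ and $0$ at the slack coordinate. Given independent corrupted samples $X^1,\dots,X^T$, start with $w^1_c=\lambda/(2n-1)$ for all $c$, iterate $$w^{t+1}_c=w^t_c\Big(1-\eta\,G_{\mathsf{miss}}(w^t;X^t)_c+\tfrac{\eta}{\lambda}\langle w^t,G_{\mathsf{miss}}(w^t;X^t)\rangle\Big),$$ and output $\bar w=\bar w^{(u)}=\frac1T\sum_{t=1}^Tw^t$. The step size is $\eta=\min\big\{\frac1{8B},\frac1{2B}\sqrt{\log(2n-1)/T}\big\}$, where $B=(1-p_{\max})^{-2}e^{\lambda/(1-p_{\max})}$. **Theorem.** There is an absolute constant $K>0$, and for all $p_{\max}\in[0,1)$ and $\lambda_0>0$ there is a constant $C>0$ depending only on $p_{\max}$ and $\lambda_0$, such that the following holds for all $n,T,A,p,\lambda$ as above and all $\delta\in(0,1)$. For $L,\epsilon>0$ call $T$ *sufficient for $(L,\epsilon)$* if $$\lambda\ge\lambda_0\ \text{ and }\ T\ge\lambda^4\,L\,e^{C\lambda}\,\epsilon^{-4},\qquad\text{or}\qquad T\ge K\,\frac{\lambda^2(1+\lambda)^2}{(1-p_{\max})^4}\,e^{\left(\frac2{1-p_{\max}}+6\right)\lambda}\,L\,\epsilon^{-4}.$$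 1. For every vertex $u$ and every $\epsilon>0$, if $T$ is sufficient for $(\log(n/\delta),\epsilon)$, then with probability at least $1-\delta$, $|\Pi(\bar w)_i-A_{ui}|\le\epsilon$ for all $i\neq u$. 2. Let $\beta>0$ satisfy $|A_{ij}|\ge\beta$ for every edge. If $T$ is sufficient for $(\log(n^2/\delta),\beta/2)$, then, running the algorithm for every vertex on the same samples, with probability at least $1-\delta$ the sets $\{i\ne u:|\Pi(\bar w^{(u)})_i|\ge\beta/2\}$ are exactly the neighbourhoods in $G$ of all vertices $u$. 3. There is one program for the real random access machine (unit-cost arithmetic, exponential and comparison of reals) which, for all $n,T\ge1$, computes the sets in part 2 from $(n,T,\lambda,\eta,\beta,p,X^1,\dots,X^T)$ in $O(n^2T)$ steps with an absolute constant. In particular, for $n\ge2$, $\lambda\ge\lambda_0$ and $T=\lceil\lambda^4\log(n^2/\delta)e^{C\lambda}(\beta/2)^{-4}\rceil$, it outputs the graph $G$ with probability at least $1-\delta$, and it always takes at most $M\,n^2\log(n/\delta)$ steps, i.e. $\widetilde O(n^2)$, where $M$ depends only on $p_{\max},\lambda_0,\lambda,\beta$. -/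

import Mathlib

open MeasureTheory

noncomputable section

namespace IsingMissing

/-! ### Ising models and missing data -/

/-- A spin `±1`, coded by a Boolean (`true` is `+1`). -/
def spin (b : Bool) : ℝ := if b then 1 else -1

/-- The exponent `∑_{i<j} A i j z_i z_j + ∑ i, θ_i z_i`. For symmetric `A` every unordered pair is
counted once, and pairs that are not edges contribute `0`. -/
def isingExponent {n : ℕ} (A : Matrix (Fin n) (Fin n) ℝ) (θ : Fin n → ℝ) (z : Fin n → Bool) : ℝ :=
  (∑ i, ∑ j, if i < j then A i j * spin (z i) * spin (z j) else 0) + ∑ i, θ i * spin (z i)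

/-- The normalizing factor. -/
def partitionFn {n : ℕ} (A : Matrix (Fin n) (Fin n) ℝ) (θ : Fin n → ℝ) : ℝ :=
  ∑ z : Fin n → Bool, Real.exp (isingExponent A θ z)

/-- The Ising model `D(A, θ)` as a measure on spin configurations. -/
def isingLaw {n : ℕ} (A : Matrix (Fin n) (Fin n) ℝ) (θ : Fin n → ℝ) : Measure (Fin n → Bool) :=
  ∑ z : Fin n → Bool,
    ENNReal.ofReal (Real.exp (isingExponent A θ z) / partitionFn A θ) • Measure.dirac z

/-- The dependency graph: `i ~ j` iff `A i j ≠ 0` (for symmetric `A` with zero diagonal). -/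
def depGraph {n : ℕ} (A : Matrix (Fin n) (Fin n) ℝ) : SimpleGraph (Fin n) :=
  SimpleGraph.fromRel fun i j => A i j ≠ 0

/-- An observed entry: `none` is a missing entry, `some b` an observed spin. -/
abbrev Entry : Type := Option Bool

instance instMeasurableSpaceEntry : MeasurableSpace Entry := ⊤

instance instDiscreteMeasurableSpaceEntry : DiscreteMeasurableSpace Entry := ⟨fun _ => trivial⟩

/-- Numerical value of an observed entry, a missing entry being replaced by `0`. -/
def entryVal : Entry → ℝ
  | none => 0
  | some b => spin b

/-- The Bernoulli law on `Bool` with `P(true) = r`. -/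
def bernoulliLaw (r : ℝ) : Measure Bool :=
  ENNReal.ofReal r • Measure.dirac true + ENNReal.ofReal (1 - r) • Measure.dirac false

/-- The law of one corrupted sample: draw `Z ∼ D(A, θ)` and, independently, independent
`C_i ∼ Ber(1 - p_i)`; the entry `Z_i` is observed if `C_i` holds and is missing otherwise. -/
def missLaw {n : ℕ} (A : Matrix (Fin n) (Fin n) ℝ) (θ p : Fin n → ℝ) : Measure (Fin n → Entry) :=
  ((isingLaw A θ).prod (Measure.pi fun i => bernoulliLaw (1 - p i))).map
    fun zc i => if zc.2 i then some (zc.1 i) else none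

/-- The law of `T` independent corrupted samples. -/
def sampleLaw {n : ℕ} (A : Matrix (Fin n) (Fin n) ℝ) (θ p : Fin n → ℝ) (T : ℕ) :
    Measure (Fin T → Fin n → Entry) :=
  Measure.pi fun _ => missLaw A θ p

/-! ### Stochastic multiplicative gradient descent for the neighbourhood of a vertex -/

/-- The vertices other than `u`. -/
abbrev Others {n : ℕ} (u : Fin n) : Type := {j : Fin n // j ≠ u}

/-- The `2 (n - 1) + 1 = 2 n - 1` coordinates of the simplex: a positive and a negative copy of
every vertex other than `u`, and one slack coordinate. -/
inductive Coord {n : ℕ} (u : Fin n) : Type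
  | pos (j : Others u)
  | neg (j : Others u)
  | slack
  deriving DecidableEq, Fintype

/-- The map from the simplex to the `ℓ¹` ball. -/
def simplexToBall {n : ℕ} {u : Fin n} (w : Coord u → ℝ) (j : Others u) : ℝ :=
  w (.pos j) - w (.neg j)

/-- The estimator of the `i`-th partial derivative of the interaction screening objective. -/
def gMiss {n : ℕ} {u : Fin n} (p : Fin n → ℝ) (w : Coord u → ℝ) (x : Fin n → Entry)
    (i : Others u) : ℝ :=
  -(entryVal (x u) / (1 - p u)) *
    (Real.exp (-(simplexToBall w i) * entryVal (x u) * entryVal (x i)) * entryVal (x i) /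
      (1 - p i)) *
    ∏ j ∈ Finset.univ.erase i,
      (Real.exp (-(simplexToBall w j) * entryVal (x u) * entryVal (x j)) - p j) / (1 - p j)

/-- The gradient estimator on the simplex. -/
def GMiss {n : ℕ} {u : Fin n} (p : Fin n → ℝ) (w : Coord u → ℝ) (x : Fin n → Entry) :
    Coord u → ℝ
  | .pos i => gMiss p w x i
  | .neg i => -gMiss p w x i
  | .slack => 0

/-- One multiplicative update, with `l1` bound `lam` and step size `η`. -/
def smgStep {n : ℕ} {u : Fin n} (p : Fin n → ℝ) (lam η : ℝ) (w : Coord u → ℝ)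
    (x : Fin n → Entry) (c : Coord u) : ℝ :=
  w c * (1 - η * GMiss p w x c + η * ((∑ d, w d * GMiss p w x d) / lam))

/-- The iterates; `smgIter … t` is the iterate after `t` updates (so index `0` is the uniform
starting point), and it uses the first `t` samples. -/
def smgIter {n T : ℕ} (u : Fin n) (p : Fin n → ℝ) (lam η : ℝ) (X : Fin T → Fin n → Entry) :
    ℕ → Coord u → ℝ
  | 0 => fun _ => lam / (2 * (n : ℝ) - 1)
  | t + 1 =>
    if h : t < T then smgStep p lam η (smgIter u p lam η X t) (X ⟨t, h⟩)
    else smgIter u p lam η X t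

/-- The output of the algorithm: the average of the first `T` iterates. -/
def smgOutput {n T : ℕ} (u : Fin n) (p : Fin n → ℝ) (lam η : ℝ) (X : Fin T → Fin n → Entry)
    (c : Coord u) : ℝ :=
  (∑ t ∈ Finset.range T, smgIter u p lam η X t c) / T

/-- The sup-norm bound for the gradient estimator, for missing probabilities at most `q`. -/
def gradBound (q lam : ℝ) : ℝ := Real.exp (lam / (1 - q)) / (1 - q) ^ 2

/-- The step size `min (1 / (8 B)) ((1 / (2 B)) √(log (2 n - 1) / T))`. -/
def stepSize (q lam : ℝ) (n T : ℕ) : ℝ :=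
  min (1 / (8 * gradBound q lam))
    (1 / (2 * gradBound q lam) * Real.sqrt (Real.log (2 * (n : ℝ) - 1) / T))

/-- The estimated neighbourhood of `u`: threshold the estimated weights at `β / 2`. -/
def estNeighbors {n T : ℕ} (p : Fin n → ℝ) (lam η β : ℝ) (X : Fin T → Fin n → Entry)
    (u : Fin n) : Set (Fin n) :=
  {i | ∃ h : i ≠ u, β / 2 ≤ |simplexToBall (smgOutput u p lam η X) ⟨i, h⟩|}

/-! ### Numbers of samples -/

/-- `lam⁴ · L · exp (C lam) · ε⁻⁴`. -/
def sampleBound (C lam L ε : ℝ) : ℝ := lam ^ 4 * L * Real.exp (C * lam) * (ε ^ 4)⁻¹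

/-- `K · lam² (1 + lam)² / (1 - q)⁴ · exp ((2 / (1 - q) + 6) lam) · L · ε⁻⁴`. -/
def explicitBound (K q lam L ε : ℝ) : ℝ :=
  K * (lam ^ 2 * (1 + lam) ^ 2 / (1 - q) ^ 4) * Real.exp ((2 / (1 - q) + 6) * lam) * L * (ε ^ 4)⁻¹

/-! ### A real random access machine with a step count -/

/-- Memory: index registers holding natural numbers, and two-dimensional real arrays
(`mem a i j` is the entry `(i, j)` of the array with name `a`). -/
structure RAMState where
  idx : ℕ → ℕ
  mem : ℕ → ℕ → ℕ → ℝ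

/-- A reference to an array entry: the name of the array and the names of the two index registers
that hold the row and the column. -/
structure Ref where
  arr : ℕ
  row : ℕ
  col : ℕ

/-- The binary arithmetic operations on real numbers. -/
inductive ArithOp
  | add
  | sub
  | mul
  | div

def ArithOp.eval : ArithOp → ℝ → ℝ → ℝ
  | .add, x, y => x + y
  | .sub, x, y => x - y
  | .mul, x, y => x * y
  | .div, x, y => x / y

/-- Programs. Every program is a fixed finite text; it does not depend on the size of the input. -/
inductive Prog
  | skip
  | seq (P Q : Prog)
  /-- set an index register to a constant, copy it, increase it or decrease it by one -/
  | idxConst (r k : ℕ)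
  | idxCopy (r s : ℕ)
  | idxSucc (r : ℕ)
  | idxPred (r : ℕ)
  /-- real assignments: an integer constant, a copy, an arithmetic operation, an exponential -/
  | const (d : Ref) (k : ℤ)
  | copy (d a : Ref)
  | arith (o : ArithOp) (d a b : Ref)
  | exp (d a : Ref)
  /-- branch on a strict comparison of two index registers -/
  | ifLt (r s : ℕ) (P Q : Prog)
  /-- branch on a comparison `a ≤ b` of two real numbers -/
  | ifLe (a b : Ref) (P Q : Prog)
  /-- for `r = 0, 1, …, s - 1` do `P`; the number of rounds is read off register `s` at the start -/
  | loop (r s : ℕ) (P : Prog)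

namespace RAMState

def get (σ : RAMState) (a : Ref) : ℝ := σ.mem a.arr (σ.idx a.row) (σ.idx a.col)

def setIdx (σ : RAMState) (r k : ℕ) : RAMState := { σ with idx := Function.update σ.idx r k }

def set (σ : RAMState) (d : Ref) (v : ℝ) : RAMState :=
  { σ with
    mem := fun a i j =>
      if a = d.arr ∧ i = σ.idx d.row ∧ j = σ.idx d.col then v else σ.mem a i j }

end RAMState

open Classical in
/-- Execution: the final state and the number of steps. Every elementary instruction, every test
and every round of a loop costs one step (on top of the body). -/
def Prog.exec : Prog → RAMState → RAMState × ℕ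
  | .skip, σ => (σ, 1)
  | .seq P Q, σ => ((Q.exec (P.exec σ).1).1, (P.exec σ).2 + (Q.exec (P.exec σ).1).2)
  | .idxConst r k, σ => (σ.setIdx r k, 1)
  | .idxCopy r s, σ => (σ.setIdx r (σ.idx s), 1)
  | .idxSucc r, σ => (σ.setIdx r (σ.idx r + 1), 1)
  | .idxPred r, σ => (σ.setIdx r (σ.idx r - 1), 1)
  | .const d k, σ => (σ.set d k, 1)
  | .copy d a, σ => (σ.set d (σ.get a), 1)
  | .arith o d a b, σ => (σ.set d (o.eval (σ.get a) (σ.get b)), 1)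
  | .exp d a, σ => (σ.set d (Real.exp (σ.get a)), 1)
  | .ifLt r s P Q, σ =>
    if σ.idx r < σ.idx s then ((P.exec σ).1, (P.exec σ).2 + 1)
    else ((Q.exec σ).1, (Q.exec σ).2 + 1)
  | .ifLe a b P Q, σ =>
    if σ.get a ≤ σ.get b then ((P.exec σ).1, (P.exec σ).2 + 1)
    else ((Q.exec σ).1, (Q.exec σ).2 + 1)
  | .loop r s P, σ =>
    Nat.rec (σ, 1)
      (fun k τ => ((P.exec (τ.1.setIdx r k)).1, τ.2 + (P.exec (τ.1.setIdx r k)).2 + 1))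
      (σ.idx s)

/-- The initial state. Registers `0` and `1` hold `n` and `T`; array `0` holds the parameters
`lam, η, β`, array `1` the missing probabilities, array `2` the samples (a missing entry being
coded by `0`); everything else is `0`. -/
def inputState {n T : ℕ} (p : Fin n → ℝ) (lam η β : ℝ) (X : Fin T → Fin n → Entry) : RAMState where
  idx r := if r = 0 then n else if r = 1 then T else 0
  mem a i j :=
    if a = 0 ∧ i = 0 ∧ j = 0 then lam
    else if a = 0 ∧ i = 0 ∧ j = 1 then η
    else if a = 0 ∧ i = 0 ∧ j = 2 then β
    else if h : a = 1 ∧ i = 0 ∧ j < n then p ⟨j, h.2.2⟩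
    else if h : a = 2 ∧ i < T ∧ j < n then entryVal (X ⟨i, h.2.1⟩ ⟨j, h.2.2⟩)
    else 0

/-- The output of a program: the `n × n` array with name `3` in the final state. -/
def Prog.output {n T : ℕ} (P : Prog) (p : Fin n → ℝ) (lam η β : ℝ) (X : Fin T → Fin n → Entry)
    (u i : Fin n) : ℝ :=
  (P.exec (inputState p lam η β X)).1.mem 3 u i

/-- The number of steps of a program. -/
def Prog.steps {n T : ℕ} (P : Prog) (p : Fin n → ℝ) (lam η β : ℝ) (X : Fin T → Fin n → Entry) :
    ℕ :=
  (P.exec (inputState p lam η β X)).2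

end IsingMissing

end

open IsingMissing

/-!
Write `v* = A_u` for the row of the interaction matrix at `u`. Flipping the spin `u` makes the
gradient of the interaction screening objective `v ↦ E exp (-z_u ∑ v_k z_k)` odd at `v*`, so it
vanishes there; flipping the spin `i` shows that no coordinate is close to determined by the others,
whence `exp (-3λ) / (1 + 2λ) * (v_i - v*_i)² ≤ ⟨v - v*, ∇(v)⟩` for every single coordinate `i`.
Dividing by the observation probabilities undoes the erasures in expectation, so `G_miss` is an
unbiased estimator of the gradient, bounded by `B`.

The potential `∑ y_c log w_c` bounds the regret of the multiplicative weights along every sample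
path. Since `w^t` depends on the samples before time `t` only, the differences between `∇(w^t)` and
`G_miss(w^t; X^t)` are martingale differences, and Azuma–Hoeffding turns the regret bound into
`(1/T) ∑_t ⟨w^t - v*, ∇(w^t)⟩ = O(λ B √(L / T))`; Jensen passes to the averaged iterate. For
`λ ≥ λ₀` the polynomial prefactors are absorbed into `exp (C λ)`.

For the running time, the products over `j ≠ i, u` needed for all `i` are obtained without division
from prefix products in a forward pass and suffix products in a backward pass, so that one gradient
step costs `O(n)`.
-/

noncomputable section

namespace IsingMissing

/-! ### Spins and spin flips -/

section Spins

lemma abs_spin (b : Bool) : |spin b| = 1 := by cases b <;> simp [spin]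

lemma spin_not (b : Bool) : spin (!b) = -spin b := by cases b <;> simp [spin]

lemma abs_neg_spin_mul (b : Bool) (x : ℝ) : |-spin b * x| = |x| := by
  rw [abs_mul, abs_neg, abs_spin, one_mul]

lemma abs_sum_mul_spin_le {ι : Type*} [Fintype ι] (a : ι → ℝ) (s : ι → Bool) :
    |∑ j, a j * spin (s j)| ≤ ∑ j, |a j| :=
  (Finset.abs_sum_le_sum_abs _ _).trans_eq (by simp only [abs_mul, abs_spin, mul_one])

variable {ι : Type*} [DecidableEq ι]

/-- The configuration `z` with the spin at `u` reversed: the reflection of the hypercube used in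
all symmetrization arguments below. -/
def flipSpin (u : ι) (z : ι → Bool) : ι → Bool := Function.update z u (!z u)

lemma flipSpin_flipSpin (u : ι) (z : ι → Bool) : flipSpin u (flipSpin u z) = z := by
  simp [flipSpin]

lemma spin_flipSpin_self (u : ι) (z : ι → Bool) : spin (flipSpin u z u) = -spin (z u) := by
  simp [flipSpin, spin_not]

lemma spin_flipSpin_of_ne {u j : ι} (h : j ≠ u) (z : ι → Bool) :
    spin (flipSpin u z j) = spin (z j) := by simp [flipSpin, h]

variable [Fintype ι]

lemma sum_comp_flipSpin {M : Type*} [AddCommMonoid M] (u : ι) (f : (ι → Bool) → M) :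
    ∑ z, f (flipSpin u z) = ∑ z, f z :=
  Equiv.sum_comp (Function.Involutive.toPerm (flipSpin u) (flipSpin_flipSpin u)) f

/-- Anti-concentration: a statistic that jumps by `2 |d|` at a flip cannot be small at both ends of
the flip, and the weights of the two ends are comparable. -/
lemma mul_sq_mul_sum_le_sum_mul_sq {μ q : (ι → Bool) → ℝ} {c d : ℝ} {i : ι} (hμ : ∀ z, 0 ≤ μ z)
    (hc0 : 0 ≤ c) (hc1 : c ≤ 1) (hflip : ∀ z, c * μ (flipSpin i z) ≤ μ z)
    (hq : ∀ z, |q z - q (flipSpin i z)| = 2 * |d|) :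
    c * d ^ 2 * ∑ z, μ z ≤ ∑ z, μ z * q z ^ 2 := by
  have hjump (z) : 2 * d ^ 2 ≤ q z ^ 2 + q (flipSpin i z) ^ 2 := by
    have hsq : (q z - q (flipSpin i z)) ^ 2 = 4 * d ^ 2 := by
      rw [← sq_abs, hq, mul_pow, sq_abs]; norm_num
    nlinarith [sq_nonneg (q z + q (flipSpin i z))]
  have hflipped : ∑ z, c * μ z * q (flipSpin i z) ^ 2 = ∑ z, c * μ (flipSpin i z) * q z ^ 2 := by
    rw [← sum_comp_flipSpin i]
    simp only [flipSpin_flipSpin]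
  have htwo : 2 * (c * d ^ 2 * ∑ z, μ z) ≤ 2 * ∑ z, μ z * q z ^ 2 :=
    calc 2 * (c * d ^ 2 * ∑ z, μ z) = ∑ z, c * μ z * (2 * d ^ 2) := by
          simp only [Finset.mul_sum]
          exact Finset.sum_congr rfl fun z _ => by ring
      _ ≤ ∑ z, c * μ z * (q z ^ 2 + q (flipSpin i z) ^ 2) := by
          gcongr with z
          · exact mul_nonneg hc0 (hμ z)
          · exact hjump z
      _ = ∑ z, c * μ z * q z ^ 2 + ∑ z, c * μ (flipSpin i z) * q z ^ 2 := by
          rw [← hflipped, ← Finset.sum_add_distrib]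
          simp only [mul_add]
      _ ≤ ∑ z, μ z * q z ^ 2 + ∑ z, μ z * q z ^ 2 := by
          gcongr with z _ z
          · exact mul_le_of_le_one_left (hμ z) hc1
          · exact hflip z
      _ = 2 * ∑ z, μ z * q z ^ 2 := (two_mul _).symm
  linarith

end Spins

/-! ### The Ising model -/

lemma two_mul_sum_sum_ite_lt {ι R : Type*} [LinearOrder ι] [Fintype ι] [NonAssocSemiring R]
    {f : ι → ι → R} (hsymm : ∀ i j, f i j = f j i) (hdiag : ∀ i, f i i = 0) :
    2 * ∑ i, ∑ j, (if i < j then f i j else 0) = ∑ i, ∑ j, f i j := by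
  have hlower : ∑ i, ∑ j, (if j < i then f i j else 0) =
      ∑ i, ∑ j, if i < j then f i j else 0 := by
    rw [Finset.sum_comm]
    simp only [hsymm]
  rw [two_mul]
  nth_rewrite 2 [← hlower]
  simp only [← Finset.sum_add_distrib]
  refine Finset.sum_congr rfl fun i _ => Finset.sum_congr rfl fun j _ => ?_
  rcases lt_trichotomy i j with h | rfl | h
  · simp [h, h.not_gt]
  · simp [hdiag]
  · simp [h, h.not_gt]

section Ising

variable {n : ℕ} {A : Matrix (Fin n) (Fin n) ℝ} {θ : Fin n → ℝ} {lam : ℝ}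

lemma isingExponent_sub_flipSpin (hA : A.IsSymm) (hd : ∀ i, A i i = 0) (u : Fin n)
    (z : Fin n → Bool) :
    isingExponent A θ z - isingExponent A θ (flipSpin u z) =
      2 * (spin (z u) * (∑ j, A u j * spin (z j) + θ u)) := by
  set D : Fin n → Fin n → ℝ := fun i j => A i j * spin (z i) * spin (z j) -
    A i j * spin (flipSpin u z i) * spin (flipSpin u z j)
  have hD (i j) : D i j = (if i = u then 2 * (spin (z u) * (A u j * spin (z j))) else 0) +
      if j = u then 2 * (spin (z u) * (A u i * spin (z i))) else 0 := by
    by_cases hi : i = u <;> by_cases hj : j = u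
    · subst hi; subst hj; simp [D, hd]
    · subst hi; simp only [D, spin_flipSpin_self, spin_flipSpin_of_ne hj, hj, if_true, if_false]
      ring
    · subst hj; simp only [D, spin_flipSpin_self, spin_flipSpin_of_ne hi, hi, if_true, if_false]
      rw [hA.apply j i]; ring
    · simp [D, spin_flipSpin_of_ne hi, spin_flipSpin_of_ne hj, hi, hj]
  have hDsum : 2 * ∑ i, ∑ j, (if i < j then D i j else 0) =
      2 * (2 * (spin (z u) * ∑ j, A u j * spin (z j))) := by
    rw [two_mul_sum_sum_ite_lt (fun i j => by rw [hD, hD, add_comm]) (fun i => by simp [D, hd i])]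
    simp_rw [hD, Finset.sum_add_distrib]
    rw [Finset.sum_comm]
    simp only [Finset.sum_ite_eq', Finset.mem_univ, if_true, ← Finset.mul_sum]
    ring
  have hfield : ∑ i, θ i * spin (z i) - ∑ i, θ i * spin (flipSpin u z i) =
      2 * (spin (z u) * θ u) := by
    rw [← Finset.sum_sub_distrib, Finset.sum_eq_single u]
    · rw [spin_flipSpin_self]; ring
    · intro j _ hj
      rw [spin_flipSpin_of_ne hj, sub_self]
    · simp
  have hpair : (∑ i, ∑ j, if i < j then A i j * spin (z i) * spin (z j) else 0) -
      (∑ i, ∑ j, if i < j then A i j * spin (flipSpin u z i) * spin (flipSpin u z j) else 0) =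
      ∑ i, ∑ j, if i < j then D i j else 0 := by
    simp only [← Finset.sum_sub_distrib]
    refine Finset.sum_congr rfl fun i _ => Finset.sum_congr rfl fun j _ => ?_
    split_ifs <;> simp only [D, sub_zero]
  rw [isingExponent, isingExponent, add_sub_add_comm, hpair, hfield]
  linarith

/-- The probability of the configuration `z` under `D(A, θ)`, i.e. the density of `isingLaw A θ`
with respect to counting measure. -/
def isingWeight (A : Matrix (Fin n) (Fin n) ℝ) (θ : Fin n → ℝ) (z : Fin n → Bool) : ℝ :=
  Real.exp (isingExponent A θ z) / partitionFn A θ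

variable (A θ) in
lemma partitionFn_pos : 0 < partitionFn A θ :=
  Finset.sum_pos (fun _ _ => Real.exp_pos _) Finset.univ_nonempty

variable (A θ) in
lemma isingWeight_pos (z : Fin n → Bool) : 0 < isingWeight A θ z :=
  div_pos (Real.exp_pos _) (partitionFn_pos A θ)

variable (A θ) in
lemma sum_isingWeight : ∑ z, isingWeight A θ z = 1 := by
  simp only [isingWeight]
  rw [← Finset.sum_div]
  exact div_self (partitionFn_pos A θ).ne'

lemma isingWeight_eq_flipSpin_mul_exp (hA : A.IsSymm) (hd : ∀ i, A i i = 0) (u : Fin n)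
    (z : Fin n → Bool) :
    isingWeight A θ z = isingWeight A θ (flipSpin u z) *
      Real.exp (2 * (spin (z u) * (∑ j, A u j * spin (z j) + θ u))) := by
  rw [← isingExponent_sub_flipSpin hA hd, isingWeight, isingWeight, div_mul_eq_mul_div,
    ← Real.exp_add, add_sub_cancel]

lemma exp_neg_mul_isingWeight_flipSpin_le (hA : A.IsSymm) (hd : ∀ i, A i i = 0) {i : Fin n}
    (hrow : ∑ j, |A i j| + |θ i| ≤ lam) (z : Fin n → Bool) :
    Real.exp (-2 * lam) * isingWeight A θ (flipSpin i z) ≤ isingWeight A θ z := by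
  rw [isingWeight_eq_flipSpin_mul_exp hA hd i z, mul_comm]
  refine mul_le_mul_of_nonneg_left (Real.exp_le_exp.2 ?_) (isingWeight_pos _ _ _).le
  have hfield : |spin (z i) * (∑ j, A i j * spin (z j) + θ i)| ≤ lam := by
    rw [abs_mul, abs_spin, one_mul]
    exact ((abs_add_le _ _).trans (add_le_add_left (abs_sum_mul_spin_le _ _) _)).trans hrow
  linarith [neg_le_of_abs_le hfield]

end Ising

/-! ### The interaction screening objective -/

section Screening

variable {n : ℕ} {A : Matrix (Fin n) (Fin n) ℝ} {θ : Fin n → ℝ} {lam : ℝ} {u : Fin n}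

/-- The row `A u ·` without the diagonal entry: the weights that the algorithm estimates. -/
def rowWeights (A : Matrix (Fin n) (Fin n) ℝ) (u : Fin n) (j : Others u) : ℝ := A u j

/-- The linear form `∑ k, v_k z_k`, which is the field at `u` created by the other spins if they
interact with `u` with strengths `v`. -/
def localField (v : Others u → ℝ) (z : Fin n → Bool) : ℝ := ∑ k : Others u, v k * spin (z k)

lemma sum_others_eq_sum {M : Type*} [AddCommMonoid M] (f : Fin n → M) (hf : f u = 0) :
    ∑ j : Others u, f j = ∑ j, f j := by
  rw [Fintype.sum_eq_add_sum_subtype_ne f u, hf, zero_add]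

lemma sum_abs_rowWeights (hd : A u u = 0) : ∑ j, |rowWeights A u j| = ∑ j, |A u j| :=
  sum_others_eq_sum (fun j => |A u j|) (by rw [hd, abs_zero])

lemma localField_rowWeights (hd : A u u = 0) (z : Fin n → Bool) :
    localField (rowWeights A u) z = ∑ j, A u j * spin (z j) :=
  sum_others_eq_sum (fun j => A u j * spin (z j)) (by rw [hd, zero_mul])

lemma localField_add (v v' : Others u → ℝ) (z : Fin n → Bool) :
    localField (v + v') z = localField v z + localField v' z := by
  simp only [localField, Pi.add_apply, add_mul, Finset.sum_add_distrib]

lemma abs_localField_le (v : Others u → ℝ) (z : Fin n → Bool) :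
    |localField v z| ≤ ∑ j, |v j| := abs_sum_mul_spin_le v fun j => z j

lemma localField_flipSpin (v : Others u → ℝ) (z : Fin n → Bool) :
    localField v (flipSpin u z) = localField v z :=
  Finset.sum_congr rfl fun k _ => by rw [spin_flipSpin_of_ne k.2]

lemma localField_sub_flipSpin (v : Others u → ℝ) (i : Others u) (z : Fin n → Bool) :
    localField v z - localField v (flipSpin i z) = 2 * v i * spin (z i) := by
  rw [localField, localField, ← Finset.sum_sub_distrib, Finset.sum_eq_single i]
  · rw [spin_flipSpin_self]; ring
  · intro j _ hj
    rw [spin_flipSpin_of_ne fun h => hj (Subtype.ext h), sub_self]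
  · simp

lemma exp_neg_mul_sq_le_sum_isingWeight_mul_sq (hA : A.IsSymm) (hd : ∀ i, A i i = 0)
    (hlam : 0 ≤ lam) (v : Others u → ℝ) {i : Others u} (hrow : ∑ j, |A i j| + |θ i| ≤ lam) :
    Real.exp (-2 * lam) * v i ^ 2 ≤ ∑ z, isingWeight A θ z * localField v z ^ 2 := by
  have h := mul_sq_mul_sum_le_sum_mul_sq (fun z => (isingWeight_pos A θ z).le)
    (Real.exp_pos _).le (Real.exp_le_one_iff.2 (by linarith))
    (exp_neg_mul_isingWeight_flipSpin_le hA hd hrow) (q := localField v) (d := v i)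
    fun z => by rw [localField_sub_flipSpin, abs_mul, abs_mul, abs_spin, mul_one, abs_two]
  rwa [sum_isingWeight, mul_one] at h

/-- The gradient at `v` of the interaction screening objective `v ↦ E[exp (-z_u ∑ k, v_k z_k)]`. -/
def screeningGrad (A : Matrix (Fin n) (Fin n) ℝ) (θ : Fin n → ℝ) (v : Others u → ℝ)
    (i : Others u) : ℝ :=
  ∑ z, isingWeight A θ z *
    (-spin (z u) * spin (z i) * Real.exp (-spin (z u) * localField v z))

lemma sum_mul_screeningGrad (v d : Others u → ℝ) :
    ∑ j, d j * screeningGrad A θ v j = ∑ z, isingWeight A θ z *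
      (-spin (z u) * localField d z * Real.exp (-spin (z u) * localField v z)) := by
  simp only [screeningGrad, Finset.mul_sum (s := (Finset.univ : Finset (Fin n → Bool)))]
  rw [Finset.sum_comm]
  refine Finset.sum_congr rfl fun z _ => ?_
  rw [show localField d z = ∑ k : Others u, d k * spin (z k) from rfl]
  simp only [Finset.mul_sum, Finset.sum_mul]
  exact Finset.sum_congr rfl fun j _ => by ring

/-- Without a field at `u`, the factor `exp (-z_u ∑ j, A_uj z_j)` cancels the dependence of the
weight on `z_u`, so that the summand is odd in `z_u`. -/
lemma sum_mul_screeningGrad_rowWeights (hA : A.IsSymm) (hd : ∀ i, A i i = 0) (hθ : θ u = 0)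
    (d : Others u → ℝ) : ∑ j, d j * screeningGrad A θ (rowWeights A u) j = 0 := by
  rw [sum_mul_screeningGrad]
  set F : (Fin n → Bool) → ℝ := fun z => isingWeight A θ z * (-spin (z u) * localField d z *
    Real.exp (-spin (z u) * localField (rowWeights A u) z)) with hF
  have hodd (z) : F (flipSpin u z) = -F z := by
    have hexp : Real.exp (- -spin (z u) * localField (rowWeights A u) z) =
        Real.exp (2 * (spin (z u) * localField (rowWeights A u) z)) *
          Real.exp (-spin (z u) * localField (rowWeights A u) z) := by
      rw [← Real.exp_add]; congr 1; ring
    simp only [hF, isingWeight_eq_flipSpin_mul_exp hA hd u z, hθ, add_zero,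
      ← localField_rowWeights (hd u), localField_flipSpin, spin_flipSpin_self, hexp]
    ring
  have hsum := sum_comp_flipSpin u F
  simp only [hodd, Finset.sum_neg_distrib] at hsum
  linarith

lemma sum_mul_screeningGrad_rowWeights_add (hA : A.IsSymm) (hd : ∀ i, A i i = 0) (hθ : θ u = 0)
    (d : Others u → ℝ) :
    ∑ j, d j * screeningGrad A θ (rowWeights A u + d) j = ∑ z, isingWeight A θ z *
      (Real.exp (-spin (z u) * localField (rowWeights A u) z) *
        (-spin (z u) * localField d z * (Real.exp (-spin (z u) * localField d z) - 1))) := by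
  rw [← sub_zero (∑ j, d j * screeningGrad A θ (rowWeights A u + d) j),
    ← sum_mul_screeningGrad_rowWeights hA hd hθ d,
    sum_mul_screeningGrad, sum_mul_screeningGrad, ← Finset.sum_sub_distrib]
  refine Finset.sum_congr rfl fun z _ => ?_
  rw [localField_add, mul_add, Real.exp_add]
  ring

lemma sq_div_one_add_abs_le_mul_exp_sub_one (y : ℝ) :
    y ^ 2 / (1 + |y|) ≤ y * (Real.exp y - 1) := by
  rw [div_le_iff₀ (by positivity)]
  rcases le_total 0 y with hy | hy
  · rw [abs_of_nonneg hy]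
    have hexp : y * y ≤ y * (Real.exp y - 1) :=
      mul_le_mul_of_nonneg_left (by linarith [Real.add_one_le_exp y]) hy
    nlinarith
  · rw [abs_of_nonpos hy]
    have hexp : Real.exp y * (1 + -y) ≤ 1 :=
      calc Real.exp y * (1 + -y) ≤ Real.exp y * Real.exp (-y) := by
            gcongr; linarith [Real.add_one_le_exp (-y)]
        _ = 1 := by rw [← Real.exp_add, add_neg_cancel, Real.exp_zero]
    nlinarith [mul_nonneg (neg_nonneg.2 hy) (sub_nonneg.2 hexp)]

lemma exp_neg_mul_sq_div_le {a y b c : ℝ} (ha : |a| ≤ b) (hy : |y| ≤ c) :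
    Real.exp (-b) * (y ^ 2 / (1 + c)) ≤ Real.exp a * (y * (Real.exp y - 1)) := by
  have hc : 0 ≤ c := (abs_nonneg y).trans hy
  have hsq : y ^ 2 / (1 + c) ≤ y * (Real.exp y - 1) :=
    (div_le_div_of_nonneg_left (sq_nonneg y) (by positivity) (by linarith)).trans
      (sq_div_one_add_abs_le_mul_exp_sub_one y)
  exact mul_le_mul (Real.exp_le_exp.2 (neg_le_of_abs_le ha)) hsq (by positivity) (by positivity)

/-- The screening objective is strongly convex in every coordinate direction, with minimizer the
true weights. -/
theorem sq_le_sum_sub_mul_screeningGrad (hA : A.IsSymm) (hd : ∀ i, A i i = 0)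
    (hrow : ∀ i, ∑ j, |A i j| ≤ lam) {v : Others u → ℝ} (hv : ∑ j, |v j| ≤ lam) (i : Others u) :
    Real.exp (-3 * lam) / (1 + 2 * lam) * (v i - A u i) ^ 2 ≤
      ∑ j, (v j - A u j) * screeningGrad A 0 v j := by
  set a := rowWeights A u
  set d := v - a with hdef
  have hlam : 0 ≤ lam := (Finset.sum_nonneg fun j _ => abs_nonneg (A u j)).trans (hrow u)
  have hal : ∑ j, |a j| ≤ lam := (sum_abs_rowWeights (hd u)).trans_le (hrow u)
  have hdl : ∑ j, |d j| ≤ 2 * lam :=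
    calc ∑ j, |d j| ≤ ∑ j, (|v j| + |a j|) := Finset.sum_le_sum fun j _ => abs_sub _ _
      _ ≤ 2 * lam := by rw [Finset.sum_add_distrib]; linarith
  have hpoint (z) : Real.exp (-lam) * (localField d z ^ 2 / (1 + 2 * lam)) ≤
      Real.exp (-spin (z u) * localField a z) *
        (-spin (z u) * localField d z * (Real.exp (-spin (z u) * localField d z) - 1)) := by
    have h := exp_neg_mul_sq_div_le
      ((abs_neg_spin_mul (z u) _).trans_le ((abs_localField_le a z).trans hal))
      ((abs_neg_spin_mul (z u) _).trans_le ((abs_localField_le d z).trans hdl))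
    rwa [← sq_abs (-spin (z u) * localField d z), abs_neg_spin_mul, sq_abs] at h
  calc Real.exp (-3 * lam) / (1 + 2 * lam) * (v i - A u i) ^ 2
      = Real.exp (-lam) / (1 + 2 * lam) * (Real.exp (-2 * lam) * d i ^ 2) := by
        rw [show -3 * lam = -lam + -2 * lam by ring, Real.exp_add, hdef]
        simp only [Pi.sub_apply, a, rowWeights]
        ring
    _ ≤ Real.exp (-lam) / (1 + 2 * lam) * ∑ z, isingWeight A 0 z * localField d z ^ 2 := by
        gcongr
        exact exp_neg_mul_sq_le_sum_isingWeight_mul_sq hA hd hlam d (by simpa using hrow i)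
    _ = ∑ z, isingWeight A 0 z * (Real.exp (-lam) * (localField d z ^ 2 / (1 + 2 * lam))) := by
        rw [Finset.mul_sum]
        exact Finset.sum_congr rfl fun z _ => by ring
    _ ≤ ∑ j, d j * screeningGrad A 0 (a + d) j := by
        rw [sum_mul_screeningGrad_rowWeights_add hA hd rfl]
        exact Finset.sum_le_sum fun z _ =>
          mul_le_mul_of_nonneg_left (hpoint z) (isingWeight_pos A 0 z).le
    _ = ∑ j, (v j - A u j) * screeningGrad A 0 v j := by rw [hdef, add_sub_cancel]; rfl

end Screening

/-! ### The law of a corrupted sample and the gradient estimator -/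

section Laws

variable {n : ℕ} (A : Matrix (Fin n) (Fin n) ℝ) (θ : Fin n → ℝ) {p : Fin n → ℝ}

lemma isingLaw_eq_sum_isingWeight_smul_dirac :
    isingLaw A θ = ∑ z, ENNReal.ofReal (isingWeight A θ z) • Measure.dirac z := rfl

instance isProbabilityMeasure_isingLaw : IsProbabilityMeasure (isingLaw A θ) := by
  refine ⟨?_⟩
  simp only [isingLaw_eq_sum_isingWeight_smul_dirac, Measure.coe_finsetSum, Finset.sum_apply,
    Measure.smul_apply, measure_univ, smul_eq_mul, mul_one]
  rw [← ENNReal.ofReal_sum_of_nonneg fun z _ => (isingWeight_pos A θ z).le, sum_isingWeight,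
    ENNReal.ofReal_one]

lemma integral_isingLaw (f : (Fin n → Bool) → ℝ) :
    ∫ z, f z ∂isingLaw A θ = ∑ z, isingWeight A θ z * f z := by
  rw [isingLaw_eq_sum_isingWeight_smul_dirac, integral_finsetSum_measure fun z _ =>
    (integrable_dirac (by simp)).smul_measure ENNReal.ofReal_ne_top]
  refine Finset.sum_congr rfl fun z _ => ?_
  rw [integral_smul_measure, integral_dirac, ENNReal.toReal_ofReal (isingWeight_pos A θ z).le,
    smul_eq_mul]

lemma isProbabilityMeasure_bernoulliLaw {r : ℝ} (h0 : 0 ≤ r) (h1 : r ≤ 1) :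
    IsProbabilityMeasure (bernoulliLaw r) := by
  refine ⟨?_⟩
  simp only [bernoulliLaw, Measure.add_apply, Measure.smul_apply, measure_univ, smul_eq_mul,
    mul_one]
  rw [← ENNReal.ofReal_add h0 (sub_nonneg.2 h1), add_sub_cancel, ENNReal.ofReal_one]

lemma integral_bernoulliLaw {r : ℝ} (h0 : 0 ≤ r) (h1 : r ≤ 1) (f : Bool → ℝ) :
    ∫ b, f b ∂bernoulliLaw r = r * f true + (1 - r) * f false := by
  rw [bernoulliLaw, integral_add_measure
    ((integrable_dirac (by simp)).smul_measure ENNReal.ofReal_ne_top)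
    ((integrable_dirac (by simp)).smul_measure ENNReal.ofReal_ne_top),
    integral_smul_measure, integral_smul_measure, integral_dirac, integral_dirac,
    ENNReal.toReal_ofReal h0, ENNReal.toReal_ofReal (sub_nonneg.2 h1), smul_eq_mul, smul_eq_mul]

lemma isProbabilityMeasure_bernoulliLaw_one_sub (hp : ∀ i, 0 ≤ p i ∧ p i ≤ 1) (i : Fin n) :
    IsProbabilityMeasure (bernoulliLaw (1 - p i)) :=
  isProbabilityMeasure_bernoulliLaw (sub_nonneg.2 (hp i).2) (sub_le_self 1 (hp i).1)

lemma isProbabilityMeasure_missLaw (hp : ∀ i, 0 ≤ p i ∧ p i ≤ 1) :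
    IsProbabilityMeasure (missLaw A θ p) := by
  have := isProbabilityMeasure_bernoulliLaw_one_sub hp
  exact Measure.isProbabilityMeasure_map Measurable.of_discrete.aemeasurable

lemma isProbabilityMeasure_sampleLaw (hp : ∀ i, 0 ≤ p i ∧ p i ≤ 1) (T : ℕ) :
    IsProbabilityMeasure (sampleLaw A θ p T) := by
  have := isProbabilityMeasure_missLaw A θ hp
  exact inferInstanceAs (IsProbabilityMeasure (Measure.pi fun _ => missLaw A θ p))

/-- The entry recorded for the true spin `b`: it is kept if `c` holds and erased otherwise. -/
def maskEntry (b c : Bool) : Entry := if c then some b else none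

lemma integral_missLaw (hp : ∀ i, 0 ≤ p i ∧ p i ≤ 1) (f : (Fin n → Entry) → ℝ) :
    ∫ x, f x ∂missLaw A θ p = ∑ z, isingWeight A θ z *
      ∫ c, f (fun i => maskEntry (z i) (c i)) ∂Measure.pi fun i => bernoulliLaw (1 - p i) := by
  have := isProbabilityMeasure_bernoulliLaw_one_sub hp
  rw [missLaw, integral_map Measurable.of_discrete.aemeasurable
    Measurable.of_discrete.aestronglyMeasurable, integral_prod _ Integrable.of_finite,
    integral_isingLaw]
  rfl

end Laws

section Estimator

variable {n : ℕ} {u : Fin n} {p : Fin n → ℝ}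

lemma abs_entryVal_le (x : Entry) : |entryVal x| ≤ 1 := by
  cases x <;> simp [entryVal, abs_spin]

/-- The factor of vertex `k` in `gMiss p w x i`, as a function of the observed entry at `k` when the
observed value at `u` is replaced by the true spin `s`. For a fixed configuration the estimator thus
becomes a product of independent variables, one for each vertex. -/
def gMissFactor (p : Fin n → ℝ) (w : Coord u → ℝ) (s : ℝ) (i : Others u) (k : Fin n) (x : Entry) :
    ℝ :=
  if hk : k = u then -(entryVal x / (1 - p u))
  else if k = i then Real.exp (-(simplexToBall w i) * s * entryVal x) * entryVal x / (1 - p i)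
  else (Real.exp (-(simplexToBall w ⟨k, hk⟩) * s * entryVal x) - p k) / (1 - p k)

lemma gMissFactor_vertex (p : Fin n → ℝ) (w : Coord u → ℝ) (s : ℝ) (i : Others u) (x : Entry) :
    gMissFactor p w s i u x = -(entryVal x / (1 - p u)) := by
  simp [gMissFactor]

lemma gMissFactor_self (p : Fin n → ℝ) (w : Coord u → ℝ) (s : ℝ) (i : Others u) (x : Entry) :
    gMissFactor p w s i i x =
      Real.exp (-(simplexToBall w i) * s * entryVal x) * entryVal x / (1 - p i) := by
  simp [gMissFactor, i.2]

lemma gMissFactor_of_ne (p : Fin n → ℝ) (w : Coord u → ℝ) (s : ℝ) {i j : Others u} (h : j ≠ i)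
    (x : Entry) : gMissFactor p w s i j x =
      (Real.exp (-(simplexToBall w j) * s * entryVal x) - p j) / (1 - p j) := by
  simp [gMissFactor, j.2, Subtype.coe_ne_coe.2 h]

lemma prod_univ_eq_mul_mul_prod_erase {M : Type*} [CommMonoid M] (f : Fin n → M) (i : Others u) :
    ∏ k, f k = f u * f i * ∏ j ∈ Finset.univ.erase i, f (j : Others u) := by
  rw [Fintype.prod_eq_mul_prod_subtype_ne f u, mul_assoc,
    Finset.mul_prod_erase Finset.univ (fun j : Others u => f j) (Finset.mem_univ i)]

lemma gMiss_mask (w : Coord u → ℝ) (z c : Fin n → Bool) (i : Others u) :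
    gMiss p w (fun k => maskEntry (z k) (c k)) i =
      ∏ k, gMissFactor p w (spin (z u)) i k (maskEntry (z k) (c k)) := by
  rw [prod_univ_eq_mul_mul_prod_erase _ i, gMissFactor_vertex, gMissFactor_self, gMiss,
    Finset.prod_congr rfl fun j hj => gMissFactor_of_ne p w _ (Finset.ne_of_mem_erase hj) _]
  by_cases hu : c u <;> simp [maskEntry, hu, entryVal]

section Expectation

variable (hp : ∀ i, 0 ≤ p i ∧ p i < 1) (z : Fin n → Bool) (w : Coord u → ℝ) (s : ℝ)
include hp

lemma integral_comp_maskEntry (k : Fin n) (f : Entry → ℝ) :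
    ∫ c, f (maskEntry (z k) c) ∂bernoulliLaw (1 - p k) =
      (1 - p k) * f (some (z k)) + p k * f none := by
  rw [integral_bernoulliLaw (sub_nonneg.2 (hp k).2.le) (sub_le_self 1 (hp k).1), sub_sub_cancel]
  rfl

lemma integral_gMissFactor_vertex (i : Others u) :
    ∫ c, gMissFactor p w s i u (maskEntry (z u) c) ∂bernoulliLaw (1 - p u) = -spin (z u) := by
  have hne : 1 - p u ≠ 0 := (sub_pos.2 (hp u).2).ne'
  rw [integral_comp_maskEntry hp z u, gMissFactor_vertex, gMissFactor_vertex]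
  simp only [entryVal]
  field

lemma integral_gMissFactor_self (i : Others u) :
    ∫ c, gMissFactor p w s i i (maskEntry (z i) c) ∂bernoulliLaw (1 - p i) =
      Real.exp (-(simplexToBall w i) * s * spin (z i)) * spin (z i) := by
  have hne : 1 - p i ≠ 0 := (sub_pos.2 (hp i).2).ne'
  rw [integral_comp_maskEntry hp z i, gMissFactor_self, gMissFactor_self]
  simp only [entryVal]
  field

lemma integral_gMissFactor_of_ne {i j : Others u} (h : j ≠ i) :
    ∫ c, gMissFactor p w s i j (maskEntry (z j) c) ∂bernoulliLaw (1 - p j) =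
      Real.exp (-(simplexToBall w j) * s * spin (z j)) := by
  have hne : 1 - p j ≠ 0 := (sub_pos.2 (hp j).2).ne'
  rw [integral_comp_maskEntry hp z j, gMissFactor_of_ne p w s h, gMissFactor_of_ne p w s h]
  simp only [entryVal, mul_zero, Real.exp_zero, div_self hne]
  field

/-- The estimator is unbiased: dividing by the observation probabilities undoes the erasures. -/
theorem integral_gMiss (A : Matrix (Fin n) (Fin n) ℝ) (θ : Fin n → ℝ) (i : Others u) :
    ∫ x, gMiss p w x i ∂missLaw A θ p = screeningGrad A θ (simplexToBall w) i := by
  have hp' (k) : 0 ≤ p k ∧ p k ≤ 1 := ⟨(hp k).1, (hp k).2.le⟩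
  have := isProbabilityMeasure_bernoulliLaw_one_sub hp'
  rw [integral_missLaw A θ hp', screeningGrad]
  refine Finset.sum_congr rfl fun z _ => congrArg _ ?_
  simp_rw [gMiss_mask]
  rw [integral_fintype_prod_eq_prod fun k c => gMissFactor p w (spin (z u)) i k (maskEntry (z k) c),
    prod_univ_eq_mul_mul_prod_erase _ i, integral_gMissFactor_vertex hp,
    integral_gMissFactor_self hp, Finset.prod_congr rfl fun j hj =>
      integral_gMissFactor_of_ne hp z w _ (Finset.ne_of_mem_erase hj),
    localField, Finset.mul_sum, Real.exp_sum,
    ← Finset.mul_prod_erase Finset.univ _ (Finset.mem_univ i)]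
  ring_nf

end Expectation

/-- Convexity of `exp` gives `exp t - p ≤ (1 - p) exp (t / (1 - p))`. -/
lemma abs_exp_sub_div_one_sub_le {q p s t : ℝ} (hp : 0 ≤ p) (hpq : p ≤ q) (hq : q < 1)
    (hst : |s| ≤ t) : |(Real.exp s - p) / (1 - p)| ≤ Real.exp (t / (1 - q)) := by
  have h1p : 0 < 1 - p := by linarith
  have : 0 < 1 - q := by linarith
  have ht : 0 ≤ t := (abs_nonneg s).trans hst
  have habs : |Real.exp s - p| ≤ Real.exp t - p := by
    have hup : Real.exp s ≤ Real.exp t := Real.exp_le_exp.2 ((le_abs_self s).trans hst)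
    have hlow : Real.exp (-t) ≤ Real.exp s := Real.exp_le_exp.2 (neg_le_of_abs_le hst)
    have hcosh : 2 ≤ Real.exp t + Real.exp (-t) := by
      linarith [Real.one_le_cosh t, Real.cosh_eq t]
    exact abs_le.2 ⟨by linarith, by linarith⟩
  have hconv : Real.exp t ≤ p + (1 - p) * Real.exp (t / (1 - p)) := by
    have h := convexOn_exp.2 (Set.mem_univ 0) (Set.mem_univ (t / (1 - p))) hp h1p.le (by ring)
    simp only [smul_eq_mul, mul_zero, zero_add, Real.exp_zero, mul_one] at h
    rwa [mul_div_cancel₀ _ h1p.ne'] at h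
  rw [abs_div, abs_of_pos h1p, div_le_iff₀' h1p]
  calc |Real.exp s - p| ≤ (1 - p) * Real.exp (t / (1 - p)) := by linarith
    _ ≤ (1 - p) * Real.exp (t / (1 - q)) := by gcongr

theorem abs_gMiss_le {q lam : ℝ} (hp : ∀ i, 0 ≤ p i ∧ p i ≤ q) (hq : q < 1) {w : Coord u → ℝ}
    (hw : ∑ j, |simplexToBall w j| ≤ lam) (x : Fin n → Entry) (i : Others u) :
    |gMiss p w x i| ≤ gradBound q lam := by
  have h1q : 0 < 1 - q := by linarith
  have h1p (k) : 1 - q ≤ 1 - p k := by linarith [(hp k).2]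
  have hexponent (j : Others u) :
      |-(simplexToBall w j) * entryVal (x u) * entryVal (x j)| ≤ |simplexToBall w j| := by
    rw [abs_mul, abs_mul, abs_neg, mul_assoc]
    exact mul_le_of_le_one_right (abs_nonneg _)
      (mul_le_one₀ (abs_entryVal_le _) (abs_nonneg _) (abs_entryVal_le _))
  have hvertex : |-(entryVal (x u) / (1 - p u))| ≤ 1 / (1 - q) := by
    rw [abs_neg, abs_div, abs_of_pos (h1q.trans_le (h1p u))]
    exact div_le_div₀ zero_le_one (abs_entryVal_le _) h1q (h1p u)
  have hself : |Real.exp (-(simplexToBall w i) * entryVal (x u) * entryVal (x i)) *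
      entryVal (x i) / (1 - p i)| ≤ Real.exp (|simplexToBall w i| / (1 - q)) / (1 - q) := by
    rw [abs_div, abs_of_pos (h1q.trans_le (h1p i)), abs_mul, abs_of_pos (Real.exp_pos _)]
    refine div_le_div₀ (Real.exp_pos _).le ?_ h1q (h1p i)
    refine (mul_le_of_le_one_right (Real.exp_pos _).le (abs_entryVal_le _)).trans ?_
    refine Real.exp_le_exp.2 ((le_abs_self _).trans ((hexponent i).trans ?_))
    exact le_div_self (abs_nonneg _) h1q (by linarith [(hp i).1, (hp i).2])
  have hothers : |∏ j ∈ Finset.univ.erase i,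
      (Real.exp (-(simplexToBall w j) * entryVal (x u) * entryVal (x j)) - p j) / (1 - p j)| ≤
      ∏ j ∈ Finset.univ.erase i, Real.exp (|simplexToBall w j| / (1 - q)) := by
    rw [Finset.abs_prod]
    exact Finset.prod_le_prod (fun _ _ => abs_nonneg _) fun j _ =>
      abs_exp_sub_div_one_sub_le (hp j).1 (hp j).2 hq (hexponent j)
  rw [gMiss, abs_mul, abs_mul]
  calc _ ≤ 1 / (1 - q) * (Real.exp (|simplexToBall w i| / (1 - q)) / (1 - q)) *
        ∏ j ∈ Finset.univ.erase i, Real.exp (|simplexToBall w j| / (1 - q)) := by gcongr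
    _ = Real.exp (∑ j, |simplexToBall w j| / (1 - q)) / (1 - q) ^ 2 := by
        rw [Real.exp_sum, ← Finset.mul_prod_erase Finset.univ _ (Finset.mem_univ i)]
        field
    _ ≤ gradBound q lam := by
        rw [gradBound, ← Finset.sum_div]
        gcongr

end Estimator

/-! ### Regret of the multiplicative updates -/

/-- The interior of the simplex of total mass `lam`. -/
structure InSimplex {κ : Type*} [Fintype κ] (lam : ℝ) (w : κ → ℝ) : Prop where
  pos : ∀ c, 0 < w c
  sum_eq : ∑ c, w c = lam

/-- The multiplicative-weights update of `w` along the gradient `g`; `smgStep` is the case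
`g = GMiss p w x`. Subtracting the weighted mean of `g` keeps the total mass equal to `lam`. -/
def mwStep {κ : Type*} [Fintype κ] (lam η : ℝ) (g w : κ → ℝ) (c : κ) : ℝ :=
  w c * (1 - η * g c + η * ((∑ d, w d * g d) / lam))

theorem neg_sub_two_mul_sq_le_log_one_sub {y : ℝ} (hy : y ≤ 1 / 2) :
    -y - 2 * y ^ 2 ≤ Real.log (1 - y) := by
  have hpos : 0 < 1 - y := by linarith
  have hinv : (1 - y)⁻¹ ≤ 2 := by rw [inv_le_comm₀ hpos two_pos]; linarith
  calc -y - 2 * y ^ 2 ≤ -y - y ^ 2 * (1 - y)⁻¹ := by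
        nlinarith [mul_le_mul_of_nonneg_left hinv (sq_nonneg y)]
    _ = 1 - (1 - y)⁻¹ := by field_simp; ring
    _ ≤ Real.log (1 - y) := Real.one_sub_inv_le_log_of_pos hpos

section MultiplicativeWeights

variable {κ : Type*} [Fintype κ] {lam η B : ℝ} {g w y : κ → ℝ}

theorem inSimplex_const [Nonempty κ] (hlam : 0 < lam) :
    InSimplex lam fun _ : κ => lam / Fintype.card κ where
  pos _ := by positivity
  sum_eq := by
    rw [Finset.sum_const, Finset.card_univ, nsmul_eq_mul]
    field_simp

theorem InSimplex.le (hw : InSimplex lam w) (c : κ) : w c ≤ lam := by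
  rw [← hw.sum_eq]
  exact Finset.single_le_sum (fun d _ => (hw.pos d).le) (Finset.mem_univ c)

theorem InSimplex.abs_mean_le (hw : InSimplex lam w) (hlam : 0 < lam) (hg : ∀ c, |g c| ≤ B) :
    |(∑ d, w d * g d) / lam| ≤ B := by
  rw [abs_div, abs_of_pos hlam, div_le_iff₀ hlam]
  calc |∑ d, w d * g d| ≤ ∑ d, w d * B := by
        refine (Finset.abs_sum_le_sum_abs _ _).trans (Finset.sum_le_sum fun d _ => ?_)
        rw [abs_mul, abs_of_pos (hw.pos d)]
        exact mul_le_mul_of_nonneg_left (hg d) (hw.pos d).le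
    _ = B * lam := by rw [← Finset.sum_mul, hw.sum_eq, mul_comm]

theorem InSimplex.abs_mul_sub_mean_le (hw : InSimplex lam w) (hlam : 0 < lam) (hη : 0 ≤ η)
    (hg : ∀ c, |g c| ≤ B) (c : κ) :
    |η * (g c - (∑ d, w d * g d) / lam)| ≤ 2 * (η * B) := by
  rw [abs_mul, abs_of_nonneg hη]
  calc η * |g c - (∑ d, w d * g d) / lam| ≤ η * (B + B) :=
        mul_le_mul_of_nonneg_left
          ((abs_sub _ _).trans (add_le_add (hg c) (hw.abs_mean_le hlam hg))) hη
    _ = 2 * (η * B) := by ring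

theorem mwStep_eq (lam η : ℝ) (g w : κ → ℝ) (c : κ) :
    mwStep lam η g w c = w c * (1 - η * (g c - (∑ d, w d * g d) / lam)) := by
  rw [mwStep]
  ring

theorem sum_mul_sub_mean (hlam : lam ≠ 0) (hy : ∑ c, y c = lam) (g w : κ → ℝ) :
    ∑ c, y c * (g c - (∑ d, w d * g d) / lam) = ∑ c, y c * g c - ∑ c, w c * g c := by
  simp_rw [mul_sub]
  rw [Finset.sum_sub_distrib, ← Finset.sum_mul, hy, mul_div_cancel₀ _ hlam]

theorem InSimplex.mwStep (hw : InSimplex lam w) (hlam : 0 < lam) (hη : 0 ≤ η)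
    (hηB : η * B ≤ 1 / 4) (hg : ∀ c, |g c| ≤ B) : InSimplex lam (mwStep lam η g w) where
  pos c := by
    rw [mwStep_eq]
    have h := (abs_le.1 (hw.abs_mul_sub_mean_le hlam hη hg c)).2
    exact mul_pos (hw.pos c) (by linarith)
  sum_eq := by
    simp_rw [mwStep_eq, mul_sub (w _), mul_one, mul_left_comm (w _) η]
    rw [Finset.sum_sub_distrib, ← Finset.mul_sum,
      sum_mul_sub_mean hlam.ne' hw.sum_eq, sub_self, mul_zero, sub_zero, hw.sum_eq]

theorem log_mwStep_ge (hw : InSimplex lam w) (hlam : 0 < lam) (hη : 0 ≤ η)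
    (hηB : η * B ≤ 1 / 4) (hg : ∀ c, |g c| ≤ B) (c : κ) :
    Real.log (w c) - η * (g c - (∑ d, w d * g d) / lam) - 8 * (η * B) ^ 2 ≤
      Real.log (mwStep lam η g w c) := by
  obtain ⟨hlower, hupper⟩ := abs_le.1 (hw.abs_mul_sub_mean_le hlam hη hg c)
  rw [mwStep_eq, Real.log_mul (hw.pos c).ne' (by linarith)]
  have hlog := neg_sub_two_mul_sq_le_log_one_sub (hupper.trans (by linarith))
  have hsq := sq_le_sq' hlower hupper
  linarith

theorem sum_sub_mul_le_potential_mwStep (hw : InSimplex lam w) (hlam : 0 < lam) (hη : 0 ≤ η)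
    (hηB : η * B ≤ 1 / 4) (hg : ∀ c, |g c| ≤ B) (hy : ∀ c, 0 ≤ y c) (hys : ∑ c, y c = lam) :
    η * ∑ c, (w c - y c) * g c ≤
      ∑ c, y c * Real.log (mwStep lam η g w c) - ∑ c, y c * Real.log (w c) +
        8 * (η * B) ^ 2 * lam := by
  have hsum := Finset.sum_le_sum fun c (_ : c ∈ Finset.univ) =>
    mul_le_mul_of_nonneg_left (log_mwStep_ge hw hlam hη hηB hg c) (hy c)
  simp only [mul_sub (y _), mul_left_comm (y _) η, Finset.sum_sub_distrib,
    ← Finset.mul_sum, ← Finset.sum_mul, hys] at hsum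
  rw [← mul_div_assoc, mul_div_cancel_left₀ _ hlam.ne'] at hsum
  simp only [sub_mul, Finset.sum_sub_distrib]
  linarith

theorem InSimplex.sum_mul_log_le (hw : InSimplex lam w) (hy : ∀ c, 0 ≤ y c)
    (hys : ∑ c, y c = lam) : ∑ c, y c * Real.log (w c) ≤ lam * Real.log lam := by
  calc ∑ c, y c * Real.log (w c) ≤ ∑ c, y c * Real.log lam :=
        Finset.sum_le_sum fun c _ =>
          mul_le_mul_of_nonneg_left (Real.log_le_log (hw.pos c) (hw.le c)) (hy c)
    _ = lam * Real.log lam := by rw [← Finset.sum_mul, hys]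

/-- The potential `∑ c, y c * log (w c)` increases at every step by the gain over `y`, up to a
second-order error, while its total increase is at most `lam * log |κ|`. -/
theorem mul_sum_regret_mwStep_le {T : ℕ} {w : ℕ → κ → ℝ} {g : Fin T → κ → ℝ} [Nonempty κ]
    (hlam : 0 < lam) (hη : 0 ≤ η) (hηB : η * B ≤ 1 / 4)
    (hw : ∀ t, InSimplex lam (w t)) (hg : ∀ t c, |g t c| ≤ B)
    (hw0 : w 0 = fun _ => lam / Fintype.card κ)
    (hstep : ∀ t : Fin T, w (t + 1) = mwStep lam η (g t) (w t))
    (hy : ∀ c, 0 ≤ y c) (hys : ∑ c, y c = lam) :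
    η * ∑ t : Fin T, ∑ c, (w t c - y c) * g t c ≤
      lam * Real.log (Fintype.card κ) + T * (8 * (η * B) ^ 2 * lam) := by
  let F : ℕ → ℝ := fun t => ∑ c, y c * Real.log (w t c)
  have hprogress (t : Fin T) :
      η * ∑ c, (w t c - y c) * g t c ≤ F (t + 1) - F t + 8 * (η * B) ^ 2 * lam := by
    simp only [F, hstep]
    exact sum_sub_mul_le_potential_mwStep (hw t) hlam hη hηB (hg t) hy hys
  have hend : F T ≤ lam * Real.log lam := (hw T).sum_mul_log_le hy hys
  have hstart : F 0 = lam * (Real.log lam - Real.log (Fintype.card κ)) := by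
    simp only [F, hw0]
    rw [← Finset.sum_mul, hys, Real.log_div hlam.ne' (by simp)]
  calc η * ∑ t : Fin T, ∑ c, (w t c - y c) * g t c
      ≤ ∑ t : Fin T, (F (t + 1) - F t + 8 * (η * B) ^ 2 * lam) := by
        rw [Finset.mul_sum]
        exact Finset.sum_le_sum fun t _ => hprogress t
    _ = F T - F 0 + T * (8 * (η * B) ^ 2 * lam) := by
        rw [Finset.sum_add_distrib, Fin.sum_univ_eq_sum_range (fun t => F (t + 1) - F t),
          Finset.sum_range_sub, Finset.sum_const, Finset.card_univ, Fintype.card_fin,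
          nsmul_eq_mul]
    _ ≤ _ := by linarith

end MultiplicativeWeights

/-- The coordinates as a disjoint union, for summing and counting over `Coord u`. -/
def coordEquiv {n : ℕ} (u : Fin n) : (Others u ⊕ Others u) ⊕ Unit ≃ Coord u where
  toFun
    | .inl (.inl j) => .pos j
    | .inl (.inr j) => .neg j
    | .inr _ => .slack
  invFun
    | .pos j => .inl (.inl j)
    | .neg j => .inl (.inr j)
    | .slack => .inr ()
  left_inv := by rintro ((_ | _) | _) <;> rfl
  right_inv := by rintro (_ | _ | _) <;> rfl

instance {n : ℕ} (u : Fin n) : Nonempty (Coord u) := ⟨.slack⟩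

section Coordinates

variable {n : ℕ} {u : Fin n}

theorem sum_coord {M : Type*} [AddCommMonoid M] (f : Coord u → M) :
    ∑ c, f c = ∑ j, f (.pos j) + ∑ j, f (.neg j) + f .slack := by
  rw [← (coordEquiv u).sum_comp f, Fintype.sum_sum_type, Fintype.sum_sum_type]
  simp [coordEquiv]

theorem card_coord (u : Fin n) : (Fintype.card (Coord u) : ℝ) = 2 * (n : ℝ) - 1 := by
  have hn : 1 ≤ n := Nat.one_le_of_lt u.2
  rw [← Fintype.card_congr (coordEquiv u), Fintype.card_sum, Fintype.card_sum,
    Fintype.card_subtype_compl, Fintype.card_unit, Fintype.card_fin, Fintype.card_subtype_eq]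
  push_cast [hn]
  ring

theorem InSimplex.sum_abs_simplexToBall_le {lam : ℝ} {w : Coord u → ℝ} (hw : InSimplex lam w) :
    ∑ j, |simplexToBall w j| ≤ lam := by
  calc ∑ j, |simplexToBall w j| ≤ ∑ j, (w (.pos j) + w (.neg j)) :=
        Finset.sum_le_sum fun j _ => by
          rw [simplexToBall, abs_le]
          constructor <;> linarith [hw.pos (.pos j), hw.pos (.neg j)]
    _ ≤ ∑ c, w c := by
        rw [sum_coord, Finset.sum_add_distrib]
        linarith [hw.pos .slack]
    _ = lam := hw.sum_eq

theorem exists_simplexToBall_eq {lam : ℝ} (a : Others u → ℝ) (ha : ∑ j, |a j| ≤ lam) :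
    ∃ y : Coord u → ℝ, (∀ c, 0 ≤ y c) ∧ ∑ c, y c = lam ∧ simplexToBall y = a := by
  let y : Coord u → ℝ
    | .pos j => (a j)⁺
    | .neg j => (a j)⁻
    | .slack => lam - ∑ j, |a j|
  refine ⟨y, ?_, ?_, funext fun j => posPart_sub_negPart (a j)⟩
  · rintro (j | j | _)
    exacts [posPart_nonneg _, negPart_nonneg _, sub_nonneg.2 ha]
  · rw [sum_coord, ← Finset.sum_add_distrib,
      Finset.sum_congr rfl fun j _ => posPart_add_negPart (a j)]
    exact add_sub_cancel _ _

theorem sum_mul_GMiss (p : Fin n → ℝ) (w y : Coord u → ℝ) (x : Fin n → Entry) :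
    ∑ c, y c * GMiss p w x c = ∑ i, simplexToBall y i * gMiss p w x i := by
  rw [sum_coord]
  simp only [GMiss, simplexToBall, sub_mul, Finset.sum_sub_distrib, mul_neg,
    Finset.sum_neg_distrib]
  ring

theorem smgIter_succ {T : ℕ} (u : Fin n) (p : Fin n → ℝ) (lam η : ℝ) (X : Fin T → Fin n → Entry)
    (t : Fin T) :
    smgIter u p lam η X (t + 1) = smgStep p lam η (smgIter u p lam η X t) (X t) := by
  simp only [smgIter, t.2, dite_true]

end Coordinates

section Iterates

variable {n T : ℕ} {q lam η : ℝ} {p : Fin n → ℝ} {u : Fin n}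

theorem abs_GMiss_le (hp : ∀ i, 0 ≤ p i ∧ p i ≤ q) (hq : q < 1) {w : Coord u → ℝ}
    (hw : InSimplex lam w) (x : Fin n → Entry) (c : Coord u) :
    |GMiss p w x c| ≤ gradBound q lam := by
  have hgMiss := abs_gMiss_le hp hq hw.sum_abs_simplexToBall_le x
  cases c with
  | pos i => exact hgMiss i
  | neg i => rw [GMiss, abs_neg]; exact hgMiss i
  | slack =>
    simp only [GMiss, abs_zero, gradBound]
    positivity

theorem inSimplex_smgIter (hlam : 0 < lam) (hη : 0 ≤ η) (hηB : η * gradBound q lam ≤ 1 / 4)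
    (hp : ∀ i, 0 ≤ p i ∧ p i ≤ q) (hq : q < 1) (u : Fin n) (X : Fin T → Fin n → Entry) (t : ℕ) :
    InSimplex lam (smgIter u p lam η X t) := by
  induction t with
  | zero => simpa only [smgIter, card_coord] using inSimplex_const (κ := Coord u) hlam
  | succ t ih =>
    by_cases h : t < T
    · simp only [smgIter, h, dite_true]
      exact ih.mwStep hlam hη hηB (abs_GMiss_le hp hq ih (X ⟨t, h⟩))
    · simpa only [smgIter, h, dite_false] using ih

theorem mul_sum_regret_smgIter_le (hlam : 0 < lam) (hη : 0 ≤ η)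
    (hηB : η * gradBound q lam ≤ 1 / 4) (hp : ∀ i, 0 ≤ p i ∧ p i ≤ q) (hq : q < 1)
    (a : Others u → ℝ) (ha : ∑ j, |a j| ≤ lam) (X : Fin T → Fin n → Entry) :
    η * ∑ t : Fin T, ∑ i, (simplexToBall (smgIter u p lam η X t) i - a i) *
        gMiss p (smgIter u p lam η X t) (X t) i ≤
      lam * Real.log (2 * (n : ℝ) - 1) + T * (8 * (η * gradBound q lam) ^ 2 * lam) := by
  obtain ⟨y, hy, hys, rfl⟩ := exists_simplexToBall_eq a ha
  have hsimplex := inSimplex_smgIter (T := T) hlam hη hηB hp hq u X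
  have hregret := mul_sum_regret_mwStep_le hlam hη hηB hsimplex
    (fun t => abs_GMiss_le hp hq (hsimplex t) (X t)) (by simp only [smgIter, card_coord])
    (fun t => smgIter_succ u p lam η X t) hy hys
  simpa only [sub_mul, Finset.sum_sub_distrib, sum_mul_GMiss, card_coord] using hregret

end Iterates

/-! ### Concentration along an adaptive process driven by independent samples -/

/-- The process `w_{t+1} = step w_t (X t)` driven by the samples `X`, constant once the samples are
used up. It abstracts `smgIter` so that the starting point can vary in inductions over `T`. -/
def runProcess {α W : Type*} (step : W → α → W) {T : ℕ} (X : Fin T → α) (w : W) : ℕ → W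
  | 0 => w
  | t + 1 => if h : t < T then step (runProcess step X w t) (X ⟨t, h⟩) else runProcess step X w t

theorem smgIter_eq_runProcess {n T : ℕ} (u : Fin n) (p : Fin n → ℝ) (lam η : ℝ)
    (X : Fin T → Fin n → Entry) (t : ℕ) :
    smgIter u p lam η X t =
      runProcess (smgStep p lam η) X (fun _ => lam / (2 * (n : ℝ) - 1)) t := by
  induction t with
  | zero => rfl
  | succ t ih => simp only [smgIter, runProcess, ih]

theorem hasSubgaussianMGF_add_prod {α β : Type*} [Finite α] [Finite β] [MeasurableSpace α]
    [MeasurableSpace β] [DiscreteMeasurableSpace α] [DiscreteMeasurableSpace β] {μ : Measure α}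
    {ν : Measure β} [IsFiniteMeasure μ] [IsFiniteMeasure ν] {f : α → ℝ} {g : α → β → ℝ}
    {a b : NNReal} (hf : ProbabilityTheory.HasSubgaussianMGF f a μ)
    (hg : ∀ x, ProbabilityTheory.HasSubgaussianMGF (g x) b ν) :
    ProbabilityTheory.HasSubgaussianMGF (fun z => f z.1 + g z.1 z.2) (a + b) (μ.prod ν) where
  integrable_exp_mul _ := Integrable.of_finite
  mgf_le s := by
    calc ∫ z, Real.exp (s * (f z.1 + g z.1 z.2)) ∂μ.prod ν
        = ∫ x, Real.exp (s * f x) * ∫ y, Real.exp (s * g x y) ∂ν ∂μ := by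
          simp_rw [integral_prod _ Integrable.of_finite, mul_add, Real.exp_add,
            integral_const_mul]
      _ ≤ ∫ x, Real.exp (s * f x) * Real.exp (b * s ^ 2 / 2) ∂μ :=
          integral_mono Integrable.of_finite Integrable.of_finite fun x =>
            mul_le_mul_of_nonneg_left ((hg x).mgf_le s) (Real.exp_pos _).le
      _ ≤ Real.exp (a * s ^ 2 / 2) * Real.exp (b * s ^ 2 / 2) := by
          rw [integral_mul_const]
          exact mul_le_mul_of_nonneg_right (hf.mgf_le s) (Real.exp_pos _).le
      _ = Real.exp ((a + b : NNReal) * s ^ 2 / 2) := by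
          rw [← Real.exp_add, NNReal.coe_add]
          ring_nf

section RunProcess

variable {α W : Type*} {step : W → α → W} {T : ℕ}

theorem runProcess_cons (x : α) (X : Fin T → α) (w : W) (t : ℕ) :
    runProcess step (Fin.cons x X : Fin (T + 1) → α) w (t + 1) =
      runProcess step X (step w x) t := by
  induction t with
  | zero => simp only [runProcess, Nat.zero_lt_succ, dite_true]; rfl
  | succ t ih =>
    rw [runProcess, ih, runProcess]
    simp only [Nat.add_lt_add_iff_right]
    rfl

theorem sum_runProcess_cons {φ : W → α → ℝ} (x : α) (X : Fin T → α) (w : W) :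
    ∑ t : Fin (T + 1), φ (runProcess step (Fin.cons x X : Fin (T + 1) → α) w t)
        ((Fin.cons x X : Fin (T + 1) → α) t) =
      φ w x + ∑ t : Fin T, φ (runProcess step X (step w x) t) (X t) := by
  rw [Fin.sum_univ_succ]
  simp only [Fin.cons_zero, Fin.cons_succ, Fin.val_zero, Fin.val_succ, runProcess_cons]
  rfl

variable [Finite α] [MeasurableSpace α] [DiscreteMeasurableSpace α] {μ : Measure α}
  [IsProbabilityMeasure μ] {Inv : W → Prop} {φ : W → α → ℝ} {w : W}

/-- Azuma–Hoeffding for the martingale differences `φ w_t (X t)`: peel off the first sample. -/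
theorem hasSubgaussianMGF_sum_runProcess {c : NNReal} (hInv : ∀ w x, Inv w → Inv (step w x))
    (hφ : ∀ w, Inv w → ProbabilityTheory.HasSubgaussianMGF (φ w) c μ) (T : ℕ) (hw : Inv w) :
    ProbabilityTheory.HasSubgaussianMGF
      (fun X : Fin T → α => ∑ t : Fin T, φ (runProcess step X w t) (X t)) (T * c)
      (Measure.pi fun _ => μ) := by
  induction T generalizing w with
  | zero => simp
  | succ T ih =>
    have hmp := measurePreserving_piFinSuccAbove (fun _ : Fin (T + 1) => μ) 0
    have hprod := hasSubgaussianMGF_add_prod (hφ w hw) fun x => ih (hInv w x hw)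
    rw [← hmp.map_eq] at hprod
    convert hprod.of_map hmp.measurable.aemeasurable using 1
    · funext X
      rw [← Fin.cons_self_tail X, sum_runProcess_cons]
      rfl
    · push_cast
      ring

theorem measureReal_le_sum_runProcess_le {b : ℝ} (hInv : ∀ w x, Inv w → Inv (step w x))
    (hφ : ∀ w x, Inv w → |φ w x| ≤ b) (hmean : ∀ w, Inv w → ∫ x, φ w x ∂μ = 0)
    (hw : Inv w) {r : ℝ} (hr : 0 ≤ r) :
    (Measure.pi fun _ : Fin T => μ).real
        {X | r ≤ ∑ t : Fin T, φ (runProcess step X w t) (X t)} ≤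
      Real.exp (-(r ^ 2 / (2 * T * b ^ 2))) := by
  have hsubgaussian (w : W) (hw : Inv w) :
      ProbabilityTheory.HasSubgaussianMGF (φ w) ((‖b - -b‖₊ / 2) ^ 2) μ :=
    ProbabilityTheory.hasSubgaussianMGF_of_mem_Icc_of_integral_eq_zero
      Measurable.of_discrete.aemeasurable
      (Filter.Eventually.of_forall fun x => abs_le.1 (hφ w x hw)) (hmean w hw)
  refine ((hasSubgaussianMGF_sum_runProcess hInv hsubgaussian T hw).measure_ge_le hr).trans_eq ?_
  push_cast
  rw [sub_neg_eq_add, ← two_mul, norm_mul, Real.norm_two, mul_div_cancel_left₀ _ two_ne_zero,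
    Real.norm_eq_abs, sq_abs, neg_div, ← mul_assoc]

end RunProcess

/-! ### Recovery of the weights -/

section StepSize

variable {q : ℝ}

lemma gradBound_pos (hq : q < 1) (lam : ℝ) : 0 < gradBound q lam := by
  have : 0 < 1 - q := by linarith
  unfold gradBound
  positivity

lemma one_le_gradBound (hq0 : 0 ≤ q) (hq : q < 1) {lam : ℝ} (hlam : 0 ≤ lam) :
    1 ≤ gradBound q lam := by
  have h : 0 < 1 - q := by linarith
  rw [gradBound, one_le_div (by positivity)]
  exact (pow_le_one₀ h.le (by linarith)).trans (Real.one_le_exp (by positivity))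

lemma stepSize_nonneg (hq : q < 1) (lam : ℝ) (n T : ℕ) : 0 ≤ stepSize q lam n T := by
  have := gradBound_pos hq lam
  exact le_min (by positivity) (by positivity)

lemma stepSize_mul_gradBound_le (hq : q < 1) (lam : ℝ) (n T : ℕ) :
    stepSize q lam n T * gradBound q lam ≤ 1 / 4 := by
  have := gradBound_pos hq lam
  calc stepSize q lam n T * gradBound q lam ≤ 1 / (8 * gradBound q lam) * gradBound q lam :=
        mul_le_mul_of_nonneg_right (min_le_left _ _) this.le
    _ = 1 / 8 := by field_simp
    _ ≤ 1 / 4 := by norm_num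

lemma stepSize_eq_div (hq : q < 1) (lam : ℝ) {n T : ℕ}
    (hT : Real.sqrt (Real.log (2 * (n : ℝ) - 1) / T) ≤ 1 / 4) :
    stepSize q lam n T =
      Real.sqrt (Real.log (2 * (n : ℝ) - 1) / T) / (2 * gradBound q lam) := by
  have := gradBound_pos hq lam
  rw [stepSize, min_eq_right, one_div_mul_eq_div]
  calc _ ≤ 1 / (2 * gradBound q lam) * (1 / 4) := mul_le_mul_of_nonneg_left hT (by positivity)
    _ = 1 / (8 * gradBound q lam) := by ring

end StepSize

section LinearizedLoss

variable {n : ℕ} {u : Fin n}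

/-- The estimated linearization at `w` of the screening objective, as a loss relative to the
weights `a`. -/
def linearizedLoss (p : Fin n → ℝ) (a : Others u → ℝ) (w : Coord u → ℝ) (x : Fin n → Entry) : ℝ :=
  ∑ i, (simplexToBall w i - a i) * gMiss p w x i

/-- The linearization at `w` of the screening objective, as a loss relative to the weights `a`: the
mean of `linearizedLoss`. -/
def meanLinearizedLoss (A : Matrix (Fin n) (Fin n) ℝ) (θ : Fin n → ℝ) (a : Others u → ℝ)
    (w : Coord u → ℝ) : ℝ :=
  ∑ i, (simplexToBall w i - a i) * screeningGrad A θ (simplexToBall w) i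

variable {q lam : ℝ} {p : Fin n → ℝ} {a : Others u → ℝ}

lemma abs_linearizedLoss_le (hp : ∀ i, 0 ≤ p i ∧ p i ≤ q) (hq : q < 1)
    (ha : ∑ j, |a j| ≤ lam) {w : Coord u → ℝ} (hw : InSimplex lam w) (x : Fin n → Entry) :
    |linearizedLoss p a w x| ≤ 2 * lam * gradBound q lam := by
  have hball := hw.sum_abs_simplexToBall_le
  calc |linearizedLoss p a w x| ≤ ∑ i, (|simplexToBall w i| + |a i|) * gradBound q lam := by
        refine (Finset.abs_sum_le_sum_abs _ _).trans (Finset.sum_le_sum fun i _ => ?_)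
        rw [abs_mul]
        exact mul_le_mul (abs_sub _ _) (abs_gMiss_le hp hq hball x i) (abs_nonneg _)
          (by positivity)
    _ ≤ 2 * lam * gradBound q lam := by
        rw [← Finset.sum_mul, Finset.sum_add_distrib]
        exact mul_le_mul_of_nonneg_right (by linarith) (gradBound_pos hq lam).le

variable (A : Matrix (Fin n) (Fin n) ℝ) (θ : Fin n → ℝ)

lemma integral_linearizedLoss (hp : ∀ i, 0 ≤ p i ∧ p i < 1) (a : Others u → ℝ)
    (w : Coord u → ℝ) :
    ∫ x, linearizedLoss p a w x ∂missLaw A θ p = meanLinearizedLoss A θ a w := by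
  have := isProbabilityMeasure_missLaw A θ fun i => ⟨(hp i).1, (hp i).2.le⟩
  simp only [linearizedLoss, meanLinearizedLoss]
  rw [integral_finsetSum _ fun i _ => Integrable.of_finite]
  simp only [integral_const_mul, integral_gMiss hp]

lemma abs_meanLinearizedLoss_le (hp : ∀ i, 0 ≤ p i ∧ p i ≤ q) (hq : q < 1)
    (ha : ∑ j, |a j| ≤ lam) {w : Coord u → ℝ} (hw : InSimplex lam w) :
    |meanLinearizedLoss A θ a w| ≤ 2 * lam * gradBound q lam := by
  have hp1 (i) : 0 ≤ p i ∧ p i < 1 := ⟨(hp i).1, (hp i).2.trans_lt hq⟩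
  have := isProbabilityMeasure_missLaw A θ fun i => ⟨(hp1 i).1, (hp1 i).2.le⟩
  rw [← integral_linearizedLoss A θ hp1, ← Real.norm_eq_abs]
  refine (norm_integral_le_of_norm_le_const (Filter.Eventually.of_forall
    fun x => abs_linearizedLoss_le hp hq ha hw x)).trans_eq ?_
  simp

theorem measureReal_le_sum_meanLinearizedLoss_sub_le {T : ℕ} {η : ℝ}
    (hp : ∀ i, 0 ≤ p i ∧ p i ≤ q) (hq : q < 1) (hlam : 0 < lam) (hη : 0 ≤ η)
    (hηB : η * gradBound q lam ≤ 1 / 4) (ha : ∑ j, |a j| ≤ lam) {r : ℝ} (hr : 0 ≤ r) :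
    (sampleLaw A θ p T).real
        {X | r ≤ ∑ t : Fin T, (meanLinearizedLoss A θ a (smgIter u p lam η X t) -
          linearizedLoss p a (smgIter u p lam η X t) (X t))} ≤
      Real.exp (-(r ^ 2 / (2 * T * (4 * lam * gradBound q lam) ^ 2))) := by
  have hp1 (i) : 0 ≤ p i ∧ p i < 1 := ⟨(hp i).1, (hp i).2.trans_lt hq⟩
  have := isProbabilityMeasure_missLaw A θ fun i => ⟨(hp1 i).1, (hp1 i).2.le⟩
  simp only [smgIter_eq_runProcess]
  refine measureReal_le_sum_runProcess_le (Inv := InSimplex lam)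
    (φ := fun w x => meanLinearizedLoss A θ a w - linearizedLoss p a w x)
    (fun w x hw => hw.mwStep hlam hη hηB (abs_GMiss_le hp hq hw x)) (fun w x hw => ?_)
    (fun w _ => ?_) (by simpa only [card_coord] using inSimplex_const (κ := Coord u) hlam) hr
  · refine (abs_sub _ _).trans ((add_le_add (abs_meanLinearizedLoss_le A θ hp hq ha hw)
      (abs_linearizedLoss_le hp hq ha hw x)).trans_eq ?_)
    ring
  · rw [integral_sub Integrable.of_finite Integrable.of_finite, integral_linearizedLoss A θ hp1]
    simp

end LinearizedLoss

section Recovery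

variable {n T : ℕ} {q lam : ℝ} {p : Fin n → ℝ} {u : Fin n}

lemma simplexToBall_smgOutput (u : Fin n) (p : Fin n → ℝ) (lam η : ℝ)
    (X : Fin T → Fin n → Entry) (i : Others u) :
    simplexToBall (smgOutput u p lam η X) i =
      (∑ t : Fin T, simplexToBall (smgIter u p lam η X t) i) / T := by
  rw [Fin.sum_univ_eq_sum_range fun t => simplexToBall (smgIter u p lam η X t) i]
  simp only [simplexToBall, smgOutput, Finset.sum_sub_distrib, sub_div]

lemma abs_apply_le_sum_abs {ι : Type*} [Fintype ι] (v : ι → ℝ) (i : ι) : |v i| ≤ ∑ j, |v j| :=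
  Finset.single_le_sum (f := fun j => |v j|) (fun _ _ => abs_nonneg _) (Finset.mem_univ i)

lemma abs_simplexToBall_smgOutput_le {η : ℝ} (hlam : 0 < lam) (hη : 0 ≤ η)
    (hηB : η * gradBound q lam ≤ 1 / 4) (hp : ∀ i, 0 ≤ p i ∧ p i ≤ q) (hq : q < 1)
    (X : Fin T → Fin n → Entry) (i : Others u) :
    |simplexToBall (smgOutput u p lam η X) i| ≤ lam := by
  rw [simplexToBall_smgOutput, abs_div, Nat.abs_cast]
  refine div_le_of_le_mul₀ (Nat.cast_nonneg _) hlam.le ?_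
  calc |∑ t : Fin T, simplexToBall (smgIter u p lam η X t) i| ≤ ∑ _t : Fin T, lam :=
        (Finset.abs_sum_le_sum_abs _ _).trans (Finset.sum_le_sum fun t _ =>
          (abs_apply_le_sum_abs _ i).trans
            (inSimplex_smgIter hlam hη hηB hp hq u X t).sum_abs_simplexToBall_le)
    _ = lam * T := by rw [Finset.sum_const, Finset.card_univ, Fintype.card_fin, nsmul_eq_mul,
        mul_comm]

theorem sum_linearizedLoss_smgIter_le (hlam : 0 < lam) (hp : ∀ i, 0 ≤ p i ∧ p i ≤ q)
    (hq : q < 1) {a : Others u → ℝ} (ha : ∑ j, |a j| ≤ lam)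
    (hT : 16 * Real.log (2 * (n : ℝ) - 1) ≤ T) (X : Fin T → Fin n → Entry) :
    ∑ t : Fin T, linearizedLoss p a (smgIter u p lam (stepSize q lam n T) X t) (X t) ≤
      6 * (lam * gradBound q lam * T * Real.sqrt (Real.log (2 * (n : ℝ) - 1) / T)) := by
  have hB := gradBound_pos hq lam
  rcases eq_or_ne n 1 with rfl | hn1
  · simp only [linearizedLoss]
    have : IsEmpty (Others u) := ⟨fun j => j.2 (Subsingleton.elim _ _)⟩
    simp only [Finset.univ_eq_empty, Finset.sum_empty, Finset.sum_const_zero]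
    positivity
  have hn2 : (2 : ℝ) ≤ n := by exact_mod_cast (by have := u.2; omega : 2 ≤ n)
  have hlog : 0 < Real.log (2 * (n : ℝ) - 1) := Real.log_pos (by linarith)
  have hT0 : (0 : ℝ) < T := by linarith
  set Ψ := ∑ t : Fin T, linearizedLoss p a (smgIter u p lam (stepSize q lam n T) X t) (X t)
  have hregret : stepSize q lam n T * Ψ ≤ _ := mul_sum_regret_smgIter_le hlam
    (stepSize_nonneg hq lam n T) (stepSize_mul_gradBound_le hq lam n T) hp hq a ha X
  have hρ4 : Real.sqrt (Real.log (2 * (n : ℝ) - 1) / T) ≤ 1 / 4 := by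
    refine Real.sqrt_le_iff.2 ⟨by norm_num, ?_⟩
    rw [div_le_iff₀ hT0]
    linarith
  have hη := stepSize_eq_div hq lam hρ4
  have hρ2 := Real.sq_sqrt (div_pos hlog hT0).le
  have hρ := Real.sqrt_pos.2 (div_pos hlog hT0)
  set ρ := Real.sqrt (Real.log (2 * (n : ℝ) - 1) / T)
  rw [eq_div_iff hT0.ne'] at hρ2
  rw [hη, ← hρ2, div_mul_eq_mul_div, div_le_iff₀ (by positivity)] at hregret
  refine le_of_mul_le_mul_left (hregret.trans_eq ?_) hρ
  field_simp
  ring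

variable {A : Matrix (Fin n) (Fin n) ℝ}

/-- The screening inequality at every iterate, and Jensen's inequality for the square. -/
theorem sq_sub_smgOutput_le (hA : A.IsSymm) (hd : ∀ i, A i i = 0) {η : ℝ} (hlam : 0 < lam)
    (hrow : ∀ i, ∑ j, |A i j| ≤ lam) (hη : 0 ≤ η) (hηB : η * gradBound q lam ≤ 1 / 4)
    (hp : ∀ i, 0 ≤ p i ∧ p i ≤ q) (hq : q < 1) (hT : 0 < T) (X : Fin T → Fin n → Entry)
    (i : Others u) :
    Real.exp (-3 * lam) / (1 + 2 * lam) *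
        (simplexToBall (smgOutput u p lam η X) i - A u i) ^ 2 * T ≤
      ∑ t : Fin T, meanLinearizedLoss A 0 (rowWeights A u) (smgIter u p lam η X t) := by
  have hT0 : (0 : ℝ) < T := by exact_mod_cast hT
  have hmean : simplexToBall (smgOutput u p lam η X) i - A u i =
      (∑ t : Fin T, (simplexToBall (smgIter u p lam η X t) i - A u i)) / T := by
    rw [simplexToBall_smgOutput, Finset.sum_sub_distrib, Finset.sum_const, Finset.card_univ,
      Fintype.card_fin, nsmul_eq_mul]
    field_simp
  have hjensen : (simplexToBall (smgOutput u p lam η X) i - A u i) ^ 2 * T ≤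
      ∑ t : Fin T, (simplexToBall (smgIter u p lam η X t) i - A u i) ^ 2 := by
    have hcs := sq_sum_le_card_mul_sum_sq (s := (Finset.univ : Finset (Fin T)))
      (f := fun t => simplexToBall (smgIter u p lam η X t) i - A u i)
    rw [Finset.card_univ, Fintype.card_fin] at hcs
    rw [hmean, div_pow, div_mul_eq_mul_div, div_le_iff₀ (pow_pos hT0 2)]
    nlinarith
  calc _ ≤ Real.exp (-3 * lam) / (1 + 2 * lam) *
        ∑ t : Fin T, (simplexToBall (smgIter u p lam η X t) i - A u i) ^ 2 := by
        rw [mul_assoc]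
        exact mul_le_mul_of_nonneg_left hjensen (by positivity)
    _ ≤ _ := by
        rw [Finset.mul_sum]
        exact Finset.sum_le_sum fun t _ => sq_le_sum_sub_mul_screeningGrad hA hd hrow
          (inSimplex_smgIter hlam hη hηB hp hq u X t).sum_abs_simplexToBall_le i

/-- The squared error of the output is of order `errorScale q lam * √(L / T)` when the failure
probability is `exp (-L)`. -/
def errorScale (q lam : ℝ) : ℝ := lam * (1 + lam) * gradBound q lam * Real.exp (3 * lam)

lemma errorScale_pos (hq : q < 1) (hlam : 0 < lam) : 0 < errorScale q lam := by
  have := gradBound_pos hq lam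
  unfold errorScale
  positivity

lemma sq_le_errorScale (hq0 : 0 ≤ q) (hq : q < 1) (hlam : 0 ≤ lam) :
    lam ^ 2 ≤ errorScale q lam := by
  have hB := one_le_gradBound hq0 hq hlam
  calc lam ^ 2 ≤ lam * (1 + lam) := by nlinarith
    _ ≤ lam * (1 + lam) * gradBound q lam := le_mul_of_one_le_right (by positivity) hB
    _ ≤ errorScale q lam :=
        le_mul_of_one_le_right (by positivity) (Real.one_le_exp (by positivity))

lemma explicitBound_eq (K q lam L ε : ℝ) :
    explicitBound K q lam L ε = K * errorScale q lam ^ 2 * L / ε ^ 4 := by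
  have hexp : Real.exp ((2 / (1 - q) + 6) * lam) =
      (Real.exp (lam / (1 - q)) * Real.exp (3 * lam)) ^ 2 := by
    rw [← Real.exp_add, ← Real.exp_nat_mul]
    congr 1
    push_cast
    ring
  rw [explicitBound, hexp, errorScale, gradBound, show (1 - q) ^ 4 = ((1 - q) ^ 2) ^ 2 by ring]
  generalize (1 - q) ^ 2 = b
  ring

lemma sq_lt_errorScale_mul (hq : q < 1) (hlam : 0 < lam) {e σ : ℝ} (hσ : 0 ≤ σ)
    (he : Real.exp (-3 * lam) / (1 + 2 * lam) * e ^ 2 < 15 * (lam * gradBound q lam * σ)) :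
    e ^ 2 < 30 * errorScale q lam * σ := by
  have := gradBound_pos hq lam
  calc e ^ 2 = Real.exp (3 * lam) * (1 + 2 * lam) *
        (Real.exp (-3 * lam) / (1 + 2 * lam) * e ^ 2) := by
        rw [neg_mul, Real.exp_neg]
        field_simp
    _ < Real.exp (3 * lam) * (1 + 2 * lam) * (15 * (lam * gradBound q lam * σ)) :=
        mul_lt_mul_of_pos_left he (by positivity)
    _ ≤ Real.exp (3 * lam) * (2 * (1 + lam)) * (15 * (lam * gradBound q lam * σ)) := by
        gcongr
        linarith
    _ = 30 * errorScale q lam * σ := by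
        rw [errorScale]
        ring

theorem measureReal_compl_sq_error_lt_le (hA : A.IsSymm) (hd : ∀ i, A i i = 0) (hq : q < 1)
    (hlam : 0 < lam) (hrow : ∀ i, ∑ j, |A i j| ≤ lam) (hp : ∀ i, 0 ≤ p i ∧ p i ≤ q)
    (hT : 0 < T) {L : ℝ} (hL : Real.log (2 * (n : ℝ) - 1) ≤ 2 * L) (hLT : 32 * L ≤ T) :
    (sampleLaw A 0 p T).real
        {X | ∀ i : Others u,
          (simplexToBall (smgOutput u p lam (stepSize q lam n T) X) i - A u i) ^ 2 <
            30 * errorScale q lam * Real.sqrt (L / T)}ᶜ ≤ Real.exp (-L) := by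
  have hT0 : (0 : ℝ) < T := by exact_mod_cast hT
  have hn : (1 : ℝ) ≤ n := by exact_mod_cast Nat.one_le_of_lt u.2
  have hL0 : 0 ≤ L := by linarith [Real.log_nonneg (by linarith : 1 ≤ 2 * (n : ℝ) - 1)]
  have hB := gradBound_pos hq lam
  have hη := stepSize_nonneg hq lam n T
  have hηB := stepSize_mul_gradBound_le hq lam n T
  have ha : ∑ j, |rowWeights A u j| ≤ lam := (sum_abs_rowWeights (hd u)).trans_le (hrow u)
  have hσρ : Real.sqrt (Real.log (2 * (n : ℝ) - 1) / T) ≤ 3 / 2 * Real.sqrt (L / T) := by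
    refine Real.sqrt_le_iff.2 ⟨by positivity, ?_⟩
    rw [mul_pow, Real.sq_sqrt (by positivity), ← mul_div_assoc]
    gcongr
    linarith
  have hexponent : (6 * (lam * gradBound q lam * T * Real.sqrt (L / T))) ^ 2 /
      (2 * T * (4 * lam * gradBound q lam) ^ 2) = 9 / 8 * L := by
    simp only [mul_pow, Real.sq_sqrt (by positivity : 0 ≤ L / T)]
    field_simp
    ring
  have := isProbabilityMeasure_sampleLaw A 0 (fun i => ⟨(hp i).1, (hp i).2.trans hq.le⟩) T
  refine (measureReal_mono fun X hX => ?_).trans ((measureReal_le_sum_meanLinearizedLoss_sub_le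
    (T := T) (u := u) A 0 hp hq hlam hη hηB ha
    (r := 6 * (lam * gradBound q lam * T * Real.sqrt (L / T))) (by positivity)).trans ?_)
  · contrapose! hX
    rw [Set.notMem_compl_iff]
    intro i
    simp only [Set.mem_ofPred_eq, not_le, Finset.sum_sub_distrib] at hX
    have herror := sq_sub_smgOutput_le hA hd hlam hrow hη hηB hp hq hT X i
    have hregret := (sum_linearizedLoss_smgIter_le hlam hp hq ha (by linarith) X).trans
      (mul_le_mul_of_nonneg_left (mul_le_mul_of_nonneg_left hσρ (by positivity)) (by norm_num))
    refine sq_lt_errorScale_mul hq hlam (Real.sqrt_nonneg _) (lt_of_mul_lt_mul_right ?_ hT0.le)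
    linarith
  · rw [hexponent]
    exact Real.exp_le_exp.2 (by linarith)

end Recovery

lemma log_two_mul_sub_one_le {n : ℝ} (hn : 1 ≤ n) :
    Real.log (2 * n - 1) ≤ 2 * Real.log n := by
  rw [← Nat.cast_two, ← Real.log_pow]
  exact Real.log_le_log (by push_cast; linarith) (by push_cast; nlinarith [sq_nonneg (n - 1)])

section ErrorScale

variable {q lam L ε : ℝ} {T : ℕ}

lemma le_of_explicitBound_le {K : ℝ} (hK : 0 ≤ K) (hq0 : 0 ≤ q) (hq : q < 1) (hlam : 0 < lam)
    (hL : 0 ≤ L) (hε : 0 < ε) (hεlam : ε ≤ 2 * lam) (hT : explicitBound K q lam L ε ≤ T) :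
    K / 16 * L ≤ T := by
  refine le_trans ?_ hT
  rw [explicitBound_eq, le_div_iff₀ (by positivity)]
  have hε4 : ε ^ 4 ≤ 16 * errorScale q lam ^ 2 := by
    calc ε ^ 4 ≤ (2 * lam) ^ 4 := pow_le_pow_left₀ hε.le hεlam 4
      _ = 16 * (lam ^ 2) ^ 2 := by ring
      _ ≤ 16 * errorScale q lam ^ 2 := by
        gcongr
        exact sq_le_errorScale hq0 hq hlam.le
  calc K / 16 * L * ε ^ 4 ≤ K / 16 * L * (16 * errorScale q lam ^ 2) :=
        mul_le_mul_of_nonneg_left hε4 (by positivity)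
    _ = K * errorScale q lam ^ 2 * L := by ring

lemma mul_errorScale_mul_sqrt_le {c : ℝ} (hε : 0 < ε) (hT0 : 0 < T)
    (hT : explicitBound (c ^ 2) q lam L ε ≤ T) :
    c * errorScale q lam * Real.sqrt (L / T) ≤ ε ^ 2 := by
  have hT0 : (0 : ℝ) < T := by exact_mod_cast hT0
  rw [explicitBound_eq, div_le_iff₀ (by positivity)] at hT
  rcases le_total L 0 with hL | hL
  · rw [Real.sqrt_eq_zero_of_nonpos (div_nonpos_of_nonpos_of_nonneg hL hT0.le), mul_zero]
    positivity
  refine le_of_sq_le_sq ?_ (by positivity)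
  rw [mul_pow, mul_pow, Real.sq_sqrt (by positivity), ← mul_div_assoc, div_le_iff₀ hT0]
  linarith

end ErrorScale

section Recovery

variable {n T : ℕ} {A : Matrix (Fin n) (Fin n) ℝ} {q lam : ℝ} {p : Fin n → ℝ}

theorem measureReal_compl_weight_recovery_le (hA : A.IsSymm) (hd : ∀ i, A i i = 0) (hq : q < 1)
    (hlam : 0 < lam) (hrow : ∀ i, ∑ j, |A i j| ≤ lam) (hp : ∀ i, 0 ≤ p i ∧ p i ≤ q)
    {L ε : ℝ} (hL0 : 0 < L) (hL : Real.log n ≤ L) (hε : 0 < ε)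
    (hT : explicitBound 1024 q lam L ε ≤ T) (u : Fin n) :
    (sampleLaw A 0 p T).real {X | ∀ i : Others u,
      |simplexToBall (smgOutput u p lam (stepSize q lam n T) X) i - A u i| < ε}ᶜ ≤
        Real.exp (-L) := by
  have hq0 : 0 ≤ q := (hp u).1.trans (hp u).2
  rcases lt_or_ge (2 * lam) ε with hε2 | hε2
  · have htriv : {X : Fin T → Fin n → Entry | ∀ i : Others u,
        |simplexToBall (smgOutput u p lam (stepSize q lam n T) X) i - A u i| < ε} = Set.univ := by
      refine Set.eq_univ_of_forall fun X i => ?_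
      have hout := abs_simplexToBall_smgOutput_le hlam (stepSize_nonneg hq lam n T)
        (stepSize_mul_gradBound_le hq lam n T) hp hq X i
      have hAi := (abs_apply_le_sum_abs (A u) i).trans (hrow u)
      exact (abs_sub _ _).trans_lt (by linarith)
    rw [htriv, Set.compl_univ, measureReal_empty]
    positivity
  have hLT := le_of_explicitBound_le (by norm_num) hq0 hq hlam hL0.le hε hε2 hT
  have hT0 : 0 < T := by exact_mod_cast (by linarith : (0 : ℝ) < T)
  have hn : (1 : ℝ) ≤ n := by exact_mod_cast Nat.one_le_of_lt u.2
  have := isProbabilityMeasure_sampleLaw A 0 (fun i => ⟨(hp i).1, (hp i).2.trans hq.le⟩) T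
  refine (measureReal_mono (Set.compl_subset_compl.2 fun X hX i => ?_)).trans
    (measureReal_compl_sq_error_lt_le hA hd hq hlam hrow hp hT0
      ((log_two_mul_sub_one_le hn).trans (by linarith)) (by linarith))
  have hscale : 30 * errorScale q lam * Real.sqrt (L / T) ≤ ε ^ 2 := by
    have := errorScale_pos hq hlam
    refine le_trans ?_ (mul_errorScale_mul_sqrt_le (c := 32) hε hT0 (by norm_num; exact hT))
    gcongr
    norm_num
  exact abs_lt_of_sq_lt_sq ((hX i).trans_le hscale) hε.le

lemma one_sub_le_measureReal {Ω : Type*} [MeasurableSpace Ω] {μ : Measure Ω}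
    [IsProbabilityMeasure μ] {s t : Set Ω} (hs : MeasurableSet s) (hst : s ⊆ t) {δ : ℝ}
    (h : μ.real sᶜ ≤ δ) : 1 - δ ≤ μ.real t := by
  have hcompl := probReal_compl_eq_one_sub (μ := μ) hs
  have hmono : μ.real s ≤ μ.real t := measureReal_mono hst
  linarith

lemma log_pow_div_pos_and_log_le {n k : ℕ} (hn : 1 ≤ n) (hk : k ≠ 0) {δ : ℝ} (hδ0 : 0 < δ)
    (hδ1 : δ < 1) :
    0 < Real.log ((n : ℝ) ^ k / δ) ∧ Real.log n ≤ Real.log ((n : ℝ) ^ k / δ) := by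
  have hn : (1 : ℝ) ≤ n := by exact_mod_cast hn
  have hlt : (n : ℝ) ^ k < n ^ k / δ := by
    rw [lt_div_iff₀ hδ0]
    exact mul_lt_of_lt_one_right (by positivity) hδ1
  exact ⟨Real.log_pos ((one_le_pow₀ hn).trans_lt hlt),
    Real.log_le_log (by positivity) ((le_self_pow₀ hn hk).trans hlt.le)⟩

theorem weight_recovery (hA : A.IsSymm) (hd : ∀ i, A i i = 0) (hq : q < 1) (hlam : 0 < lam)
    (hrow : ∀ i, ∑ j, |A i j| ≤ lam) (hp : ∀ i, 0 ≤ p i ∧ p i ≤ q) {δ ε : ℝ} (hδ0 : 0 < δ)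
    (hδ1 : δ < 1) (hε : 0 < ε) (u : Fin n)
    (hT : explicitBound 1024 q lam (Real.log (n / δ)) ε ≤ T) :
    1 - δ ≤ (sampleLaw A 0 p T).real {X | ∀ i : Others u,
      |simplexToBall (smgOutput u p lam (stepSize q lam n T) X) i - A u i| ≤ ε} := by
  have := isProbabilityMeasure_sampleLaw A 0 (fun i => ⟨(hp i).1, (hp i).2.trans hq.le⟩) T
  have hn1 : 1 ≤ n := Nat.one_le_of_lt u.2
  have hn : (1 : ℝ) ≤ n := by exact_mod_cast hn1
  obtain ⟨hL0, hL⟩ := log_pow_div_pos_and_log_le hn1 one_ne_zero hδ0 hδ1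
  rw [pow_one] at hL0 hL
  refine one_sub_le_measureReal (Set.toFinite _).measurableSet (fun X hX i => (hX i).le)
    ((measureReal_compl_weight_recovery_le hA hd hq hlam hrow hp hL0 hL hε hT u).trans ?_)
  rw [Real.exp_neg, Real.exp_log (by positivity), inv_div]
  exact div_le_self hδ0.le hn

/-! ### Recovery of the graph -/

lemma neighborSet_depGraph (hA : A.IsSymm) (u : Fin n) :
    (depGraph A).neighborSet u = {i | i ≠ u ∧ A u i ≠ 0} := by
  ext i
  simp only [SimpleGraph.mem_neighborSet, depGraph, SimpleGraph.fromRel_adj, Set.mem_ofPred_eq,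
    hA.apply u i, or_self, ne_comm]

lemma estNeighbors_eq_neighborSet (hA : A.IsSymm) {η β : ℝ}
    (hβ : ∀ i j, A i j ≠ 0 → β ≤ |A i j|) {X : Fin T → Fin n → Entry} {u : Fin n}
    (h : ∀ i : Others u, |simplexToBall (smgOutput u p lam η X) i - A u i| < β / 2) :
    estNeighbors p lam η β X u = (depGraph A).neighborSet u := by
  rw [neighborSet_depGraph hA]
  ext i
  constructor
  · rintro ⟨hi, hle⟩
    refine ⟨hi, fun h0 => hle.not_gt ?_⟩
    simpa only [h0, sub_zero] using h ⟨i, hi⟩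
  · rintro ⟨hi, hne⟩
    have herror := h ⟨i, hi⟩
    rw [abs_sub_comm] at herror
    have htriangle := abs_sub_abs_le_abs_sub (A u i) (simplexToBall (smgOutput u p lam η X) ⟨i, hi⟩)
    exact ⟨hi, by linarith [hβ u i hne]⟩

theorem graph_recovery (hA : A.IsSymm) (hd : ∀ i, A i i = 0) (hq : q < 1) (hlam : 0 < lam)
    (hrow : ∀ i, ∑ j, |A i j| ≤ lam) (hp : ∀ i, 0 ≤ p i ∧ p i ≤ q) {δ β : ℝ} (hδ0 : 0 < δ)
    (hδ1 : δ < 1) (hβ : 0 < β) (hAβ : ∀ i j, A i j ≠ 0 → β ≤ |A i j|)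
    (hT : explicitBound 1024 q lam (Real.log ((n : ℝ) ^ 2 / δ)) (β / 2) ≤ T) :
    1 - δ ≤ (sampleLaw A 0 p T).real
      {X | ∀ u, estNeighbors p lam (stepSize q lam n T) β X u = (depGraph A).neighborSet u} := by
  have := isProbabilityMeasure_sampleLaw A 0 (fun i => ⟨(hp i).1, (hp i).2.trans hq.le⟩) T
  let good (u : Fin n) : Set (Fin T → Fin n → Entry) := {X | ∀ i : Others u,
    |simplexToBall (smgOutput u p lam (stepSize q lam n T) X) i - A u i| < β / 2}
  have hbad (u : Fin n) : (sampleLaw A 0 p T).real (good u)ᶜ ≤ δ / n := by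
    have hn1 : 1 ≤ n := Nat.one_le_of_lt u.2
    have hn : (1 : ℝ) ≤ n := by exact_mod_cast hn1
    obtain ⟨hL0, hL⟩ := log_pow_div_pos_and_log_le hn1 two_ne_zero hδ0 hδ1
    refine (measureReal_compl_weight_recovery_le hA hd hq hlam hrow hp hL0 hL (half_pos hβ)
      hT u).trans ?_
    rw [Real.exp_neg, Real.exp_log (by positivity), inv_div]
    exact div_le_div_of_nonneg_left hδ0.le (by positivity) (le_self_pow₀ hn two_ne_zero)
  have hunion : (sampleLaw A 0 p T).real (⋂ u, good u)ᶜ ≤ δ := by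
    rw [Set.compl_iInter]
    calc _ ≤ ∑ _u : Fin n, δ / n :=
          (measureReal_iUnion_fintype_le _).trans (Finset.sum_le_sum fun u _ => hbad u)
      _ = n * (δ / n) := by rw [Finset.sum_const, Finset.card_univ, Fintype.card_fin, nsmul_eq_mul]
      _ ≤ δ := by
        rw [← mul_div_assoc]
        exact div_le_of_le_mul₀ (Nat.cast_nonneg n) hδ0.le (mul_comm _ _).le
  exact one_sub_le_measureReal (Set.toFinite _).measurableSet
    (fun X hX u => estNeighbors_eq_neighborSet hA hAβ (Set.mem_iInter.1 hX u)) hunion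

end Recovery

/-! ### Numbers of samples -/

section SampleBound

lemma sq_mul_one_add_sq_le {lam₀ lam : ℝ} (hlam₀ : 0 < lam₀) (hlam : lam₀ ≤ lam) :
    lam ^ 2 * (1 + lam) ^ 2 ≤ lam ^ 4 * (1 + 1 / lam₀) ^ 2 := by
  have hlam0 : 0 < lam := hlam₀.trans_le hlam
  have hone : 1 + lam ≤ lam * (1 + 1 / lam₀) := by
    have : 1 ≤ lam * (1 / lam₀) := by rwa [mul_one_div, one_le_div hlam₀]
    linarith
  calc lam ^ 2 * (1 + lam) ^ 2 ≤ lam ^ 2 * (lam * (1 + 1 / lam₀)) ^ 2 := by gcongr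
    _ = lam ^ 4 * (1 + 1 / lam₀) ^ 2 := by ring

lemma le_exp_div_mul {Q lam₀ lam : ℝ} (hQ : 0 ≤ Q) (hlam₀ : 0 < lam₀) (hlam : lam₀ ≤ lam) :
    Q ≤ Real.exp (Q / lam₀ * lam) := by
  have hle : Q ≤ Q / lam₀ * lam := by
    rw [div_mul_eq_mul_div, le_div_iff₀ hlam₀]
    exact mul_le_mul_of_nonneg_left hlam hQ
  linarith [Real.add_one_le_exp (Q / lam₀ * lam)]

theorem exists_explicitBound_le_sampleBound {K q lam₀ : ℝ} (hK : 0 ≤ K) (hq : q < 1)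
    (hlam₀ : 0 < lam₀) :
    ∃ C : ℝ, 0 < C ∧ ∀ lam L ε : ℝ, lam₀ ≤ lam → 0 ≤ L →
      explicitBound K q lam L ε ≤ sampleBound C lam L ε := by
  have : 0 < 1 - q := by linarith
  set Q := K * (1 + 1 / lam₀) ^ 2 / (1 - q) ^ 4
  have hQ : 0 ≤ Q := by positivity
  refine ⟨2 / (1 - q) + 6 + Q / lam₀, by positivity, fun lam L ε hlam hL => ?_⟩
  rw [explicitBound, sampleBound, add_mul _ (Q / lam₀), Real.exp_add]
  calc K * (lam ^ 2 * (1 + lam) ^ 2 / (1 - q) ^ 4) * Real.exp ((2 / (1 - q) + 6) * lam) * L *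
          (ε ^ 4)⁻¹
      ≤ K * (lam ^ 4 * (1 + 1 / lam₀) ^ 2 / (1 - q) ^ 4) *
          Real.exp ((2 / (1 - q) + 6) * lam) * L * (ε ^ 4)⁻¹ := by
        gcongr ?_ * (?_ / _) * _ * _ * _
        exact sq_mul_one_add_sq_le hlam₀ hlam
    _ = lam ^ 4 * L * (Real.exp ((2 / (1 - q) + 6) * lam) * Q) * (ε ^ 4)⁻¹ := by
        ring
    _ ≤ _ := by
        gcongr
        exact le_exp_div_mul hQ hlam₀ hlam

end SampleBound

/-! ### Frames, loops and running times of programs -/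

namespace RAMState

@[simp] lemma idx_set (σ : RAMState) (d : Ref) (v : ℝ) : (σ.set d v).idx = σ.idx := rfl

lemma mem_set (σ : RAMState) (d : Ref) (v : ℝ) (a i j : ℕ) :
    (σ.set d v).mem a i j =
      if a = d.arr ∧ i = σ.idx d.row ∧ j = σ.idx d.col then v else σ.mem a i j := rfl

@[simp] lemma mem_setIdx (σ : RAMState) (r k : ℕ) : (σ.setIdx r k).mem = σ.mem := rfl

lemma idx_setIdx (σ : RAMState) (r k s : ℕ) :
    (σ.setIdx r k).idx s = if s = r then k else σ.idx s := by
  simp [setIdx, Function.update_apply]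

/-- The states `σ` and `τ` agree outside the index registers `rs` and the arrays `as`. -/
structure AgreeOutside (rs as : List ℕ) (σ τ : RAMState) : Prop where
  idx_eq : ∀ r ∉ rs, τ.idx r = σ.idx r
  mem_eq : ∀ a ∉ as, τ.mem a = σ.mem a

namespace AgreeOutside

variable {rs rs' as as' : List ℕ} {σ τ υ : RAMState}

lemma refl (σ : RAMState) : AgreeOutside rs as σ σ := ⟨fun _ _ => rfl, fun _ _ => rfl⟩

lemma mono (h : AgreeOutside rs as σ τ) (hrs : rs ⊆ rs') (has : as ⊆ as') :
    AgreeOutside rs' as' σ τ :=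
  ⟨fun r hr => h.idx_eq r fun h' => hr (hrs h'), fun a ha => h.mem_eq a fun h' => ha (has h')⟩

lemma trans (h : AgreeOutside rs as σ τ) (h' : AgreeOutside rs as τ υ) :
    AgreeOutside rs as σ υ :=
  ⟨fun r hr => (h'.idx_eq r hr).trans (h.idx_eq r hr),
    fun a ha => (h'.mem_eq a ha).trans (h.mem_eq a ha)⟩

end AgreeOutside

lemma agreeOutside_setIdx (σ : RAMState) (r k : ℕ) : AgreeOutside [r] [] σ (σ.setIdx r k) :=
  ⟨fun s hs => by rw [idx_setIdx, if_neg (List.mem_singleton.not.1 hs)], fun _ _ => rfl⟩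

lemma agreeOutside_set (σ : RAMState) (d : Ref) (v : ℝ) :
    AgreeOutside [] [d.arr] σ (σ.set d v) := by
  refine ⟨fun _ _ => rfl, fun a ha => ?_⟩
  funext i j
  rw [mem_set, if_neg fun h => List.mem_singleton.not.1 ha h.1]

end RAMState

namespace Prog

open RAMState

/-- Sequential composition of a list of programs. -/
def block : List Prog → Prog
  | [] => .skip
  | P :: Ps => .seq P (block Ps)

/-- The arrays that a program may write to. -/
def arrs : Prog → List ℕ
  | .skip | .idxConst _ _ | .idxCopy _ _ | .idxSucc _ | .idxPred _ => []
  | .const d _ | .copy d _ | .arith _ d _ _ | .exp d _ => [d.arr]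
  | .seq P Q | .ifLt _ _ P Q | .ifLe _ _ P Q => P.arrs ++ Q.arrs
  | .loop _ _ P => P.arrs

/-- The index registers that a program may write to. -/
def regs : Prog → List ℕ
  | .idxConst r _ | .idxCopy r _ | .idxSucc r | .idxPred r => [r]
  | .skip | .const _ _ | .copy _ _ | .arith _ _ _ _ | .exp _ _ => []
  | .seq P Q | .ifLt _ _ P Q | .ifLe _ _ P Q => P.regs ++ Q.regs
  | .loop r _ P => r :: P.regs

/-- The state and the step count after `k` rounds of the loop over `P` with counter `r`. -/
def rounds (r : ℕ) (P : Prog) (σ : RAMState) : ℕ → RAMState × ℕ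
  | 0 => (σ, 1)
  | k + 1 => ((P.exec ((rounds r P σ k).1.setIdx r k)).1,
      (rounds r P σ k).2 + (P.exec ((rounds r P σ k).1.setIdx r k)).2 + 1)

lemma exec_loop (r s : ℕ) (P : Prog) (σ : RAMState) :
    (Prog.loop r s P).exec σ = rounds r P σ (σ.idx s) := by
  rw [exec]
  induction σ.idx s with
  | zero => rfl
  | succ k ih => simp only [rounds, ← ih]

lemma agreeOutside_rounds_setIdx {r k : ℕ} {P : Prog} {σ : RAMState}
    (h : AgreeOutside (r :: P.regs) P.arrs σ (rounds r P σ k).1) :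
    AgreeOutside (r :: P.regs) P.arrs σ ((rounds r P σ k).1.setIdx r k) :=
  h.trans ((agreeOutside_setIdx _ r k).mono (by simp) (by simp))

lemma agreeOutside_rounds {r : ℕ} {P : Prog}
    (hP : ∀ τ, AgreeOutside P.regs P.arrs τ (P.exec τ).1) (σ : RAMState) (k : ℕ) :
    AgreeOutside (r :: P.regs) P.arrs σ (rounds r P σ k).1 := by
  induction k with
  | zero => exact .refl σ
  | succ k ih =>
    exact (agreeOutside_rounds_setIdx ih).trans
      ((hP _).mono (List.subset_cons_self _ _) (List.Subset.refl _))

lemma agreeOutside_exec (P : Prog) (σ : RAMState) :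
    AgreeOutside P.regs P.arrs σ (P.exec σ).1 := by
  induction P generalizing σ with
  | skip => exact .refl σ
  | idxConst | idxCopy | idxSucc | idxPred => exact agreeOutside_setIdx σ _ _
  | const | copy | arith | exp => exact agreeOutside_set σ _ _
  | seq P Q ihP ihQ =>
    exact ((ihP σ).mono (List.subset_append_left _ _) (List.subset_append_left _ _)).trans
      ((ihQ _).mono (List.subset_append_right _ _) (List.subset_append_right _ _))
  | ifLt r s P Q ihP ihQ | ifLe r s P Q ihP ihQ =>
    rw [exec]
    split_ifs
    · exact (ihP σ).mono (List.subset_append_left _ _) (List.subset_append_left _ _)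
    · exact (ihQ σ).mono (List.subset_append_right _ _) (List.subset_append_right _ _)
  | loop r s P ih =>
    rw [exec_loop]
    exact agreeOutside_rounds ih σ _

lemma exec_idx_of_notMem {P : Prog} {r : ℕ} (h : r ∉ P.regs) (σ : RAMState) :
    (P.exec σ).1.idx r = σ.idx r :=
  (agreeOutside_exec P σ).idx_eq r h

lemma exec_mem_of_notMem {P : Prog} {a : ℕ} (h : a ∉ P.arrs) (σ : RAMState) :
    (P.exec σ).1.mem a = σ.mem a :=
  (agreeOutside_exec P σ).mem_eq a h

/-- The invariant must not depend on the counter, which every round overwrites. -/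
lemma loop_induction {r s : ℕ} {P : Prog} {σ : RAMState} (I : ℕ → RAMState → Prop)
    (hI : ∀ k τ, I k τ → I k (τ.setIdx r k)) (h0 : I 0 σ)
    (hstep : ∀ k < σ.idx s, ∀ τ, AgreeOutside (r :: P.regs) P.arrs σ τ → τ.idx r = k →
      I k τ → I (k + 1) (P.exec τ).1) :
    I (σ.idx s) ((Prog.loop r s P).exec σ).1 := by
  rw [exec_loop]
  suffices h : ∀ k ≤ σ.idx s, I k (rounds r P σ k).1 from h _ le_rfl
  intro k
  induction k with
  | zero => exact fun _ => h0
  | succ k ih =>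
    exact fun hk => hstep k hk _
      (agreeOutside_rounds_setIdx (agreeOutside_rounds (agreeOutside_exec P) σ k))
      (by rw [idx_setIdx, if_pos rfl]) (hI k _ (ih (Nat.le_of_succ_le hk)))

lemma loop_mem_eq_of_pointwise {r s a i : ℕ} {P : Prog} {σ : RAMState} (f : ℕ → ℝ)
    (hP : ∀ k < σ.idx s, ∀ τ, AgreeOutside (r :: P.regs) P.arrs σ τ → τ.idx r = k →
      τ.mem a i k = σ.mem a i k →
      ∀ j, (P.exec τ).1.mem a i j = if j = k then f j else τ.mem a i j) :
    ∀ j < σ.idx s, ((Prog.loop r s P).exec σ).1.mem a i j = f j := by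
  have key := loop_induction (r := r) (s := s) (P := P) (σ := σ)
    (fun k τ => ∀ j, τ.mem a i j = if j < k then f j else σ.mem a i j)
    (fun _ _ h => h) (by simp) fun k hk τ hτ hr hI j => ?_
  · exact fun j hj => (key j).trans (if_pos hj)
  · rw [hP k hk τ hτ hr ((hI k).trans (if_neg (lt_irrefl k))), hI j]
    grind

/-- The number of steps of a program whose loops run over registers `0` and `1` only, when these
hold `n` and `T`; a branch is charged for both alternatives. -/
def cost (n T : ℕ) : Prog → ℕ
  | .seq P Q => P.cost n T + Q.cost n T
  | .ifLt _ _ P Q | .ifLe _ _ P Q => P.cost n T + Q.cost n T + 1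
  | .loop _ s P => 1 + (if s = 0 then n else T) * (P.cost n T + 1)
  | _ => 1

/-- All loops run over registers `0` and `1`. -/
def SimpleLoops : Prog → Prop
  | .seq P Q | .ifLt _ _ P Q | .ifLe _ _ P Q => P.SimpleLoops ∧ Q.SimpleLoops
  | .loop _ s P => (s = 0 ∨ s = 1) ∧ P.SimpleLoops
  | _ => True

lemma rounds_snd_le {r c : ℕ} {P : Prog} {σ : RAMState}
    (h : ∀ k, (P.exec ((rounds r P σ k).1.setIdx r k)).2 ≤ c) (k : ℕ) :
    (rounds r P σ k).2 ≤ 1 + k * (c + 1) := by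
  induction k with
  | zero => simp [rounds]
  | succ k ih =>
    rw [rounds, Nat.succ_mul]
    linarith [h k]

lemma exec_snd_le_cost {P : Prog} (h0 : 0 ∉ P.regs) (h1 : 1 ∉ P.regs) (hs : P.SimpleLoops)
    (σ : RAMState) : (P.exec σ).2 ≤ P.cost (σ.idx 0) (σ.idx 1) := by
  induction P generalizing σ with
  | idxConst | idxCopy | idxSucc | idxPred | skip | const | copy | arith | exp => exact le_rfl
  | seq P Q ihP ihQ =>
    simp only [regs, List.mem_append, not_or] at h0 h1
    have hQ := ihQ h0.2 h1.2 hs.2 (P.exec σ).1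
    rw [exec_idx_of_notMem h0.1, exec_idx_of_notMem h1.1] at hQ
    exact add_le_add (ihP h0.1 h1.1 hs.1 σ) hQ
  | ifLt r s P Q ihP ihQ | ifLe r s P Q ihP ihQ =>
    simp only [regs, List.mem_append, not_or] at h0 h1
    have hP := ihP h0.1 h1.1 hs.1 σ
    have hQ := ihQ h0.2 h1.2 hs.2 σ
    rw [exec, cost]
    split_ifs <;> simp only <;> omega
  | loop r s P ih =>
    have hround k : (P.exec ((rounds r P σ k).1.setIdx r k)).2 ≤ P.cost (σ.idx 0) (σ.idx 1) := by
      have hk := agreeOutside_rounds_setIdx (agreeOutside_rounds (r := r) (agreeOutside_exec P) σ k)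
      rw [← hk.idx_eq 0 h0, ← hk.idx_eq 1 h1]
      simp only [regs, List.mem_cons, not_or] at h0 h1
      exact ih h0.2 h1.2 hs.2 _
    rw [exec_loop, cost]
    refine (rounds_snd_le hround _).trans_eq ?_
    rcases hs.1 with rfl | rfl <;> simp

end Prog

/-! ### The program for one update -/

namespace Prog

open RAMState

/-! Names of index registers. The first two are fixed by the input; `zero`, `one` and `two` hold
constants, `run` is the counter of the loops over the vertices, `back` runs backwards. -/

@[simp] abbrev Reg.size : ℕ := 0
@[simp] abbrev Reg.samples : ℕ := 1
@[simp] abbrev Reg.zero : ℕ := 2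
@[simp] abbrev Reg.one : ℕ := 3
@[simp] abbrev Reg.two : ℕ := 4
@[simp] abbrev Reg.vertex : ℕ := 5
@[simp] abbrev Reg.time : ℕ := 6
@[simp] abbrev Reg.run : ℕ := 7
@[simp] abbrev Reg.back : ℕ := 8

/-! Names of arrays. The first three are fixed by the input and the fourth by the output. Scalars
are stored in the entry `(0, 0)` of an array of their own, vectors indexed by vertices in row `0`.
`own` and `other` hold the factors of the estimator, `before` the products of the factors of the
preceding vertices, `total` the sum of the iterates. -/

@[simp] abbrev Arr.param : ℕ := 0
@[simp] abbrev Arr.missing : ℕ := 1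
@[simp] abbrev Arr.sample : ℕ := 2
@[simp] abbrev Arr.output : ℕ := 3
@[simp] abbrev Arr.one : ℕ := 4
@[simp] abbrev Arr.zero : ℕ := 5
@[simp] abbrev Arr.start : ℕ := 6
@[simp] abbrev Arr.count : ℕ := 7
@[simp] abbrev Arr.threshold : ℕ := 8
@[simp] abbrev Arr.pos : ℕ := 9
@[simp] abbrev Arr.neg : ℕ := 10
@[simp] abbrev Arr.total : ℕ := 11
@[simp] abbrev Arr.own : ℕ := 12
@[simp] abbrev Arr.other : ℕ := 13
@[simp] abbrev Arr.before : ℕ := 14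
@[simp] abbrev Arr.grad : ℕ := 15
@[simp] abbrev Arr.prod : ℕ := 16
@[simp] abbrev Arr.inner : ℕ := 17
@[simp] abbrev Arr.tmp : ℕ := 18
@[simp] abbrev Arr.tmp' : ℕ := 19

abbrev scalar (a : ℕ) : Ref := ⟨a, Reg.zero, Reg.zero⟩

abbrev atVertex (a : ℕ) : Ref := ⟨a, Reg.zero, Reg.vertex⟩

abbrev atRun (a : ℕ) : Ref := ⟨a, Reg.zero, Reg.run⟩

abbrev atBack (a : ℕ) : Ref := ⟨a, Reg.zero, Reg.back⟩

abbrev lamRef : Ref := ⟨Arr.param, Reg.zero, Reg.zero⟩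

abbrev etaRef : Ref := ⟨Arr.param, Reg.zero, Reg.one⟩

abbrev betaRef : Ref := ⟨Arr.param, Reg.zero, Reg.two⟩

abbrev sampleAtVertex : Ref := ⟨Arr.sample, Reg.time, Reg.vertex⟩

abbrev sampleAtRun : Ref := ⟨Arr.sample, Reg.time, Reg.run⟩

/-- One round of the forward pass: the factors of the running vertex and the product of the factors
before it. -/
def forwardBody : Prog := block [
  .arith .sub (scalar Arr.tmp) (atRun Arr.pos) (atRun Arr.neg),
  .arith .add (atRun Arr.total) (atRun Arr.total) (scalar Arr.tmp),
  .arith .sub (scalar Arr.tmp) (scalar Arr.zero) (scalar Arr.tmp),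
  .arith .mul (scalar Arr.tmp) (scalar Arr.tmp) sampleAtVertex,
  .arith .mul (scalar Arr.tmp) (scalar Arr.tmp) sampleAtRun,
  .exp (scalar Arr.tmp) (scalar Arr.tmp),
  .arith .sub (scalar Arr.tmp') (scalar Arr.one) (atRun Arr.missing),
  .arith .mul (atRun Arr.own) (scalar Arr.tmp) sampleAtRun,
  .arith .div (atRun Arr.own) (atRun Arr.own) (scalar Arr.tmp'),
  .arith .sub (atRun Arr.other) (scalar Arr.tmp) (atRun Arr.missing),
  .arith .div (atRun Arr.other) (atRun Arr.other) (scalar Arr.tmp'),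
  .copy (atRun Arr.before) (scalar Arr.prod),
  .arith .mul (scalar Arr.prod) (scalar Arr.prod) (atRun Arr.other)]

/-- The forward pass up to its loop: the running product starts with the factor of the vertex
`u`. -/
def forwardInit : Prog := block [
  .arith .sub (scalar Arr.prod) (scalar Arr.one) (atVertex Arr.missing),
  .arith .div (scalar Arr.prod) sampleAtVertex (scalar Arr.prod),
  .arith .sub (scalar Arr.prod) (scalar Arr.zero) (scalar Arr.prod)]

/-- The forward pass, which evaluates the factors of the estimator. -/
def forwardPass : Prog := block [forwardInit, .loop Reg.run Reg.size forwardBody]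

/-- One round of the backward pass: `prod` is the product of the factors after the vertex `back`. -/
def backwardBody : Prog := block [
  .idxPred Reg.back,
  .arith .mul (atBack Arr.grad) (atBack Arr.before) (scalar Arr.prod),
  .arith .mul (atBack Arr.grad) (atBack Arr.own) (atBack Arr.grad),
  .arith .mul (scalar Arr.prod) (scalar Arr.prod) (atBack Arr.other),
  .arith .sub (scalar Arr.tmp) (atBack Arr.pos) (atBack Arr.neg),
  .arith .mul (scalar Arr.tmp) (scalar Arr.tmp) (atBack Arr.grad),
  .arith .add (scalar Arr.inner) (scalar Arr.inner) (scalar Arr.tmp)]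

/-- The backward pass up to its loop. -/
def backwardInit : Prog := block [
  .const (scalar Arr.prod) 1,
  .const (scalar Arr.inner) 0,
  .idxCopy Reg.back Reg.size]

/-- The backward pass after its loop. -/
def backwardScale : Prog := block [
  .arith .div (scalar Arr.inner) (scalar Arr.inner) lamRef,
  .arith .mul (scalar Arr.inner) etaRef (scalar Arr.inner)]

/-- The backward pass, which computes the gradient estimate and its scaled inner product with the
weights. -/
def backwardPass : Prog :=
  block [backwardInit, .loop Reg.run Reg.size backwardBody, backwardScale]

/-- The multiplicative update of the weights of the running vertex. -/
def updateBody : Prog := block [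
  .arith .mul (scalar Arr.tmp) etaRef (atRun Arr.grad),
  .arith .sub (scalar Arr.tmp') (scalar Arr.one) (scalar Arr.tmp),
  .arith .add (scalar Arr.tmp') (scalar Arr.tmp') (scalar Arr.inner),
  .arith .mul (atRun Arr.pos) (atRun Arr.pos) (scalar Arr.tmp'),
  .arith .add (scalar Arr.tmp') (scalar Arr.one) (scalar Arr.tmp),
  .arith .add (scalar Arr.tmp') (scalar Arr.tmp') (scalar Arr.inner),
  .arith .mul (atRun Arr.neg) (atRun Arr.neg) (scalar Arr.tmp')]

/-- One update with the sample `time`. -/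
def stepProg : Prog := block [forwardPass, backwardPass, .loop Reg.run Reg.size updateBody]

/-- The registers and scalars that hold constants do so. -/
structure HasConstants (σ : RAMState) : Prop where
  idx_zero : σ.idx Reg.zero = 0
  idx_one : σ.idx Reg.one = 1
  idx_two : σ.idx Reg.two = 2
  mem_one : σ.mem Arr.one 0 0 = 1
  mem_zero : σ.mem Arr.zero 0 0 = 0

variable {σ τ : RAMState} {rs as : List ℕ}

lemma HasConstants.of_agreeOutside (h : HasConstants σ) (hτ : AgreeOutside rs as σ τ)
    (hrs : ∀ r ∈ [Reg.zero, Reg.one, Reg.two], r ∉ rs := by decide)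
    (has : ∀ a ∈ [Arr.one, Arr.zero], a ∉ as := by decide) : HasConstants τ where
  idx_zero := by rw [hτ.idx_eq _ (hrs _ (by decide)), h.idx_zero]
  idx_one := by rw [hτ.idx_eq _ (hrs _ (by decide)), h.idx_one]
  idx_two := by rw [hτ.idx_eq _ (hrs _ (by decide)), h.idx_two]
  mem_one := by rw [hτ.mem_eq _ (has _ (by decide)), h.mem_one]
  mem_zero := by rw [hτ.mem_eq _ (has _ (by decide)), h.mem_zero]

/-- `exp (-v_j x_u x_j)` for the weights `v` and the sample `x` in memory. -/
def expAt (σ : RAMState) (j : ℕ) : ℝ :=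
  Real.exp (-(σ.mem Arr.pos 0 j - σ.mem Arr.neg 0 j) *
    σ.mem Arr.sample (σ.idx Reg.time) (σ.idx Reg.vertex) * σ.mem Arr.sample (σ.idx Reg.time) j)

/-- The factor of the vertex `j` in the coordinate `j` of the estimator. -/
def ownFactor (σ : RAMState) (j : ℕ) : ℝ :=
  expAt σ j * σ.mem Arr.sample (σ.idx Reg.time) j / (1 - σ.mem Arr.missing 0 j)

/-- The factor of the vertex `j` in the coordinates `i ≠ j` of the estimator. -/
def otherFactor (σ : RAMState) (j : ℕ) : ℝ :=
  (expAt σ j - σ.mem Arr.missing 0 j) / (1 - σ.mem Arr.missing 0 j)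

/-- The factor of the vertex `u` in all coordinates of the estimator. -/
def vertexFactor (σ : RAMState) : ℝ :=
  -(σ.mem Arr.sample (σ.idx Reg.time) (σ.idx Reg.vertex) /
    (1 - σ.mem Arr.missing 0 (σ.idx Reg.vertex)))

lemma factors_eq_of_agreeOutside (hτ : AgreeOutside rs as σ τ)
    (hrs : ∀ r ∈ [Reg.time, Reg.vertex], r ∉ rs := by decide)
    (has : ∀ a ∈ [Arr.missing, Arr.sample, Arr.pos, Arr.neg], a ∉ as := by decide) :
    ownFactor τ = ownFactor σ ∧ otherFactor τ = otherFactor σ := by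
  have ht := hτ.idx_eq Reg.time (hrs _ (by decide))
  have hv := hτ.idx_eq Reg.vertex (hrs _ (by decide))
  have hm := hτ.mem_eq Arr.missing (has _ (by decide))
  have hs := hτ.mem_eq Arr.sample (has _ (by decide))
  have hpos := hτ.mem_eq Arr.pos (has _ (by decide))
  have hneg := hτ.mem_eq Arr.neg (has _ (by decide))
  have he : expAt τ = expAt σ := funext fun j => by rw [expAt, expAt, ht, hv, hs, hpos, hneg]
  exact ⟨funext fun j => by rw [ownFactor, ownFactor, he, ht, hs, hm],
    funext fun j => by rw [otherFactor, otherFactor, he, hm]⟩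

lemma forwardBody_exec (h : HasConstants σ) :
    (∀ j, (forwardBody.exec σ).1.mem Arr.total 0 j = if j = σ.idx Reg.run then
      σ.mem Arr.total 0 j + (σ.mem Arr.pos 0 j - σ.mem Arr.neg 0 j) else σ.mem Arr.total 0 j) ∧
    (∀ j, (forwardBody.exec σ).1.mem Arr.own 0 j =
      if j = σ.idx Reg.run then ownFactor σ j else σ.mem Arr.own 0 j) ∧
    (∀ j, (forwardBody.exec σ).1.mem Arr.other 0 j =
      if j = σ.idx Reg.run then otherFactor σ j else σ.mem Arr.other 0 j) ∧
    (∀ j, (forwardBody.exec σ).1.mem Arr.before 0 j =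
      if j = σ.idx Reg.run then σ.mem Arr.prod 0 0 else σ.mem Arr.before 0 j) ∧
    (forwardBody.exec σ).1.mem Arr.prod 0 0 =
      σ.mem Arr.prod 0 0 * otherFactor σ (σ.idx Reg.run) := by
  obtain ⟨h0, -, -, hone, hzero⟩ := h
  simp only [forwardBody, block, exec, RAMState.get, mem_set, idx_set, ArithOp.eval]
  refine ⟨fun j => ?_, fun j => ?_, fun j => ?_, fun j => ?_, by simp_all [otherFactor, expAt]⟩ <;>
    by_cases hj : j = σ.idx Reg.run <;> simp_all [ownFactor, otherFactor, expAt]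

lemma forwardLoop_exec (h : HasConstants σ) {j : ℕ} (hj : j < σ.idx Reg.size) :
    ((loop Reg.run Reg.size forwardBody).exec σ).1.mem Arr.total 0 j =
      σ.mem Arr.total 0 j + (σ.mem Arr.pos 0 j - σ.mem Arr.neg 0 j) ∧
    ((loop Reg.run Reg.size forwardBody).exec σ).1.mem Arr.own 0 j = ownFactor σ j ∧
    ((loop Reg.run Reg.size forwardBody).exec σ).1.mem Arr.other 0 j = otherFactor σ j := by
  refine ⟨loop_mem_eq_of_pointwise (fun j => σ.mem Arr.total 0 j +
      (σ.mem Arr.pos 0 j - σ.mem Arr.neg 0 j)) (fun k _ τ hτ hk htotal i => ?_) j hj,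
    loop_mem_eq_of_pointwise _ (fun k _ τ hτ hk _ i => ?_) j hj,
    loop_mem_eq_of_pointwise _ (fun k _ τ hτ hk _ i => ?_) j hj⟩
  · rw [(forwardBody_exec (h.of_agreeOutside hτ)).1, hk, hτ.mem_eq Arr.pos (by decide),
      hτ.mem_eq Arr.neg (by decide)]
    split_ifs with hi
    · rw [hi, htotal]
    · rfl
  · rw [(forwardBody_exec (h.of_agreeOutside hτ)).2.1, hk, (factors_eq_of_agreeOutside hτ).1]
  · rw [(forwardBody_exec (h.of_agreeOutside hτ)).2.2.1, hk, (factors_eq_of_agreeOutside hτ).2]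

lemma forwardLoop_before (h : HasConstants σ) {j : ℕ} (hj : j < σ.idx Reg.size) :
    ((loop Reg.run Reg.size forwardBody).exec σ).1.mem Arr.before 0 j =
      σ.mem Arr.prod 0 0 * ∏ i ∈ Finset.range j, otherFactor σ i := by
  refine (loop_induction (fun k τ =>
    τ.mem Arr.prod 0 0 = σ.mem Arr.prod 0 0 * ∏ i ∈ Finset.range k, otherFactor σ i ∧
    ∀ j < k, τ.mem Arr.before 0 j =
      σ.mem Arr.prod 0 0 * ∏ i ∈ Finset.range j, otherFactor σ i)
    (fun _ _ h => h) (by simp) fun k _ τ hτ hk ⟨hprod, hbefore⟩ => ⟨?_, fun j hj => ?_⟩).2 j hj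
  · rw [(forwardBody_exec (h.of_agreeOutside hτ)).2.2.2.2, hk, hprod,
      (factors_eq_of_agreeOutside hτ).2, Finset.prod_range_succ, mul_assoc]
  · rw [(forwardBody_exec (h.of_agreeOutside hτ)).2.2.2.1, hk]
    split_ifs with hjk
    · rw [hprod, hjk]
    · exact hbefore j (by lia)

lemma forwardInit_exec (h : HasConstants σ) :
    (forwardInit.exec σ).1.mem Arr.prod 0 0 = vertexFactor σ := by
  simp [forwardInit, block, exec, RAMState.get, mem_set, ArithOp.eval, vertexFactor, h.idx_zero,
    h.mem_one, h.mem_zero]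

lemma forwardPass_exec (h : HasConstants σ) {j : ℕ} (hj : j < σ.idx Reg.size) :
    (forwardPass.exec σ).1.mem Arr.total 0 j =
      σ.mem Arr.total 0 j + (σ.mem Arr.pos 0 j - σ.mem Arr.neg 0 j) ∧
    (forwardPass.exec σ).1.mem Arr.own 0 j = ownFactor σ j ∧
    (forwardPass.exec σ).1.mem Arr.other 0 j = otherFactor σ j ∧
    (forwardPass.exec σ).1.mem Arr.before 0 j =
      vertexFactor σ * ∏ i ∈ Finset.range j, otherFactor σ i := by
  have hτ := agreeOutside_exec forwardInit σ
  have hj' : j < (forwardInit.exec σ).1.idx Reg.size := by rwa [hτ.idx_eq _ (by decide)]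
  have hloop := forwardLoop_exec (h.of_agreeOutside hτ) hj'
  have hbefore := forwardLoop_before (h.of_agreeOutside hτ) hj'
  rw [(factors_eq_of_agreeOutside hτ).1, (factors_eq_of_agreeOutside hτ).2,
    hτ.mem_eq Arr.total (by decide), hτ.mem_eq Arr.pos (by decide),
    hτ.mem_eq Arr.neg (by decide)] at hloop
  rw [(factors_eq_of_agreeOutside hτ).2, forwardInit_exec h] at hbefore
  exact ⟨hloop.1, hloop.2.1, hloop.2.2, hbefore⟩

/-- The gradient estimate as computed by the backward pass from the results of the forward pass. -/
def backwardGrad (σ : RAMState) (j : ℕ) : ℝ :=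
  σ.mem Arr.own 0 j *
    (σ.mem Arr.before 0 j * ∏ i ∈ Finset.Ico (j + 1) (σ.idx Reg.size), σ.mem Arr.other 0 i)

/-- The inner product of the weights and the gradient estimate in the backward pass, restricted to
the vertices from `m` on. -/
def backwardInner (σ : RAMState) (m : ℕ) : ℝ :=
  ∑ i ∈ Finset.Ico m (σ.idx Reg.size),
    (σ.mem Arr.pos 0 i - σ.mem Arr.neg 0 i) * backwardGrad σ i

lemma backwardBody_exec (h : HasConstants σ) {j : ℕ} (hj : σ.idx Reg.back = j + 1) :
    (backwardBody.exec σ).1.idx Reg.back = j ∧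
    (∀ i, (backwardBody.exec σ).1.mem Arr.grad 0 i = if i = j then
      σ.mem Arr.own 0 j * (σ.mem Arr.before 0 j * σ.mem Arr.prod 0 0) else σ.mem Arr.grad 0 i) ∧
    (backwardBody.exec σ).1.mem Arr.prod 0 0 = σ.mem Arr.prod 0 0 * σ.mem Arr.other 0 j ∧
    (backwardBody.exec σ).1.mem Arr.inner 0 0 = σ.mem Arr.inner 0 0 +
      (σ.mem Arr.pos 0 j - σ.mem Arr.neg 0 j) *
        (σ.mem Arr.own 0 j * (σ.mem Arr.before 0 j * σ.mem Arr.prod 0 0)) := by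
  have := h.idx_zero
  simp only [backwardBody, block, exec, RAMState.get, mem_set, idx_set, idx_setIdx, mem_setIdx,
    ArithOp.eval]
  refine ⟨by simp_all, fun i => ?_, by simp_all, by simp_all⟩
  by_cases hi : i = j <;> simp_all

lemma backwardLoop_exec (h : HasConstants σ) (hprod : σ.mem Arr.prod 0 0 = 1)
    (hinner : σ.mem Arr.inner 0 0 = 0) (hback : σ.idx Reg.back = σ.idx Reg.size) :
    (∀ j < σ.idx Reg.size, ((loop Reg.run Reg.size backwardBody).exec σ).1.mem Arr.grad 0 j =
      backwardGrad σ j) ∧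
    ((loop Reg.run Reg.size backwardBody).exec σ).1.mem Arr.inner 0 0 = backwardInner σ 0 := by
  have key := loop_induction (r := Reg.run) (s := Reg.size) (P := backwardBody) (σ := σ)
    (fun k τ => τ.idx Reg.back = σ.idx Reg.size - k ∧
      τ.mem Arr.prod 0 0 =
        ∏ i ∈ Finset.Ico (σ.idx Reg.size - k) (σ.idx Reg.size), σ.mem Arr.other 0 i ∧
      τ.mem Arr.inner 0 0 = backwardInner σ (σ.idx Reg.size - k) ∧
      ∀ j < σ.idx Reg.size, σ.idx Reg.size - k ≤ j → τ.mem Arr.grad 0 j = backwardGrad σ j)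
    (fun k τ h => by simpa [idx_setIdx] using h) (by simp_all [backwardInner]) ?_
  · rw [Nat.sub_self] at key
    exact ⟨fun j hj => key.2.2.2 j hj (Nat.zero_le j), key.2.2.1⟩
  rintro k hk τ hτ - ⟨hb, hp, hi, hg⟩
  obtain ⟨m, hm⟩ : ∃ m, σ.idx Reg.size = m + (k + 1) := Nat.exists_eq_add_of_le' hk
  have hm' : σ.idx Reg.size - k = m + 1 := by lia
  rw [hm'] at hb hp hi hg
  obtain ⟨eb, eg, ep, ei⟩ := backwardBody_exec (h.of_agreeOutside hτ) hb
  have hgrad : τ.mem Arr.own 0 m * (τ.mem Arr.before 0 m * τ.mem Arr.prod 0 0) =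
      backwardGrad σ m := by
    rw [hp, hτ.mem_eq Arr.own (by decide), hτ.mem_eq Arr.before (by decide), backwardGrad]
  rw [hgrad] at eg ei
  rw [show σ.idx Reg.size - (k + 1) = m by lia]
  refine ⟨eb, ?_, ?_, fun j hj hmj => ?_⟩
  · rw [ep, hp, hτ.mem_eq Arr.other (by decide),
      Finset.prod_eq_prod_Ico_succ_bot (a := m) (by lia), mul_comm]
  · rw [ei, hi, hτ.mem_eq Arr.pos (by decide), hτ.mem_eq Arr.neg (by decide), backwardInner,
      backwardInner, Finset.sum_eq_sum_Ico_succ_bot (a := m) (by lia), add_comm]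
  · rw [eg]
    split_ifs with hjm
    · rw [hjm]
    · exact hg j hj (by lia)

lemma backwardInit_exec (h : HasConstants σ) :
    (backwardInit.exec σ).1.mem Arr.prod 0 0 = 1 ∧ (backwardInit.exec σ).1.mem Arr.inner 0 0 = 0 ∧
    (backwardInit.exec σ).1.idx Reg.back = σ.idx Reg.size := by
  simp [backwardInit, block, exec, mem_set, idx_setIdx, h.idx_zero]

lemma backwardScale_exec (h : HasConstants σ) :
    (backwardScale.exec σ).1.mem Arr.inner 0 0 =
      σ.mem Arr.param 0 1 * (σ.mem Arr.inner 0 0 / σ.mem Arr.param 0 0) := by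
  simp [backwardScale, block, exec, RAMState.get, mem_set, ArithOp.eval, h.idx_zero, h.idx_one]

lemma backwardGrad_eq_of_agreeOutside (hτ : AgreeOutside rs as σ τ) (hrs : Reg.size ∉ rs)
    (has : ∀ a ∈ [Arr.own, Arr.before, Arr.other], a ∉ as) : backwardGrad τ = backwardGrad σ := by
  funext j
  rw [backwardGrad, backwardGrad, hτ.idx_eq _ hrs, hτ.mem_eq Arr.own (has _ (by decide)),
    hτ.mem_eq Arr.before (has _ (by decide)), hτ.mem_eq Arr.other (has _ (by decide))]

lemma backwardPass_exec (h : HasConstants σ) :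
    (∀ j < σ.idx Reg.size, (backwardPass.exec σ).1.mem Arr.grad 0 j = backwardGrad σ j) ∧
    (backwardPass.exec σ).1.mem Arr.inner 0 0 =
      σ.mem Arr.param 0 1 * (backwardInner σ 0 / σ.mem Arr.param 0 0) := by
  have hτ := agreeOutside_exec backwardInit σ
  obtain ⟨hprod, hinner, hback⟩ := backwardInit_exec h
  set τ := (backwardInit.exec σ).1
  have hsize : τ.idx Reg.size = σ.idx Reg.size := hτ.idx_eq _ (by decide)
  have hτgrad : backwardGrad τ = backwardGrad σ :=
    backwardGrad_eq_of_agreeOutside hτ (by decide) (by decide)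
  have hτinner : backwardInner τ 0 = backwardInner σ 0 := by
    rw [backwardInner, backwardInner, hτgrad, hsize, hτ.mem_eq Arr.pos (by decide),
      hτ.mem_eq Arr.neg (by decide)]
  have hconst := h.of_agreeOutside hτ
  obtain ⟨hgrad, hloop⟩ := backwardLoop_exec hconst hprod hinner (hback.trans hsize.symm)
  have hυ := agreeOutside_exec (loop Reg.run Reg.size backwardBody) τ
  set υ := ((loop Reg.run Reg.size backwardBody).exec τ).1
  change (∀ j < σ.idx Reg.size, (backwardScale.exec υ).1.mem Arr.grad 0 j = backwardGrad σ j) ∧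
    (backwardScale.exec υ).1.mem Arr.inner 0 0 = _
  refine ⟨fun j hj => ?_, ?_⟩
  · rw [exec_mem_of_notMem (by decide), hgrad j (hsize ▸ hj), hτgrad]
  · rw [backwardScale_exec (hconst.of_agreeOutside hυ), hloop, hτinner,
      hυ.mem_eq Arr.param (by decide), hτ.mem_eq Arr.param (by decide)]

lemma updateBody_exec (h : HasConstants σ) :
    (∀ j, (updateBody.exec σ).1.mem Arr.pos 0 j = if j = σ.idx Reg.run then
      σ.mem Arr.pos 0 j * (1 - σ.mem Arr.param 0 1 * σ.mem Arr.grad 0 j + σ.mem Arr.inner 0 0)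
      else σ.mem Arr.pos 0 j) ∧
    ∀ j, (updateBody.exec σ).1.mem Arr.neg 0 j = if j = σ.idx Reg.run then
      σ.mem Arr.neg 0 j * (1 + σ.mem Arr.param 0 1 * σ.mem Arr.grad 0 j + σ.mem Arr.inner 0 0)
      else σ.mem Arr.neg 0 j := by
  obtain ⟨h0, h1, -, hone, -⟩ := h
  simp only [updateBody, block, exec, RAMState.get, mem_set, idx_set, ArithOp.eval]
  refine ⟨fun j => ?_, fun j => ?_⟩ <;> by_cases hj : j = σ.idx Reg.run <;> simp_all

lemma updateLoop_exec (h : HasConstants σ) {j : ℕ} (hj : j < σ.idx Reg.size) :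
    ((loop Reg.run Reg.size updateBody).exec σ).1.mem Arr.pos 0 j =
      σ.mem Arr.pos 0 j * (1 - σ.mem Arr.param 0 1 * σ.mem Arr.grad 0 j + σ.mem Arr.inner 0 0) ∧
    ((loop Reg.run Reg.size updateBody).exec σ).1.mem Arr.neg 0 j =
      σ.mem Arr.neg 0 j * (1 + σ.mem Arr.param 0 1 * σ.mem Arr.grad 0 j + σ.mem Arr.inner 0 0) := by
  refine ⟨loop_mem_eq_of_pointwise (fun j => σ.mem Arr.pos 0 j *
      (1 - σ.mem Arr.param 0 1 * σ.mem Arr.grad 0 j + σ.mem Arr.inner 0 0))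
      (fun k _ τ hτ hk hpos i => ?_) j hj,
    loop_mem_eq_of_pointwise (fun j => σ.mem Arr.neg 0 j *
      (1 + σ.mem Arr.param 0 1 * σ.mem Arr.grad 0 j + σ.mem Arr.inner 0 0))
      (fun k _ τ hτ hk hneg i => ?_) j hj⟩
  · rw [(updateBody_exec (h.of_agreeOutside hτ)).1, hk, hτ.mem_eq Arr.param (by decide),
      hτ.mem_eq Arr.grad (by decide), hτ.mem_eq Arr.inner (by decide)]
    split_ifs with hi
    · rw [hi, hpos]
    · rfl
  · rw [(updateBody_exec (h.of_agreeOutside hτ)).2, hk, hτ.mem_eq Arr.param (by decide),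
      hτ.mem_eq Arr.grad (by decide), hτ.mem_eq Arr.inner (by decide)]
    split_ifs with hi
    · rw [hi, hneg]
    · rfl

/-- The gradient estimate at the weights and the sample in memory. -/
def gradOf (σ : RAMState) (j : ℕ) : ℝ :=
  ownFactor σ j * (vertexFactor σ * (∏ i ∈ Finset.range j, otherFactor σ i) *
    ∏ i ∈ Finset.Ico (j + 1) (σ.idx Reg.size), otherFactor σ i)

/-- The inner product of the weights in memory and their gradient estimate. -/
def innerOf (σ : RAMState) : ℝ :=
  ∑ i ∈ Finset.range (σ.idx Reg.size), (σ.mem Arr.pos 0 i - σ.mem Arr.neg 0 i) * gradOf σ i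

lemma backwardGrad_forwardPass (h : HasConstants σ) {j : ℕ} (hj : j < σ.idx Reg.size) :
    backwardGrad (forwardPass.exec σ).1 j = gradOf σ j := by
  rw [backwardGrad, gradOf, exec_idx_of_notMem (by decide), (forwardPass_exec h hj).2.1,
    (forwardPass_exec h hj).2.2.2]
  congr 2
  exact Finset.prod_congr rfl fun i hi => (forwardPass_exec h (Finset.mem_Ico.1 hi).2).2.2.1

lemma backwardInner_forwardPass (h : HasConstants σ) :
    backwardInner (forwardPass.exec σ).1 0 = innerOf σ := by
  rw [backwardInner, innerOf, exec_idx_of_notMem (by decide),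
    exec_mem_of_notMem (a := Arr.pos) (by decide), exec_mem_of_notMem (a := Arr.neg) (by decide),
    ← Finset.range_eq_Ico]
  exact Finset.sum_congr rfl fun i hi => by
    rw [backwardGrad_forwardPass h (Finset.mem_range.1 hi)]

lemma stepProg_exec (h : HasConstants σ) {j : ℕ} (hj : j < σ.idx Reg.size) :
    (stepProg.exec σ).1.mem Arr.total 0 j =
      σ.mem Arr.total 0 j + (σ.mem Arr.pos 0 j - σ.mem Arr.neg 0 j) ∧
    (stepProg.exec σ).1.mem Arr.pos 0 j = σ.mem Arr.pos 0 j * (1 - σ.mem Arr.param 0 1 *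
      gradOf σ j + σ.mem Arr.param 0 1 * (innerOf σ / σ.mem Arr.param 0 0)) ∧
    (stepProg.exec σ).1.mem Arr.neg 0 j = σ.mem Arr.neg 0 j * (1 + σ.mem Arr.param 0 1 *
      gradOf σ j + σ.mem Arr.param 0 1 * (innerOf σ / σ.mem Arr.param 0 0)) := by
  have hτ := agreeOutside_exec forwardPass σ
  have hgrad := backwardGrad_forwardPass h hj
  have hinner := backwardInner_forwardPass h
  have htotal := (forwardPass_exec h hj).1
  set τ := (forwardPass.exec σ).1
  have hconst := h.of_agreeOutside hτ
  have hυ := agreeOutside_exec backwardPass τ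
  have hj' : j < τ.idx Reg.size := by rwa [hτ.idx_eq _ (by decide)]
  obtain ⟨hυgrad, hυinner⟩ := backwardPass_exec hconst
  replace hυgrad := hυgrad j hj'
  set υ := (backwardPass.exec τ).1
  have hj'' : j < υ.idx Reg.size := by rwa [hυ.idx_eq _ (by decide)]
  obtain ⟨hpos, hneg⟩ := updateLoop_exec (hconst.of_agreeOutside hυ) hj''
  rw [hυgrad, hυinner, hgrad, hinner, hυ.mem_eq Arr.param (by decide),
    hτ.mem_eq Arr.param (by decide)] at hpos hneg
  rw [hυ.mem_eq Arr.pos (by decide), hτ.mem_eq Arr.pos (by decide)] at hpos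
  rw [hυ.mem_eq Arr.neg (by decide), hτ.mem_eq Arr.neg (by decide)] at hneg
  refine ⟨?_, hpos, hneg⟩
  change ((loop Reg.run Reg.size updateBody).exec υ).1.mem Arr.total 0 j = _
  rw [exec_mem_of_notMem (by decide), hυ.mem_eq Arr.total (by decide), htotal]

end Prog

/-! ### The program for all vertices -/

namespace Prog

open RAMState

def constBlock : Prog := block [
  .idxConst Reg.one 1,
  .idxConst Reg.two 2,
  .const (scalar Arr.one) 1,
  .const (scalar Arr.zero) 0,
  .const (scalar Arr.start) (-1),
  .const (scalar Arr.count) 0]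

def sizeBody : Prog := block [
  .arith .add (scalar Arr.start) (scalar Arr.start) (scalar Arr.one),
  .arith .add (scalar Arr.start) (scalar Arr.start) (scalar Arr.one)]

def countBody : Prog := .arith .add (scalar Arr.count) (scalar Arr.count) (scalar Arr.one)

def paramBlock : Prog := block [
  .arith .div (scalar Arr.start) lamRef (scalar Arr.start),
  .const (scalar Arr.threshold) 2,
  .arith .div (scalar Arr.threshold) betaRef (scalar Arr.threshold)]

/-- The computation of the constants, the initial weight, the number of samples and the threshold.
The reals `n` and `T` are not part of the input, so that they have to be counted up to. -/
def setupProg : Prog := block [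
  constBlock,
  .loop Reg.run Reg.size sizeBody,
  .loop Reg.run Reg.samples countBody,
  paramBlock]

def initBody : Prog := block [
  .copy (atRun Arr.pos) (scalar Arr.start),
  .copy (atRun Arr.neg) (scalar Arr.start),
  .const (atRun Arr.total) 0]

def initVertex : Prog := block [.const (atVertex Arr.pos) 0, .const (atVertex Arr.neg) 0]

/-- The initialization of the weights. Those of the vertex `u` itself are `0`, and remain so, since
the updates are multiplicative. -/
def initProg : Prog := block [.loop Reg.run Reg.size initBody, initVertex]

abbrev outputAtRun : Ref := ⟨Arr.output, Reg.vertex, Reg.run⟩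

def thresholdBody : Prog := block [
  .arith .div (scalar Arr.tmp) (atRun Arr.total) (scalar Arr.count),
  .ifLe (scalar Arr.threshold) (scalar Arr.tmp) (.const outputAtRun 1) (block [
    .arith .sub (scalar Arr.tmp) (scalar Arr.zero) (scalar Arr.tmp),
    .ifLe (scalar Arr.threshold) (scalar Arr.tmp) (.const outputAtRun 1) (.const outputAtRun 0)])]

/-- The computation of the estimated neighbourhood from the sum of the iterates. -/
def thresholdProg : Prog := block [
  .loop Reg.run Reg.size thresholdBody,
  .const ⟨Arr.output, Reg.vertex, Reg.vertex⟩ 0]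

/-- The algorithm for one vertex. -/
def vertexProg : Prog := block [initProg, .loop Reg.time Reg.samples stepProg, thresholdProg]

/-- The algorithm for all vertices. -/
def mainProg : Prog := block [setupProg, .loop Reg.vertex Reg.size vertexProg]

/-- The state after the setup, up to the arrays and registers that the algorithm works with. -/
structure Ready {n T : ℕ} (p : Fin n → ℝ) (lam η β : ℝ) (X : Fin T → Fin n → Entry)
    (σ : RAMState) : Prop extends HasConstants σ where
  idx_size : σ.idx Reg.size = n
  idx_samples : σ.idx Reg.samples = T
  input : ∀ a ∈ [Arr.param, Arr.missing, Arr.sample], σ.mem a = (inputState p lam η β X).mem a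
  start : σ.mem Arr.start 0 0 = lam / (2 * (n : ℝ) - 1)
  count : σ.mem Arr.count 0 0 = T
  threshold : σ.mem Arr.threshold 0 0 = β / 2

section Ready

variable {n T : ℕ} {p : Fin n → ℝ} {lam η β : ℝ} {X : Fin T → Fin n → Entry} {σ τ : RAMState}
  {rs as : List ℕ}

namespace Ready

lemma of_agreeOutside (h : Ready p lam η β X σ) (hτ : AgreeOutside rs as σ τ)
    (hrs : ∀ r ∈ [Reg.size, Reg.samples, Reg.zero, Reg.one, Reg.two], r ∉ rs := by decide)
    (has : ∀ a ∈ [Arr.param, Arr.missing, Arr.sample, Arr.one, Arr.zero, Arr.start, Arr.count,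
      Arr.threshold], a ∉ as := by decide) : Ready p lam η β X τ where
  toHasConstants := h.toHasConstants.of_agreeOutside hτ
    (fun r hr => hrs r (by revert r; decide)) (fun a ha => has a (by revert a; decide))
  idx_size := by rw [hτ.idx_eq _ (hrs _ (by decide)), h.idx_size]
  idx_samples := by rw [hτ.idx_eq _ (hrs _ (by decide)), h.idx_samples]
  input a ha := by rw [hτ.mem_eq _ (has _ (by revert a; decide)), h.input a ha]
  start := by rw [hτ.mem_eq _ (has _ (by decide)), h.start]
  count := by rw [hτ.mem_eq _ (has _ (by decide)), h.count]
  threshold := by rw [hτ.mem_eq _ (has _ (by decide)), h.threshold]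

lemma lam_eq (h : Ready p lam η β X σ) : σ.mem Arr.param 0 0 = lam := by
  rw [h.input Arr.param (by decide)]
  simp [inputState]

lemma eta_eq (h : Ready p lam η β X σ) : σ.mem Arr.param 0 1 = η := by
  rw [h.input Arr.param (by decide)]
  simp [inputState]

lemma missing_eq (h : Ready p lam η β X σ) (j : Fin n) : σ.mem Arr.missing 0 j = p j := by
  rw [h.input Arr.missing (by decide)]
  simp [inputState]

lemma sample_eq (h : Ready p lam η β X σ) (t : Fin T) (j : Fin n) :
    σ.mem Arr.sample t j = entryVal (X t j) := by
  rw [h.input Arr.sample (by decide)]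
  simp [inputState]

end Ready

lemma constBlock_exec (h : σ.idx Reg.zero = 0) :
    HasConstants (constBlock.exec σ).1 ∧ (constBlock.exec σ).1.mem Arr.start 0 0 = -1 ∧
    (constBlock.exec σ).1.mem Arr.count 0 0 = 0 := by
  refine ⟨⟨?_, ?_, ?_, ?_, ?_⟩, ?_, ?_⟩ <;>
    simp [constBlock, block, Prog.exec, mem_set, idx_setIdx, h]

lemma sizeLoop_exec (h : HasConstants σ) (hstart : σ.mem Arr.start 0 0 = -1) :
    ((loop Reg.run Reg.size sizeBody).exec σ).1.mem Arr.start 0 0 =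
      2 * (σ.idx Reg.size : ℝ) - 1 := by
  refine loop_induction (fun k τ => τ.mem Arr.start 0 0 = 2 * (k : ℝ) - 1) (fun _ _ h => h)
    (by simp [hstart]) fun k _ τ hτ _ hI => ?_
  have hτ' := h.of_agreeOutside hτ
  simp only [sizeBody, block, Prog.exec, RAMState.get, mem_set, idx_set, ArithOp.eval]
  simp [hτ'.idx_zero, hτ'.mem_one, hI]
  ring

lemma countLoop_exec (h : HasConstants σ) (hcount : σ.mem Arr.count 0 0 = 0) :
    ((loop Reg.run Reg.samples countBody).exec σ).1.mem Arr.count 0 0 = σ.idx Reg.samples := by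
  refine loop_induction (fun k τ => τ.mem Arr.count 0 0 = (k : ℝ)) (fun _ _ h => h)
    (by simp [hcount]) fun k _ τ hτ _ hI => ?_
  have hτ' := h.of_agreeOutside hτ
  simp [countBody, Prog.exec, RAMState.get, mem_set, ArithOp.eval, hτ'.idx_zero, hτ'.mem_one, hI]

lemma paramBlock_exec (h : HasConstants σ) :
    (paramBlock.exec σ).1.mem Arr.start 0 0 = σ.mem Arr.param 0 0 / σ.mem Arr.start 0 0 ∧
    (paramBlock.exec σ).1.mem Arr.threshold 0 0 = σ.mem Arr.param 0 2 / 2 := by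
  constructor <;> simp [paramBlock, block, Prog.exec, RAMState.get, mem_set, ArithOp.eval,
    h.idx_zero, h.idx_two]

lemma ready_setupProg (p : Fin n → ℝ) (lam η β : ℝ) (X : Fin T → Fin n → Entry) :
    Ready p lam η β X (setupProg.exec (inputState p lam η β X)).1 := by
  set σ₀ := inputState p lam η β X
  obtain ⟨hconst₁, hstart₁, hcount₁⟩ := constBlock_exec (σ := σ₀) rfl
  have h₁ := agreeOutside_exec constBlock σ₀
  set σ₁ := (constBlock.exec σ₀).1
  have hstart₂ := sizeLoop_exec hconst₁ hstart₁
  have h₂ := agreeOutside_exec (loop Reg.run Reg.size sizeBody) σ₁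
  set σ₂ := ((loop Reg.run Reg.size sizeBody).exec σ₁).1
  have hconst₂ := hconst₁.of_agreeOutside h₂
  have hcount₃ := countLoop_exec hconst₂ ((congrFun₂ (h₂.mem_eq Arr.count (by decide)) 0 0).trans
    hcount₁)
  have h₃ := agreeOutside_exec (loop Reg.run Reg.samples countBody) σ₂
  set σ₃ := ((loop Reg.run Reg.samples countBody).exec σ₂).1
  have hconst₃ := hconst₂.of_agreeOutside h₃
  obtain ⟨hstart₄, hthreshold₄⟩ := paramBlock_exec hconst₃
  have h₄ := agreeOutside_exec paramBlock σ₃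
  have hparam : σ₃.mem Arr.param = σ₀.mem Arr.param := by
    rw [h₃.mem_eq _ (by decide), h₂.mem_eq _ (by decide), h₁.mem_eq _ (by decide)]
  refine ⟨hconst₃.of_agreeOutside h₄, exec_idx_of_notMem (by decide) _,
    exec_idx_of_notMem (by decide) _, fun a ha => exec_mem_of_notMem (by revert a; decide) _,
    hstart₄.trans ?_, ?_, hthreshold₄.trans ?_⟩
  · rw [hparam, h₃.mem_eq _ (by decide), hstart₂, h₁.idx_eq _ (by decide)]
    simp [σ₀, inputState]
  · change (paramBlock.exec σ₃).1.mem Arr.count 0 0 = _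
    rw [h₄.mem_eq _ (by decide), hcount₃, h₂.idx_eq _ (by decide), h₁.idx_eq _ (by decide)]
    simp [σ₀, inputState]
  · rw [hparam]
    simp [σ₀, inputState]

/-- The memory holds the weights `w`, and `0` at the vertex `u` itself. -/
structure HoldsWeights {n : ℕ} {u : Fin n} (w : Coord u → ℝ) (σ : RAMState) : Prop where
  pos : ∀ j : Others u, σ.mem Arr.pos 0 j = w (.pos j)
  neg : ∀ j : Others u, σ.mem Arr.neg 0 j = w (.neg j)
  pos_self : σ.mem Arr.pos 0 u = 0
  neg_self : σ.mem Arr.neg 0 u = 0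

lemma prod_range_mul_prod_Ico_succ {M : Type*} [CommMonoid M] {n : ℕ} {u : Fin n} (f : ℕ → M)
    (i : Others u) :
    (∏ k ∈ Finset.range i, f k) * ∏ k ∈ Finset.Ico ((i : ℕ) + 1) n, f k =
      f u * ∏ j ∈ Finset.univ.erase i, f (j : Others u) := by
  set f' := Function.update f (i : ℕ) 1
  have hne (k : ℕ) (hk : k ≠ i) : f' k = f k := Function.update_of_ne hk _ _
  have hi : f' i = 1 := Function.update_self _ _ _
  calc (∏ k ∈ Finset.range i, f k) * ∏ k ∈ Finset.Ico ((i : ℕ) + 1) n, f k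
      = (∏ k ∈ Finset.range i, f' k) * ∏ k ∈ Finset.Ico ((i : ℕ) + 1) n, f' k := by
        congr 1 <;> refine Finset.prod_congr rfl fun k hk => (hne k ?_).symm
        · exact (Finset.mem_range.1 hk).ne
        · exact (Nat.lt_of_succ_le (Finset.mem_Ico.1 hk).1).ne'
    _ = ∏ j : Fin n, f' j := by
        rw [Fin.prod_univ_eq_prod_range f' n, ← Finset.prod_range_mul_prod_Ico f' i.1.2.le,
          Finset.prod_eq_prod_Ico_succ_bot i.1.2, hi, one_mul]
    _ = f u * ∏ j ∈ Finset.univ.erase i, f (j : Others u) := by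
        rw [prod_univ_eq_mul_mul_prod_erase (fun k : Fin n => f' k) i, hi, mul_one,
          hne u fun e => i.2 (Fin.ext e.symm)]
        congr 1
        refine Finset.prod_congr rfl fun j hj => hne j fun e => ?_
        exact Finset.ne_of_mem_erase hj (Subtype.ext (Fin.ext e))

variable {u : Fin n} {t : Fin T} {w : Coord u → ℝ}

lemma expAt_eq (h : Ready p lam η β X σ) (hu : σ.idx Reg.vertex = u) (ht : σ.idx Reg.time = t)
    (hw : HoldsWeights w σ) (j : Others u) :
    expAt σ j = Real.exp (-(simplexToBall w j) * entryVal (X t u) * entryVal (X t j)) := by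
  rw [expAt, hu, ht, h.sample_eq t u, h.sample_eq t j, hw.pos, hw.neg, simplexToBall]

lemma vertexFactor_eq (h : Ready p lam η β X σ) (hu : σ.idx Reg.vertex = u)
    (ht : σ.idx Reg.time = t) : vertexFactor σ = -(entryVal (X t u) / (1 - p u)) := by
  rw [vertexFactor, hu, ht, h.sample_eq, h.missing_eq]

/-- The case `p u = 1` is excluded because of the quotient `0 / 0 = 0`. -/
lemma otherFactor_self (h : Ready p lam η β X σ) (hw : HoldsWeights w σ) (hp : 1 - p u ≠ 0) :
    otherFactor σ u = 1 := by
  rw [otherFactor, expAt, hw.pos_self, hw.neg_self, h.missing_eq]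
  simp [div_self hp]

lemma gradOf_eq (h : Ready p lam η β X σ) (hu : σ.idx Reg.vertex = u) (ht : σ.idx Reg.time = t)
    (hw : HoldsWeights w σ) (i : Others u) : gradOf σ i = gMiss p w (X t) i := by
  have hprod := prod_range_mul_prod_Ico_succ (otherFactor σ) i
  have hother (j : Others u) : otherFactor σ j =
      (Real.exp (-(simplexToBall w j) * entryVal (X t u) * entryVal (X t j)) - p j) /
        (1 - p j) := by
    rw [otherFactor, expAt_eq h hu ht hw, h.missing_eq]
  rw [gradOf, gMiss, h.idx_size, mul_assoc (vertexFactor σ), hprod, ownFactor,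
    expAt_eq h hu ht hw, vertexFactor_eq h hu ht, ht, h.sample_eq, h.missing_eq]
  simp_rw [hother]
  by_cases hp : 1 - p u = 0
  · simp [hp]
  · rw [otherFactor_self h hw hp]
    ring

lemma innerOf_eq (h : Ready p lam η β X σ) (hu : σ.idx Reg.vertex = u) (ht : σ.idx Reg.time = t)
    (hw : HoldsWeights w σ) : innerOf σ = ∑ d, w d * GMiss p w (X t) d := by
  rw [sum_mul_GMiss, innerOf, h.idx_size, ← Fin.sum_univ_eq_sum_range fun i =>
      (σ.mem Arr.pos 0 i - σ.mem Arr.neg 0 i) * gradOf σ i,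
    ← sum_others_eq_sum (u := u) _ (by rw [hw.pos_self, hw.neg_self, sub_zero, zero_mul])]
  refine Finset.sum_congr rfl fun i _ => ?_
  rw [gradOf_eq h hu ht hw, hw.pos, hw.neg, simplexToBall]

lemma stepProg_weights (h : Ready p lam η β X σ) (hu : σ.idx Reg.vertex = u)
    (ht : σ.idx Reg.time = t) (hw : HoldsWeights w σ) :
    HoldsWeights (smgStep p lam η w (X t)) (stepProg.exec σ).1 ∧ ∀ j : Others u,
      (stepProg.exec σ).1.mem Arr.total 0 j = σ.mem Arr.total 0 j + simplexToBall w j := by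
  have hstep (j : Fin n) := stepProg_exec h.toHasConstants (j := j) (h.idx_size ▸ j.2)
  refine ⟨⟨fun j => ?_, fun j => ?_, ?_, ?_⟩, fun j => ?_⟩
  · rw [(hstep j).2.1, h.eta_eq, h.lam_eq, innerOf_eq h hu ht hw, gradOf_eq h hu ht hw, hw.pos]
    rfl
  · rw [(hstep j).2.2, h.eta_eq, h.lam_eq, innerOf_eq h hu ht hw, gradOf_eq h hu ht hw, hw.neg,
      smgStep, GMiss, mul_neg, sub_neg_eq_add]
  · rw [(hstep u).2.1, hw.pos_self, zero_mul]
  · rw [(hstep u).2.2, hw.neg_self, zero_mul]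
  · rw [(hstep j).1, hw.pos, hw.neg, simplexToBall]

lemma timeLoop_exec (h : Ready p lam η β X σ) (hu : σ.idx Reg.vertex = u)
    (hw : HoldsWeights (u := u) (fun _ => lam / (2 * (n : ℝ) - 1)) σ)
    (htotal : ∀ j : Others u, σ.mem Arr.total 0 j = 0) (j : Others u) :
    ((loop Reg.time Reg.samples stepProg).exec σ).1.mem Arr.total 0 j =
      ∑ s ∈ Finset.range T, simplexToBall (smgIter u p lam η X s) j := by
  have key := (loop_induction (r := Reg.time) (s := Reg.samples) (P := stepProg) (σ := σ)
    (fun k τ => HoldsWeights (smgIter u p lam η X k) τ ∧ ∀ j : Others u,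
      τ.mem Arr.total 0 j = ∑ s ∈ Finset.range k, simplexToBall (smgIter u p lam η X s) j)
    (fun _ _ h => ⟨⟨h.1.1, h.1.2, h.1.3, h.1.4⟩, h.2⟩) ⟨hw, by simpa using htotal⟩ ?_).2 j
  · rwa [h.idx_samples] at key
  rintro k hk τ hτ hrun ⟨hweights, hsum⟩
  let t : Fin T := ⟨k, h.idx_samples ▸ hk⟩
  obtain ⟨hweights', hsum'⟩ := stepProg_weights (t := t) (h.of_agreeOutside hτ)
    ((hτ.idx_eq _ (by decide)).trans hu) hrun hweights
  refine ⟨?_, fun j => ?_⟩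
  · rwa [smgIter_succ u p lam η X t]
  · rw [hsum', hsum, Finset.sum_range_succ]

lemma initBody_exec (h : HasConstants σ) (j : ℕ) :
    (initBody.exec σ).1.mem Arr.pos 0 j =
      (if j = σ.idx Reg.run then σ.mem Arr.start 0 0 else σ.mem Arr.pos 0 j) ∧
    (initBody.exec σ).1.mem Arr.neg 0 j =
      (if j = σ.idx Reg.run then σ.mem Arr.start 0 0 else σ.mem Arr.neg 0 j) ∧
    (initBody.exec σ).1.mem Arr.total 0 j =
      (if j = σ.idx Reg.run then 0 else σ.mem Arr.total 0 j) := by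
  simp [initBody, block, Prog.exec, RAMState.get, mem_set, h.idx_zero]

lemma initLoop_exec (h : HasConstants σ) {j : ℕ} (hj : j < σ.idx Reg.size) :
    ((loop Reg.run Reg.size initBody).exec σ).1.mem Arr.pos 0 j = σ.mem Arr.start 0 0 ∧
    ((loop Reg.run Reg.size initBody).exec σ).1.mem Arr.neg 0 j = σ.mem Arr.start 0 0 ∧
    ((loop Reg.run Reg.size initBody).exec σ).1.mem Arr.total 0 j = 0 := by
  refine ⟨loop_mem_eq_of_pointwise (fun _ => σ.mem Arr.start 0 0) (fun k _ τ hτ hk _ i => ?_) j hj,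
    loop_mem_eq_of_pointwise (fun _ => σ.mem Arr.start 0 0) (fun k _ τ hτ hk _ i => ?_) j hj,
    loop_mem_eq_of_pointwise (fun _ => 0) (fun k _ τ hτ hk _ i => ?_) j hj⟩
  · rw [(initBody_exec (h.of_agreeOutside hτ) i).1, hk, hτ.mem_eq Arr.start (by decide)]
  · rw [(initBody_exec (h.of_agreeOutside hτ) i).2.1, hk, hτ.mem_eq Arr.start (by decide)]
  · rw [(initBody_exec (h.of_agreeOutside hτ) i).2.2, hk]

lemma initVertex_exec (h : HasConstants σ) (j : ℕ) :
    (initVertex.exec σ).1.mem Arr.pos 0 j =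
      (if j = σ.idx Reg.vertex then 0 else σ.mem Arr.pos 0 j) ∧
    (initVertex.exec σ).1.mem Arr.neg 0 j =
      (if j = σ.idx Reg.vertex then 0 else σ.mem Arr.neg 0 j) := by
  simp [initVertex, block, Prog.exec, mem_set, h.idx_zero]

lemma initProg_exec (h : Ready p lam η β X σ) (hu : σ.idx Reg.vertex = u) :
    HoldsWeights (u := u) (fun _ => lam / (2 * (n : ℝ) - 1)) (initProg.exec σ).1 ∧
    ∀ j : Others u, (initProg.exec σ).1.mem Arr.total 0 j = 0 := by
  have hloop (j : Fin n) := initLoop_exec h.toHasConstants (j := j) (h.idx_size ▸ j.2)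
  have hτ := agreeOutside_exec (loop Reg.run Reg.size initBody) σ
  set τ := ((loop Reg.run Reg.size initBody).exec σ).1
  have hvertex (j : ℕ) := initVertex_exec (h.toHasConstants.of_agreeOutside hτ) j
  rw [hτ.idx_eq _ (by decide), hu] at hvertex
  have hne (j : Others u) : ((j : Fin n) : ℕ) ≠ u := fun e => j.2 (Fin.ext e)
  refine ⟨⟨fun j => (hvertex j).1.trans ?_, fun j => (hvertex j).2.trans ?_,
    (hvertex u).1.trans (if_pos rfl), (hvertex u).2.trans (if_pos rfl)⟩, fun j => ?_⟩
  · rw [if_neg (hne j), (hloop j).1, h.start]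
  · rw [if_neg (hne j), (hloop j).2.1, h.start]
  · change (initVertex.exec τ).1.mem Arr.total 0 j = 0
    rw [exec_mem_of_notMem (by decide), (hloop j).2.2]

lemma thresholdBody_exec (h : HasConstants σ) (i j : ℕ) :
    (thresholdBody.exec σ).1.mem Arr.output i j = if i = σ.idx Reg.vertex ∧ j = σ.idx Reg.run then
      (if σ.mem Arr.threshold 0 0 ≤ |σ.mem Arr.total 0 j / σ.mem Arr.count 0 0| then 1 else 0)
      else σ.mem Arr.output i j := by
  obtain ⟨h0, -, -, -, hzero⟩ := h
  simp only [thresholdBody, block, Prog.exec, RAMState.get, mem_set, idx_set, ArithOp.eval, h0,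
    le_abs]
  by_cases hij : i = σ.idx Reg.vertex ∧ j = σ.idx Reg.run
  · obtain ⟨rfl, rfl⟩ := hij
    by_cases hpos : σ.mem Arr.threshold 0 0 ≤
        σ.mem Arr.total 0 (σ.idx Reg.run) / σ.mem Arr.count 0 0
    · simp [hpos, mem_set]
    · by_cases hneg : σ.mem Arr.threshold 0 0 ≤
        -(σ.mem Arr.total 0 (σ.idx Reg.run) / σ.mem Arr.count 0 0) <;>
        simp [hpos, hneg, hzero, mem_set]
  · rw [if_neg hij]
    split_ifs <;> simp [hij, mem_set]

lemma thresholdLoop_exec (h : Ready p lam η β X σ) {j : ℕ} (hj : j < n) :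
    ((loop Reg.run Reg.size thresholdBody).exec σ).1.mem Arr.output (σ.idx Reg.vertex) j =
      if β / 2 ≤ |σ.mem Arr.total 0 j / T| then 1 else 0 := by
  refine loop_mem_eq_of_pointwise (fun j => if β / 2 ≤ |σ.mem Arr.total 0 j / T| then 1 else 0)
    (fun k _ τ hτ hk _ j => ?_) j (h.idx_size ▸ hj)
  have hτ' := h.of_agreeOutside hτ
  rw [thresholdBody_exec hτ'.toHasConstants, hτ'.threshold, hτ'.count, hk,
    hτ.mem_eq Arr.total (by decide), hτ.idx_eq Reg.vertex (by decide)]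
  simp only [true_and]

lemma thresholdLoop_exec_of_ne (h : HasConstants σ) {i : ℕ} (hi : i ≠ σ.idx Reg.vertex) (j : ℕ) :
    ((loop Reg.run Reg.size thresholdBody).exec σ).1.mem Arr.output i j =
      σ.mem Arr.output i j := by
  refine loop_induction (fun _ τ => τ.mem Arr.output i j = σ.mem Arr.output i j) (fun _ _ h => h)
    rfl fun k _ τ hτ _ hI => ?_
  rw [thresholdBody_exec (h.of_agreeOutside hτ), hτ.idx_eq Reg.vertex (by decide),
    if_neg (not_and_of_not_left _ hi), hI]

lemma thresholdProg_exec (h : Ready p lam η β X σ) :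
    (∀ j < n, (thresholdProg.exec σ).1.mem Arr.output (σ.idx Reg.vertex) j =
      if j ≠ σ.idx Reg.vertex ∧ β / 2 ≤ |σ.mem Arr.total 0 j / T| then 1 else 0) ∧
    ∀ i ≠ σ.idx Reg.vertex, ∀ j,
      (thresholdProg.exec σ).1.mem Arr.output i j = σ.mem Arr.output i j := by
  have hmem (i j : ℕ) : (thresholdProg.exec σ).1.mem Arr.output i j =
      if i = σ.idx Reg.vertex ∧ j = σ.idx Reg.vertex then 0 else
        ((loop Reg.run Reg.size thresholdBody).exec σ).1.mem Arr.output i j := by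
    rw [← exec_idx_of_notMem (P := loop Reg.run Reg.size thresholdBody) (by decide) σ]
    change RAMState.mem (RAMState.set _ _ _) _ _ _ = _
    rw [mem_set]
    simp
  refine ⟨fun j hj => ?_, fun i hi j => ?_⟩
  · rw [hmem, thresholdLoop_exec h hj]
    grind
  · rw [hmem, if_neg (not_and_of_not_left _ hi), thresholdLoop_exec_of_ne h.toHasConstants hi]

open Classical in
lemma vertexProg_exec (h : Ready p lam η β X σ) (hu : σ.idx Reg.vertex = u) :
    (∀ i : Fin n, (vertexProg.exec σ).1.mem Arr.output u i =
      (estNeighbors p lam η β X u).indicator (fun _ => (1 : ℝ)) i) ∧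
    ∀ r ≠ (u : ℕ), ∀ j,
      (vertexProg.exec σ).1.mem Arr.output r j = σ.mem Arr.output r j := by
  have hτ := agreeOutside_exec initProg σ
  obtain ⟨hweights, htotal⟩ := initProg_exec h hu
  set τ := (initProg.exec σ).1
  have hready := h.of_agreeOutside hτ
  have hτu : τ.idx Reg.vertex = u := (hτ.idx_eq _ (by decide)).trans hu
  have hsum := timeLoop_exec hready hτu hweights htotal
  have hυ := agreeOutside_exec (loop Reg.time Reg.samples stepProg) τ
  set υ := ((loop Reg.time Reg.samples stepProg).exec τ).1
  obtain ⟨hrow, hother⟩ := thresholdProg_exec (hready.of_agreeOutside hυ)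
  rw [hυ.idx_eq _ (by decide), hτu] at hrow hother
  refine ⟨fun i => (hrow i i.2).trans ?_, fun r hr j => (hother r hr j).trans ?_⟩
  · have hmem : i ∈ estNeighbors p lam η β X u ↔
        (i : ℕ) ≠ u ∧ β / 2 ≤ |υ.mem Arr.total 0 i / T| := by
      rw [Fin.val_ne_iff, estNeighbors, Set.mem_ofPred, ← exists_prop]
      refine exists_congr fun hi => ?_
      rw [simplexToBall_smgOutput, hsum ⟨i, hi⟩, Fin.sum_univ_eq_sum_range fun t =>
        simplexToBall (smgIter u p lam η X t) ⟨i, hi⟩]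
    simp only [Set.indicator_apply, hmem]
  · rw [hυ.mem_eq _ (by decide), hτ.mem_eq _ (by decide)]

theorem mainProg_output (p : Fin n → ℝ) (lam η β : ℝ) (X : Fin T → Fin n → Entry) (u i : Fin n) :
    mainProg.output p lam η β X u i =
      (estNeighbors p lam η β X u).indicator (fun _ => (1 : ℝ)) i := by
  have h := ready_setupProg p lam η β X
  set σ := (setupProg.exec (inputState p lam η β X)).1
  have key := loop_induction (r := Reg.vertex) (s := Reg.size) (P := vertexProg) (σ := σ)
    (fun k τ => ∀ v : Fin n, (v : ℕ) < k → ∀ j : Fin n, τ.mem Arr.output v j =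
      (estNeighbors p lam η β X v).indicator (fun _ => (1 : ℝ)) j) (fun _ _ h => h) (by simp) ?_
  · exact key u (u.2.trans_eq h.idx_size.symm) i
  intro k hk τ hτ hvertex hI v hv j
  obtain ⟨hrow, hother⟩ :=
    vertexProg_exec (u := ⟨k, h.idx_size ▸ hk⟩) (h.of_agreeOutside hτ) hvertex
  rcases Nat.lt_succ_iff_lt_or_eq.1 hv with hvk | hvk
  · rw [hother v hvk.ne, hI v hvk]
  · rw [show v = ⟨k, h.idx_size ▸ hk⟩ from Fin.ext hvk]
    exact hrow j

end Ready

lemma simpleLoops_mainProg : mainProg.SimpleLoops := by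
  simp [mainProg, setupProg, constBlock, sizeBody, countBody, paramBlock, vertexProg, initProg,
    initBody, initVertex, stepProg, forwardPass, forwardInit, forwardBody, backwardPass,
    backwardInit, backwardBody, backwardScale, updateBody, thresholdProg, thresholdBody, block,
    SimpleLoops]

lemma cost_mainProg (n T : ℕ) : mainProg.cost n T =
    33 * (n ^ 2 * T) + 18 * (n * T) + 15 * n ^ 2 + 15 * n + 2 * T + 16 := by
  simp only [mainProg, setupProg, constBlock, sizeBody, countBody, paramBlock, vertexProg, initProg,
    initBody, initVertex, stepProg, forwardPass, forwardInit, forwardBody, backwardPass,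
    backwardInit, backwardBody, backwardScale, updateBody, thresholdProg, thresholdBody, block,
    cost, if_true, one_ne_zero, if_false]
  ring

lemma cost_mainProg_le {n T : ℕ} (hn : 1 ≤ n) (hT : 1 ≤ T) :
    mainProg.cost n T ≤ 99 * (n ^ 2 * T) := by
  have h₁ : n ≤ n ^ 2 := Nat.le_self_pow two_ne_zero n
  have h₂ : n ^ 2 ≤ n ^ 2 * T := Nat.le_mul_of_pos_right _ hT
  have h₃ : n * T ≤ n ^ 2 * T := Nat.mul_le_mul_right T h₁
  have h₄ : T ≤ n * T := Nat.le_mul_of_pos_left _ hn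
  rw [cost_mainProg]
  lia

theorem mainProg_steps_le {n T : ℕ} (hn : 1 ≤ n) (hT : 1 ≤ T) (p : Fin n → ℝ) (lam η β : ℝ)
    (X : Fin T → Fin n → Entry) :
    (mainProg.steps p lam η β X : ℝ) ≤ 99 * (n : ℝ) ^ 2 * T := by
  have h := (exec_snd_le_cost (by decide) (by decide) simpleLoops_mainProg
    (inputState p lam η β X)).trans (cost_mainProg_le hn hT)
  calc (mainProg.steps p lam η β X : ℝ) ≤ ((99 * (n ^ 2 * T) : ℕ) : ℝ) := Nat.cast_le.2 h
    _ = 99 * (n : ℝ) ^ 2 * T := by push_cast; ring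

end Prog

/-! ### Recovery by the program -/

lemma log_natCast_div_nonneg (m : ℕ) {δ : ℝ} (hδ0 : 0 < δ) (hδ1 : δ < 1) :
    0 ≤ Real.log (m / δ) := by
  rcases Nat.eq_zero_or_pos m with rfl | hm
  · simp
  · have hm : (1 : ℝ) ≤ m := by exact_mod_cast hm
    exact Real.log_nonneg ((one_le_div hδ0).2 (hδ1.le.trans hm))

lemma log_sq_div_le {x δ : ℝ} (hx : 0 < x) (hδ0 : 0 < δ) (hδ1 : δ < 1) :
    Real.log (x ^ 2 / δ) ≤ 2 * Real.log (x / δ) := by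
  have hle : x ^ 2 / δ ≤ (x / δ) ^ 2 := by
    rw [div_pow]
    exact div_le_div_of_nonneg_left (by positivity) (by positivity)
      (pow_le_of_le_one hδ0.le hδ1.le two_ne_zero)
  calc Real.log (x ^ 2 / δ) ≤ Real.log ((x / δ) ^ 2) := Real.log_le_log (by positivity) hle
    _ = 2 * Real.log (x / δ) := by rw [Real.log_pow, Nat.cast_two]

lemma exists_mul_ceil_sampleBound_le {C lam ε R : ℝ} (hlam : 0 < lam) (hε : 0 < ε) (hR : 0 < R) :
    ∃ M : ℝ, 0 < M ∧ ∀ (n : ℕ) (δ : ℝ), 2 ≤ n → 0 < δ → δ < 1 →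
      R * ⌈sampleBound C lam (Real.log ((n : ℝ) ^ 2 / δ)) ε⌉₊ ≤ M * Real.log (n / δ) := by
  set c := lam ^ 4 * Real.exp (C * lam) * (ε ^ 4)⁻¹
  have hlog2 : 0 < Real.log 2 := Real.log_pos one_lt_two
  refine ⟨R * (c * 2 + 1 / Real.log 2), by positivity, fun n δ hn hδ0 hδ1 => ?_⟩
  have hn1 := one_le_two.trans hn
  obtain ⟨hpos, -⟩ := log_pow_div_pos_and_log_le hn1 two_ne_zero hδ0 hδ1
  have hlog : Real.log 2 ≤ Real.log (n / δ) :=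
    Real.log_le_log two_pos ((Nat.ofNat_le_cast.2 hn).trans
      (le_div_self n.cast_nonneg hδ0 hδ1.le))
  have hbound : sampleBound C lam (Real.log ((n : ℝ) ^ 2 / δ)) ε =
      c * Real.log ((n : ℝ) ^ 2 / δ) := by
    rw [sampleBound]
    ring
  rw [hbound, mul_assoc R]
  gcongr
  calc (⌈c * Real.log ((n : ℝ) ^ 2 / δ)⌉₊ : ℝ) ≤ c * Real.log ((n : ℝ) ^ 2 / δ) + 1 :=
        (Nat.ceil_lt_add_one (by positivity)).le
    _ ≤ c * (2 * Real.log (n / δ)) + 1 / Real.log 2 * Real.log (n / δ) := by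
        gcongr
        · exact log_sq_div_le (Nat.cast_pos.2 hn1) hδ0 hδ1
        · rwa [one_div_mul_eq_div, one_le_div hlog2]
    _ = (c * 2 + 1 / Real.log 2) * Real.log (n / δ) := by ring

lemma one_le_ceil_sampleBound {C lam L ε : ℝ} (hlam : 0 < lam) (hL : 0 < L) (hε : 0 < ε) :
    1 ≤ ⌈sampleBound C lam L ε⌉₊ :=
  Nat.ceil_pos.2 (by rw [sampleBound]; positivity)

section

variable {n T : ℕ} {A : Matrix (Fin n) (Fin n) ℝ} {p : Fin n → ℝ} {q lam : ℝ}

theorem Prog.mainProg_recovers_depGraph (hA : A.IsSymm) (hd : ∀ i, A i i = 0) (hq : q < 1)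
    (hlam : 0 < lam) (hrow : ∀ i, ∑ j, |A i j| ≤ lam) (hp : ∀ i, 0 ≤ p i ∧ p i ≤ q) {δ β : ℝ}
    (hδ0 : 0 < δ) (hδ1 : δ < 1) (hβ : 0 < β) (hAβ : ∀ i j, A i j ≠ 0 → β ≤ |A i j|)
    (hT : explicitBound 1024 q lam (Real.log ((n : ℝ) ^ 2 / δ)) (β / 2) ≤ T) :
    1 - δ ≤ (sampleLaw A 0 p T).real
      {X | ∀ u i, mainProg.output p lam (stepSize q lam n T) β X u i =
        ((depGraph A).neighborSet u).indicator (fun _ => (1 : ℝ)) i} := by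
  have := isProbabilityMeasure_sampleLaw A 0 (fun i => ⟨(hp i).1, (hp i).2.trans hq.le⟩) T
  refine (graph_recovery hA hd hq hlam hrow hp hδ0 hδ1 hβ hAβ hT).trans
    (measureReal_mono fun X hX u i => ?_)
  rw [mainProg_output, hX u]

end

end IsingMissing

end

theorem mainTheorem1 :
    ∃ (K R : ℝ) (P : Prog), 0 < K ∧ 0 < R ∧
      -- One fixed program runs the algorithm for every vertex on the same samples, thresholds the
      -- results, and takes at most `R n² T` steps.
      (∀ (n T : ℕ) (p : Fin n → ℝ) (lam η β : ℝ) (X : Fin T → Fin n → Entry), 1 ≤ n → 1 ≤ T →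
        (∀ u i, P.output p lam η β X u i =
          (estNeighbors p lam η β X u).indicator (fun _ => (1 : ℝ)) i) ∧
        (P.steps p lam η β X : ℝ) ≤ R * (n : ℝ) ^ 2 * T) ∧
      ∀ q lam₀ : ℝ, 0 ≤ q → q < 1 → 0 < lam₀ → ∃ C : ℝ, 0 < C ∧
        (∀ (n T : ℕ) (A : Matrix (Fin n) (Fin n) ℝ) (p : Fin n → ℝ) (lam δ : ℝ),
          A.IsSymm → (∀ i, A i i = 0) → 0 < lam → (∀ i, ∑ j, |A i j| ≤ lam) →
          (∀ i, 0 ≤ p i ∧ p i ≤ q) → 0 < δ → δ < 1 →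
          -- Recovery of the weights at one vertex.
          (∀ (u : Fin n) (ε : ℝ), 0 < ε →
            (explicitBound K q lam (Real.log (n / δ)) ε ≤ T ∨
              (lam₀ ≤ lam ∧ sampleBound C lam (Real.log (n / δ)) ε ≤ T)) →
            1 - δ ≤ (sampleLaw A 0 p T).real
              {X | ∀ i : Others u,
                |simplexToBall (smgOutput u p lam (stepSize q lam n T) X) i - A u i| ≤ ε}) ∧
          -- Recovery of the whole graph.
          (∀ β : ℝ, 0 < β → (∀ i j, A i j ≠ 0 → β ≤ |A i j|) →
            (explicitBound K q lam (Real.log ((n : ℝ) ^ 2 / δ)) (β / 2) ≤ T ∨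
              (lam₀ ≤ lam ∧ sampleBound C lam (Real.log ((n : ℝ) ^ 2 / δ)) (β / 2) ≤ T)) →
            1 - δ ≤ (sampleLaw A 0 p T).real
              {X | ∀ u, estNeighbors p lam (stepSize q lam n T) β X u =
                (depGraph A).neighborSet u})) ∧
        -- With the stated number of samples, the program recovers the whole graph in
        -- `O(n² log (n / δ))` steps, for fixed `q, lam, β`.
        (∀ lam β : ℝ, lam₀ ≤ lam → 0 < β → ∃ M : ℝ, 0 < M ∧
          ∀ (n T : ℕ) (A : Matrix (Fin n) (Fin n) ℝ) (p : Fin n → ℝ) (δ : ℝ),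
            2 ≤ n → A.IsSymm → (∀ i, A i i = 0) → (∀ i, ∑ j, |A i j| ≤ lam) →
            (∀ i, 0 ≤ p i ∧ p i ≤ q) → 0 < δ → δ < 1 →
            (∀ i j, A i j ≠ 0 → β ≤ |A i j|) →
            T = ⌈sampleBound C lam (Real.log ((n : ℝ) ^ 2 / δ)) (β / 2)⌉₊ →
            1 - δ ≤ (sampleLaw A 0 p T).real
              {X | ∀ u i, P.output p lam (stepSize q lam n T) β X u i =
                ((depGraph A).neighborSet u).indicator (fun _ => (1 : ℝ)) i} ∧
            ∀ X : Fin T → Fin n → Entry,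
              (P.steps p lam (stepSize q lam n T) β X : ℝ) ≤
                M * (n : ℝ) ^ 2 * Real.log (n / δ)) := by
  refine ⟨1024, 99, Prog.mainProg, by norm_num, by norm_num, fun n T p lam η β X hn hT =>
    ⟨Prog.mainProg_output p lam η β X, Prog.mainProg_steps_le hn hT p lam η β X⟩,
    fun q lam₀ _ hq hlam₀ => ?_⟩
  obtain ⟨C, hC0, hC⟩ := exists_explicitBound_le_sampleBound (K := 1024) (by norm_num) hq hlam₀
  refine ⟨C, hC0, fun n T A p lam δ hA hd hlam hrow hp hδ0 hδ1 =>
    ⟨fun u ε hε hT => ?_, fun β hβ hAβ hT => ?_⟩, fun lam β hlam hβ => ?_⟩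
  · exact weight_recovery hA hd hq hlam hrow hp hδ0 hδ1 hε u <|
      hT.elim id fun h => (hC lam _ ε h.1 (log_natCast_div_nonneg n hδ0 hδ1)).trans h.2
  · have hL : 0 ≤ Real.log ((n : ℝ) ^ 2 / δ) := mod_cast log_natCast_div_nonneg (n ^ 2) hδ0 hδ1
    exact graph_recovery hA hd hq hlam hrow hp hδ0 hδ1 hβ hAβ <|
      hT.elim id fun h => (hC lam _ _ h.1 hL).trans h.2
  · have hlam0 := hlam₀.trans_le hlam
    obtain ⟨M, hM0, hM⟩ := exists_mul_ceil_sampleBound_le (C := C) (R := 99) hlam0 (half_pos hβ)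
      (by norm_num)
    refine ⟨M, hM0, fun n T A p δ hn hA hd hrow hp hδ0 hδ1 hAβ hT => ?_⟩
    subst hT
    have hn1 : 1 ≤ n := one_le_two.trans hn
    have hL := (log_pow_div_pos_and_log_le hn1 two_ne_zero hδ0 hδ1).1
    refine ⟨Prog.mainProg_recovers_depGraph hA hd hq hlam0 hrow hp hδ0 hδ1 hβ hAβ
      ((hC lam _ _ hlam hL.le).trans (Nat.le_ceil _)), fun X =>
      (Prog.mainProg_steps_le hn1 (one_le_ceil_sampleBound hlam0 hL (half_pos hβ)) ..).trans ?_⟩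
    rw [mul_right_comm, mul_right_comm M]
    exact mul_le_mul_of_nonneg_right (hM n δ hn hδ0 hδ1) (sq_nonneg _)
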